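/- Let $0<\epsilon<\frac16$ be a real number and $M$ a positive integer. Then there is a finite set $\Gamma_0'$ of positive integers, depending only on $\epsilon$ and $M$, with the following property. Let $r$ be a positive integer, $0\le a_1,a_2,a_3,a_4,e<r$ integers, $\xi_r=e^{2\pi i/r}$, $\boldsymbol\mu$ the action $x_i\mapsto \xi_r^{a_i}x_i$ on $\mathbb C^4$, $\mathfrak m$ the maximal ideal of $\mathbb C\{x_1,x_2,x_3,x_4\}$, and $f\in\mathbb C\{x_1,x_2,x_3,x_4\}$ with $\boldsymbol\mu(f)=\xi_r^e f$. Let $Y=(f=0)\subset(\mathbb C^4\ni 0)$ and $X=Y/\boldsymbol\mu$, with $x\in X$ the image of the origin. Suppose that * $Y$ is an isolated cDV singularity, $X\ni x$ is an isolated singularity (that is, the group generated by $\boldsymbol\mu$ acts freely on $Y$ outside the origin), and $Y\to X$ is the index $1$ cover; * $a(E,X)\ne 1$ for every prime divisor $E$ over $X\ni x$ (with center $x$), and $\frac56+\epsilon\le \mathrm{mld}(X\ni x)<1$, where $a(E,X)$ is the log discrepancy and $\mathrm{mld}(X\ni x)$ is the infimum of $a(E,X)$ over all such $E$; * $a_1+a_2+a_3+a_4-e\equiv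 1 \bmod r$; * $f$ is not of cA type but in one of the following normal forms: either $f=x_1^2+x_2^2+g(x_3,x_4)$ with $g\in\mathfrak m^3$ and $a_1\not\equiv a_2\bmod r$, or $f=x_1^2+g(x_2,x_3,x_4)$ with $g\in\mathfrak m^3$. For a weight $w\in\mathbb Q_{\ge0}^4$ and a power series $h\neq 0$ let $w(h)$ be the minimum of $w(\boldsymbol x^{\boldsymbol n})=\sum_i w_in_i$ over the monomials $\boldsymbol x^{\boldsymbol n}$ occurring in $h$. Let $N$ be the set of nonzero $w\in\mathbb Q^4_{\ge 0}$ with $w\equiv\frac1r(ja_1,ja_2,ja_3,ja_4)\bmod\mathbb Z^4$ for some $j\in\mathbb Z$; a vector of $N$ is primitive if it is not $l v$ with $v\in N$ and an integer $l\ge2$. Let $N^0=(N\cap[0,1]^4)\setminus\{0,1\}^4$, let $\alpha_j=(\{\frac{ja_1}r\},\{\frac{ja_2}r\},\{\frac{ja_3}r\},\{\frac{ja_4}r\})$ for $1\le j\le r-1$, and let $\Psi_1$ be the set of primitive $\beta\in N$ with $\frac56+\epsilon\le\beta(x_1x_2x_3x_4)-\beta(f)<1$. Suppose moreover that 1. $2a_1\equiv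 e \bmod r$; 2. $7\le\gcd(a_1,r)=\gcd(e,r)\le M$; 3. $r\mid k_\beta e$ for every $\beta\in\Psi_1\cap N^0$ and every integer $1\le k_\beta\le r-1$ with $\beta=\alpha_{k_\beta}$. Then $r\in\Gamma_0'$. -/

import Mathlib

namespace Hyperquotient

open MvPowerSeries

/-! ### Convergent power series in four variables -/

/-- A power series in `x₁, …, x₄` (indices `0, …, 3` here) with complex coefficients converges
near the origin. -/
def IsConvergent (h : MvPowerSeries (Fin 4) ℂ) : Prop :=
  ∃ ρ : ℝ, 0 < ρ ∧ Summable fun n : Fin 4 →₀ ℕ => ‖coeff n h‖ * ρ ^ n.degree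

theorem IsConvergent.mono {h : MvPowerSeries (Fin 4) ℂ} {ρ ρ' : ℝ} (h0 : 0 ≤ ρ') (h1 : ρ' ≤ ρ)
    (hs : Summable fun n : Fin 4 →₀ ℕ => ‖coeff n h‖ * ρ ^ n.degree) :
    Summable fun n : Fin 4 →₀ ℕ => ‖coeff n h‖ * ρ' ^ n.degree :=
  Summable.of_nonneg_of_le (fun n => by positivity) (fun n => by gcongr) hs

theorem isConvergent_of_finite {h : MvPowerSeries (Fin 4) ℂ} {s : Finset (Fin 4 →₀ ℕ)}
    (hs : ∀ n ∉ s, coeff n h = 0) : IsConvergent h :=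
  ⟨1, one_pos, summable_of_ne_finset_zero (s := s) fun n hn => by simp [hs n hn]⟩

theorem IsConvergent.add {h k : MvPowerSeries (Fin 4) ℂ} (hh : IsConvergent h)
    (hk : IsConvergent k) : IsConvergent (h + k) := by
  obtain ⟨ρ, hρ, hs⟩ := hh
  obtain ⟨σ, hσ, ht⟩ := hk
  have hm : 0 < min ρ σ := lt_min hρ hσ
  refine ⟨min ρ σ, hm, ?_⟩
  refine Summable.of_nonneg_of_le (fun n => by positivity) (fun n => ?_)
    ((IsConvergent.mono hm.le (min_le_left _ _) hs).add
      (IsConvergent.mono hm.le (min_le_right _ _) ht))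
  rw [map_add, ← add_mul]
  gcongr
  exact norm_add_le _ _

theorem summable_convolution {ι : Type*} [AddCommMonoid ι] [Finset.HasAntidiagonal ι]
    (d : ι →+ ℕ) (u v : ι → ℂ) (m : ℝ) (hm : 0 < m)
    (h1 : Summable fun n => ‖u n‖ * m ^ d n) (h2 : Summable fun n => ‖v n‖ * m ^ d n) :
    Summable fun n => ‖∑ p ∈ Finset.HasAntidiagonal.antidiagonal n, u p.1 * v p.2‖ * m ^ d n := by
  have h3 : Summable fun p : ι × ι =>
      (‖u p.1‖ * m ^ d p.1) * (‖v p.2‖ * m ^ d p.2) :=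
    Summable.mul_of_nonneg h1 h2 (fun n => by positivity) (fun n => by positivity)
  have h4 := summable_sum_mul_antidiagonal_of_summable_mul 
    (f := fun n => ‖u n‖ * m ^ d n)
    (g := fun n => ‖v n‖ * m ^ d n) h3
  refine Summable.of_nonneg_of_le (fun n => by positivity) (fun n => ?_) h4
  have : ∀ p ∈ Finset.HasAntidiagonal.antidiagonal n, ‖u p.1‖ * m ^ d p.1 * (‖v p.2‖ * m ^ d p.2) = ‖u p.1‖ * ‖v p.2‖ * m ^ d n := by
    intro p hp
    rw [← Finset.HasAntidiagonal.mem_antidiagonal.mp hp, map_add, pow_add]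
    ring
  rw [Finset.sum_congr rfl this, ← Finset.sum_mul]
  gcongr
  refine (norm_sum_le _ _).trans (Finset.sum_le_sum fun p _ => ?_)
  exact norm_mul_le _ _

theorem IsConvergent.mul {h k : MvPowerSeries (Fin 4) ℂ} (hh : IsConvergent h)
    (hk : IsConvergent k) : IsConvergent (h * k) := by
  classical
  obtain ⟨ρ, hρ, hs⟩ := hh
  obtain ⟨σ, hσ, ht⟩ := hk
  have hm : 0 < min ρ σ := lt_min hρ hσ
  refine ⟨min ρ σ, hm, ?_⟩
  simp only [coeff_mul]
  exact summable_convolution Finsupp.degree (fun n => coeff n h) (fun n => coeff n k) _ hm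
    (IsConvergent.mono hm.le (min_le_left _ _) hs) (IsConvergent.mono hm.le (min_le_right _ _) ht)

theorem isConvergent_C (c : ℂ) : IsConvergent (C c) := by
  classical
  refine isConvergent_of_finite (s := {0}) fun n hn => ?_
  rw [coeff_C, if_neg (by simpa using hn)]

theorem isConvergent_X (i : Fin 4) : IsConvergent (X i) := by
  classical
  refine isConvergent_of_finite (s := {Finsupp.single i 1}) fun n hn => ?_
  rw [coeff_X, if_neg (by simpa using hn)]

/-- The ring `ℂ{x₁, x₂, x₃, x₄}` of convergent power series. -/
def ConvSeries : Subalgebra ℂ (MvPowerSeries (Fin 4) ℂ) where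
  carrier := {h | IsConvergent h}
  mul_mem' := IsConvergent.mul
  add_mem' := IsConvergent.add
  algebraMap_mem' c := isConvergent_C c

noncomputable instance : CommRing ConvSeries := Subalgebra.toCommRing ConvSeries

/-- The coordinate functions. -/
noncomputable def coord (i : Fin 4) : ConvSeries := ⟨X i, isConvergent_X i⟩

theorem IsConvergent.pderiv {h : MvPowerSeries (Fin 4) ℂ} (hh : IsConvergent h) (i : Fin 4) :
    IsConvergent (MvPowerSeries.pderiv ℂ i h) := by
  obtain ⟨ρ, hρ, hs⟩ := hh
  refine ⟨ρ / 2, by positivity, ?_⟩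
  have hinj : Function.Injective fun n : Fin 4 →₀ ℕ => n + Finsupp.single i 1 :=
    add_left_injective _
  have h1 := (hs.comp_injective hinj).mul_right (2 / ρ)
  refine Summable.of_nonneg_of_le (fun n => by positivity) (fun n => ?_) h1
  have hle : ((n i : ℝ) + 1) ≤ 2 * 2 ^ n.degree := by
    have h2 : n i ≤ n.degree := Finsupp.le_degree i n
    have h3 : n.degree + 1 ≤ 2 ^ (n.degree + 1) := Nat.lt_two_pow_self.le
    have h4 : n i + 1 ≤ 2 * 2 ^ n.degree := by rw [pow_succ] at h3; omega
    exact_mod_cast h4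
  have hn : ‖((n i : ℂ) + 1)‖ = (n i : ℝ) + 1 := by
    have : ((n i : ℂ) + 1) = ((n i + 1 : ℕ) : ℂ) := by push_cast; ring
    rw [this, Complex.norm_natCast]; push_cast; ring
  rw [MvPowerSeries.coeff_pderiv, norm_mul, hn, div_pow]
  simp only [Function.comp, map_add, Finsupp.degree_single, pow_add, pow_one]
  have hpos : (0 : ℝ) < 2 ^ n.degree := by positivity
  calc ‖coeff (n + Finsupp.single i 1) h‖ * ((n i : ℝ) + 1) * (ρ ^ n.degree / 2 ^ n.degree)
      ≤ ‖coeff (n + Finsupp.single i 1) h‖ * (2 * 2 ^ n.degree)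
          * (ρ ^ n.degree / 2 ^ n.degree) := by gcongr
    _ = _ := by field_simp

/-- The partial derivative `∂/∂xᵢ` on `ℂ{x₁, x₂, x₃, x₄}`. -/
noncomputable def partialDeriv (i : Fin 4) (h : ConvSeries) : ConvSeries :=
  ⟨MvPowerSeries.pderiv ℂ i h.1, IsConvergent.pderiv h.2 i⟩

/-! ### The action of the cyclic group -/

/-- The primitive root of unity `ξ_r = exp (2πi / r)`. -/
noncomputable def xi (r : ℕ) : ℂ := Complex.exp (2 * Real.pi * Complex.I / r)

theorem norm_xi (r : ℕ) : ‖xi r‖ = 1 := by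
  have h : (2 * Real.pi * Complex.I / r : ℂ) = ((2 * Real.pi / r : ℝ) : ℂ) * Complex.I := by
    push_cast; ring
  rw [xi, h, Complex.norm_exp_ofReal_mul_I]

theorem IsConvergent.rescale {h : MvPowerSeries (Fin 4) ℂ} (hh : IsConvergent h) (r : ℕ)
    (a : Fin 4 → ℕ) : IsConvergent (MvPowerSeries.rescale (fun i => xi r ^ a i) h) := by
  obtain ⟨ρ, hρ, hs⟩ := hh
  refine ⟨ρ, hρ, ?_⟩
  convert hs using 3 with n
  rw [coeff_rescale, norm_mul, Finsupp.prod, norm_prod]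
  simp [norm_xi]

/-- The generator `μ` of the group acting on `ℂ{x₁, …, x₄}` by
`xᵢ ↦ ξ_r ^ aᵢ xᵢ`. -/
noncomputable def mu (r : ℕ) (a : Fin 4 → ℕ) : ConvSeries →ₐ[ℂ] ConvSeries where
  toFun h := ⟨rescale (fun i => xi r ^ a i) h.1, h.2.rescale r a⟩
  map_one' := Subtype.ext (map_one _)
  map_mul' h k := Subtype.ext (map_mul _ _ _)
  map_zero' := Subtype.ext (map_zero _)
  map_add' h k := Subtype.ext (map_add _ _ _)
  commutes' c := by
    classical
    refine Subtype.ext (MvPowerSeries.ext fun n => ?_)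
    change coeff n (rescale _ (C c)) = coeff n (C c)
    rw [coeff_rescale, coeff_C]
    split_ifs with hn
    · simp [hn]
    · simp

/-- The local ring of the germ `Y = (f = 0)` at the origin. -/
abbrev LocalRingY (f : ConvSeries) : Type := ConvSeries ⧸ Ideal.span {f}

noncomputable instance (f : ConvSeries) : CommRing (LocalRingY f) :=
  Ideal.Quotient.commRing (Ideal.span {f})

/-- The class in `𝒪_Y` of a convergent power series. -/
noncomputable abbrev toY (f : ConvSeries) : ConvSeries →ₐ[ℂ] LocalRingY f :=
  Ideal.Quotient.mkₐ ℂ (Ideal.span {f})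

/-- The local ring of `X = (f = 0) / μ`: the ring of invariants of `𝒪_Y`, that is, the classes of
the series `h` for which `μ h` and `h` agree on `Y`. -/
noncomputable def LocalRingX (r : ℕ) (a : Fin 4 → ℕ) (f : ConvSeries) :
    Subalgebra ℂ (LocalRingY f) :=
  (AlgHom.equalizer ((toY f).comp (mu r a)) (toY f)).map (toY f)

noncomputable instance (r : ℕ) (a : Fin 4 → ℕ) (f : ConvSeries) : CommRing (LocalRingX r a f) :=
  Subalgebra.toCommRing (LocalRingX r a f)

noncomputable instance (r : ℕ) (a : Fin 4 → ℕ) (f : ConvSeries) : Algebra ℂ (LocalRingX r a f) :=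
  Subalgebra.algebra (LocalRingX r a f)

/-! ### Properties of the germ and of the quotient map -/

/-- The singular locus of `(f = 0)`, defined by `f` and its partial derivatives, is supported at
the origin. -/
def HasIsolatedSingularity (f : ConvSeries) : Prop :=
  ∀ i, coord i ∈ (Ideal.span (insert f (Set.range fun j => partialDeriv j f))).radical

/-- The equations of the Du Val surface singularities `A_n` (`n ≥ 1`), `D_n` (`n ≥ 4`), `E₆`,
`E₇`, `E₈` in the coordinates `x₁, x₂, x₃`. -/
inductive IsDuValEquation : ConvSeries → Prop
  | A (n : ℕ) (hn : 1 ≤ n) :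
      IsDuValEquation (coord 0 ^ 2 + coord 1 ^ 2 + coord 2 ^ (n + 1))
  | D (n : ℕ) (hn : 4 ≤ n) :
      IsDuValEquation (coord 0 ^ 2 + coord 1 ^ 2 * coord 2 + coord 2 ^ (n - 1))
  | E6 : IsDuValEquation (coord 0 ^ 2 + coord 1 ^ 3 + coord 2 ^ 4)
  | E7 : IsDuValEquation (coord 0 ^ 2 + coord 1 ^ 3 + coord 1 * coord 2 ^ 3)
  | E8 : IsDuValEquation (coord 0 ^ 2 + coord 1 ^ 3 + coord 2 ^ 5)

/-- `(f = 0)` is a compound Du Val (cDV) singularity: in suitable analytic coordinates and up to a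
unit its equation is `p(x₁, x₂, x₃) + x₄ k(x₁, x₂, x₃, x₄)` with `p` a Du Val equation. -/
def IsCDV (f : ConvSeries) : Prop :=
  ∃ (φ : ConvSeries ≃ₐ[ℂ] ConvSeries) (p k : ConvSeries),
    IsDuValEquation p ∧ Associated (φ f) (p + coord 3 * k)

/-- The group generated by `μ` acts freely on `Y` outside the origin: for every nontrivial element
`μ ^ j`, its fixed locus in `Y`, which is cut out by the coordinates that `μ ^ j` does not fix, is
supported at the origin. -/
def ActsFreelyOutsideOrigin (r : ℕ) (a : Fin 4 → ℕ) (f : ConvSeries) : Prop :=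
  ∀ j : ℕ, ¬ r ∣ j → ∀ i,
    coord i ∈ (Ideal.span (insert f {h | ∃ l, ¬ r ∣ j * a l ∧ h = coord l})).radical

/-- `X` has an isolated singularity and `Y → X` is its index one cover: the group acts freely
outside the origin, and it acts on the generator of `ω_Y` (the residue of
`dx₁ ∧ dx₂ ∧ dx₃ ∧ dx₄ / f`, which `μ` multiplies by `ξ_r ^ (∑ aᵢ - e)`) through a character of
order exactly `r`, so that `r` is the Cartier index of `K_X`. -/
def IsIndexOneCover (r : ℕ) (a : Fin 4 → ℕ) (e : ℕ) (f : ConvSeries) : Prop :=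
  ActsFreelyOutsideOrigin r a f ∧ IsCoprime ((∑ i, (a i : ℤ)) - e) (r : ℤ)

/-! ### Prime divisors, log discrepancies, and the minimal log discrepancy -/

/-- The discrete valuation ring `V` is (the local ring at its generic point of) a prime divisor
over the threefold germ with local ring `R`, with center the closed point: `V` has the same
fraction field as `R`, it dominates `R`, and its residue field has transcendence degree `2 = 3 - 1`
over `ℂ`. -/
structure IsPrimeDivisorOver (R V : Type) [CommRing R] [Algebra ℂ R] [CommRing V] [IsDomain V]
    [IsDiscreteValuationRing V] [Algebra ℂ V] [Algebra R V] [IsScalarTower ℂ R V] : Prop where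
  injective : Function.Injective (algebraMap R V)
  sameFractionField : ∀ v : V, ∃ p q : R, q ≠ 0 ∧ v * algebraMap R V q = algebraMap R V p
  dominates : IsLocalHom (algebraMap R V)
  trdeg_residueField : Algebra.trdeg ℂ (IsLocalRing.ResidueField V) = 2

/-- The 3-form `dv₁ ∧ dv₂ ∧ dv₃` in `⋀³ Ω_{V/ℂ}`. -/
noncomputable def wedgeD (V : Type) [CommRing V] [Algebra ℂ V] (v : Fin 3 → V) :
    ⋀[V]^3 (Ω[V⁄ℂ]) :=
  exteriorPower.ιMulti V 3 fun i => KaehlerDifferential.D ℂ V (v i)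

/-- The 3-form `ω` vanishes along the divisor of `V` to order exactly `k`. -/
def VanishesToOrder (V : Type) [CommRing V] [IsLocalRing V] [Algebra ℂ V]
    (ω : ⋀[V]^3 (Ω[V⁄ℂ])) (k : ℕ) : Prop :=
  ω ∈ (IsLocalRing.maximalIdeal V ^ k) • (⊤ : Submodule V (⋀[V]^3 (Ω[V⁄ℂ]))) ∧
    ω ∉ (IsLocalRing.maximalIdeal V ^ (k + 1)) • (⊤ : Submodule V (⋀[V]^3 (Ω[V⁄ℂ])))

/-- The Jacobian determinant `∂(f, h₁, h₂, h₃) / ∂(x₁, x₂, x₃, x₄)`. -/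
noncomputable def jacobian (f : ConvSeries) (h : Fin 3 → ConvSeries) : ConvSeries :=
  Matrix.det (Matrix.of fun i j : Fin 4 =>
    partialDeriv j ((Fin.cons f h : Fin 4 → ConvSeries) i))

/-- `c` is the log discrepancy `a(E, X)` of the prime divisor `E` over `X` with local ring `V`.

Let `s` be the generator of `ω_Y` given by the residue of `dx₁ ∧ dx₂ ∧ dx₃ ∧ dx₄ / f`. Then `s ^ r`
generates `𝒪_X(r K_X)`, and `a(E, X) = 1 + ord_E (s ^ r) / r`, where `s ^ r` is regarded as a
rational section of the `r`-th power of the canonical sheaf of a resolution on which `E` lies.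
For functions `u₁, u₂, u₃` on `X` lifted to `h₁, h₂, h₃`, one has
`du₁ ∧ du₂ ∧ du₃ = J s` on `Y` with `J` the Jacobian determinant of `f, h₁, h₂, h₃`. Hence, when
`J ≠ 0` on `Y`, `ord_E (s ^ r) = r ord_E (du₁ ∧ du₂ ∧ du₃) - ord_E (J ^ r)`, for any choice of the
`uᵢ`; note that `J ^ r` is a function on `X`. -/
def HasLogDiscrepancy (r : ℕ) (a : Fin 4 → ℕ) (f : ConvSeries) (V : Type) [CommRing V]
    [IsDomain V] [IsDiscreteValuationRing V] [Algebra ℂ V] [Algebra (LocalRingX r a f) V]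
    (c : ℝ) : Prop :=
  ∃ (u : Fin 3 → LocalRingX r a f) (h : Fin 3 → ConvSeries) (J : LocalRingX r a f) (k m : ℕ),
    (∀ i, toY f (h i) = (u i : LocalRingY f)) ∧
    (J : LocalRingY f) = toY f (jacobian f h) ^ r ∧ J ≠ 0 ∧
    VanishesToOrder V (wedgeD V fun i => algebraMap (LocalRingX r a f) V (u i)) k ∧
    IsDiscreteValuationRing.addVal V (algebraMap (LocalRingX r a f) V J) = m ∧
    c = 1 + (k : ℝ) - (m : ℝ) / r

/-- The set of the log discrepancies `a(E, X)` of all prime divisors `E` over `X ∋ x`. -/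
def logDiscrepancies (r : ℕ) (a : Fin 4 → ℕ) (f : ConvSeries) : Set ℝ :=
  {c | ∃ (V : Type) (_ : CommRing V) (_ : IsDomain V) (_ : IsDiscreteValuationRing V)
    (_ : Algebra ℂ V) (_ : Algebra (LocalRingX r a f) V)
    (_ : IsScalarTower ℂ (LocalRingX r a f) V),
    IsPrimeDivisorOver (LocalRingX r a f) V ∧ HasLogDiscrepancy r a f V c}

/-- The minimal log discrepancy `mld(X ∋ x)`. -/
noncomputable def mld (r : ℕ) (a : Fin 4 → ℕ) (f : ConvSeries) : EReal :=
  sInf ((fun c : ℝ => (c : EReal)) '' logDiscrepancies r a f)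

/-- The hyperquotient singularity `X = (f = 0) / (1/r)(a₁, a₂, a₃, a₄)`, with `f` semi-invariant of
weight `e`: `Y = (f = 0)` is an isolated cDV singularity, `Y → X` is the index one cover, `X` is
isolated, no prime divisor over `X ∋ x` has log discrepancy `1`, and
`5/6 + ε ≤ mld(X ∋ x) < 1`. -/
structure IsHyperquotientSingularity (ε : ℝ) (r : ℕ) (a : Fin 4 → ℕ) (e : ℕ)
    (f : ConvSeries) : Prop where
  a_lt : ∀ i, a i < r
  e_lt : e < r
  semiInvariant : mu r a f = xi r ^ e • f
  isolated : HasIsolatedSingularity f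
  cDV : IsCDV f
  indexOneCover : IsIndexOneCover r a e f
  logDiscrepancy_ne_one : (1 : ℝ) ∉ logDiscrepancies r a f
  le_mld : ((5 / 6 + ε : ℝ) : EReal) ≤ mld r a f
  mld_lt : mld r a f < 1

/-! ### The non-cA normal forms -/

/-- Odd type: `f = x₁² + x₂² + g(x₃, x₄)` with `g ∈ 𝔪³` and `a₁ ≢ a₂ mod r`. -/
def IsOddType (r : ℕ) (a : Fin 4 → ℕ) (f : ConvSeries) : Prop :=
  ¬ a 0 ≡ a 1 [MOD r] ∧ ∃ g : ConvSeries, f = coord 0 ^ 2 + coord 1 ^ 2 + g ∧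
    ∀ n, coeff n g.1 ≠ 0 → n 0 = 0 ∧ n 1 = 0 ∧ 3 ≤ n.degree

/-- cD-E type: `f = x₁² + g(x₂, x₃, x₄)` with `g ∈ 𝔪³`. -/
def IsCDEType (f : ConvSeries) : Prop :=
  ∃ g : ConvSeries, f = coord 0 ^ 2 + g ∧ ∀ n, coeff n g.1 ≠ 0 → n 0 = 0 ∧ 3 ≤ n.degree

/-! ### Weights -/

/-- The weight `w(h)`, the minimum of `w(x^n)` over the monomials `x^n` that occur in `h`. It is
used for `h ≠ 0` and rational weights `w ≥ 0` only, where the minimum is attained. -/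
noncomputable def weight (w : Fin 4 → ℚ) (h : ConvSeries) : ℝ :=
  sInf {s : ℝ | ∃ n : Fin 4 →₀ ℕ, coeff n h.1 ≠ 0 ∧ s = ((∑ i, w i * n i : ℚ) : ℝ)}

/-- The set `N` of nonzero weights `w ∈ ℚ⁴_{≥ 0}` with `w ≡ (j/r)(a₁, a₂, a₃, a₄) mod ℤ⁴` for some
integer `j`. -/
def weightSet (r : ℕ) (a : Fin 4 → ℕ) : Set (Fin 4 → ℚ) :=
  {w | (∀ i, 0 ≤ w i) ∧ w ≠ 0 ∧ ∃ j : ℤ, ∀ i, ∃ m : ℤ, w i = (j * a i : ℚ) / r + m}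

/-- `N⁰ = N ∩ [0,1]⁴ \ {0,1}⁴`. -/
def weightSetZero (r : ℕ) (a : Fin 4 → ℕ) : Set (Fin 4 → ℚ) :=
  {w | w ∈ weightSet r a ∧ (∀ i, w i ≤ 1) ∧ ¬ ∀ i, w i = 0 ∨ w i = 1}

/-- `w` is a primitive vector of `N`: it lies in `N` and it is not an integer multiple `l v` of a
vector `v ∈ N` with `l ≥ 2`. -/
def IsPrimitive (r : ℕ) (a : Fin 4 → ℕ) (w : Fin 4 → ℚ) : Prop :=
  w ∈ weightSet r a ∧ ∀ l : ℕ, 2 ≤ l → ∀ v ∈ weightSet r a, w ≠ (l : ℚ) • v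

/-- `Ψ₁`: the primitive `β ∈ N` with `5/6 + ε ≤ β(x₁x₂x₃x₄) - β(f) < 1`. -/
def Psi1 (ε : ℝ) (r : ℕ) (a : Fin 4 → ℕ) (f : ConvSeries) : Set (Fin 4 → ℚ) :=
  {β | IsPrimitive r a β ∧ 5 / 6 + ε ≤ ((∑ i, β i : ℚ) : ℝ) - weight β f ∧
    ((∑ i, β i : ℚ) : ℝ) - weight β f < 1}

/-- `α_j = ({j a₁ / r}, {j a₂ / r}, {j a₃ / r}, {j a₄ / r})`. -/
def alpha (r : ℕ) (a : Fin 4 → ℕ) (j : ℕ) : Fin 4 → ℚ :=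
  fun i => Int.fract ((j * a i : ℚ) / r)

/-- The special alternative, with bound `M`: `2 a₁ ≡ e mod r`,
`7 ≤ gcd(a₁, r) = gcd(e, r) ≤ M`, and `r ∣ k_β e` whenever `β = α_{k_β}` lies in `Ψ₁ ∩ N⁰`, where
`1 ≤ k_β ≤ r - 1`. -/
structure SpecialAlternative (M : ℕ) (ε : ℝ) (r : ℕ) (a : Fin 4 → ℕ) (e : ℕ)
    (f : ConvSeries) : Prop where
  two_mul_modEq : 2 * a 0 ≡ e [MOD r]
  seven_le : 7 ≤ Nat.gcd (a 0) r
  gcd_eq : Nat.gcd (a 0) r = Nat.gcd e r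
  gcd_le : Nat.gcd e r ≤ M
  dvd_mul : ∀ β ∈ Psi1 ε r a f ∩ weightSetZero r a, ∀ k : ℕ, 1 ≤ k → k < r →
    β = alpha r a k → r ∣ k * e

end Hyperquotient

/-! Coordinates are numbered x₀, …, x₃, as in `coord`. The proof shows r = gcd(e, r), and this is at
most M.

The odd type does not occur: d = gcd(a₀, r) divides a₀ and, since x₁² occurs in f, also 2a₁, so some
nontrivial power of μ fixes a branch of the curve x₀² + x₁² = 0, x₂ = x₃ = 0 of Y pointwise
(`not_isOddType`). Hence f = x₀² + g(x₁, x₂, x₃), and freeness along similar curves makes a₁, a₂, a₃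
prime to r (`coprime_of_isCDEType`).

The geometric input is `weight_inequality`: every positive integral weight b ≡ ja mod r satisfies Σ
bᵢ − b(f) ≥ (5/6 + ε) r. This is the bound that the mld puts on weighted blowups, but no blowup is
constructed. If x₀² and g have the same b-weight, put x₁ = X^b₁, x₂ = s₀X^b₂, x₃ = s₁X^b₃ with s₀,
s₁ algebraically independent over ℂ, and x₀ = √(−g). This is an arc on Y over a field of
transcendence degree 2. The fractions of 𝒪_X that are regular along it form a discrete valuation
ring, which is a prime divisor over X. If q is the X-order of a uniformizer, then q times the log
discrepancy is at most b₁ + b₂ + b₃ − b₀, and r ∣ q because functions on X are unchanged by X ↦ ξ_r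
X (`exists_arc`, `exists_primeDivisor`, `key_inequality`). A general weight is reduced to a balanced
one by changing b₀, after doubling b if necessary.

The rest is arithmetic. If r ∤ ke, hypothesis 3 keeps α_k out of Ψ₁, so the inequality improves to Σ
bᵢ − b(f) > r for b = r α_k (`add_lt_sum_of_not_dvd`). Used for both k and r − k, it determines b₁ +
b₂ + b₃ = b₀ + r + k whenever 2b₀ < r (`residues_of_small`). Summing this over a class of k modulo R
= r/d contradicts d ≥ 7 unless R = 1 (`eq_gcd_of_residues`). -/

namespace Hyperquotient

section Arc

open PowerSeries

/-! ### Valuation rings given by arcs -/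

variable {L : Type*} [Field L]

theorem powerSeries_dvd_of_order_le {p q : L⟦X⟧} (h : p.order ≤ q.order) : p ∣ q := by
  by_cases hq : q = 0
  · simp [hq]
  have hp : p ≠ 0 := by
    rintro rfl
    rw [order_zero, top_le_iff, order_eq_top] at h
    exact hq h
  have hle : p.order.toNat ≤ q.order.toNat :=
    ENat.toNat_le_toNat h (order_finite_iff_ne_zero.2 hq).ne
  have h1 : p ∣ X ^ p.order.toNat := by
    obtain ⟨u, hu⟩ := isUnit_divided_by_X_pow_order hp
    refine ⟨(u⁻¹ : L⟦X⟧ˣ), ?_⟩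
    nth_rewrite 2 [← X_pow_order_mul_divXPowOrder (f := p)]
    rw [← hu, mul_assoc, Units.mul_inv, mul_one]
  exact h1.trans ((pow_dvd_pow X hle).trans X_pow_order_dvd)

section DVR

variable {V : Type*} [CommRing V]

theorem exists_minimal_order (ι : V →+* L⟦X⟧) (hι : Function.Injective ι)
    (hex : ∃ x : V, x ≠ 0 ∧ (ι x).order ≠ 0) :
    ∃ (π : V) (q : ℕ), π ≠ 0 ∧ 0 < q ∧ (ι π).order = q ∧
      ∀ y, y ≠ 0 → (ι y).order ≠ 0 → (q : ℕ∞) ≤ (ι y).order := by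
  classical
  have key : ∃ n : ℕ, ∃ x : V, x ≠ 0 ∧ (ι x).order = n ∧ n ≠ 0 := by
    obtain ⟨x, hx, hx0⟩ := hex
    have hn : (ι x) ≠ 0 := (map_ne_zero_iff ι hι).2 hx
    refine ⟨(ι x).order.toNat, x, hx, (coe_toNat_order hn).symm, ?_⟩
    intro h
    rw [← coe_toNat_order hn, h] at hx0
    exact hx0 rfl
  obtain ⟨π, hπ, hq, hq0⟩ := Nat.find_spec key
  refine ⟨π, Nat.find key, hπ, Nat.pos_of_ne_zero hq0, hq, fun y hy hy0 => ?_⟩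
  have hn : (ι y) ≠ 0 := (map_ne_zero_iff ι hι).2 hy
  rw [← coe_toNat_order hn] at hy0 ⊢
  exact_mod_cast Nat.find_min' key ⟨y, hy, (coe_toNat_order hn).symm, by exact_mod_cast hy0⟩

theorem isUnit_of_order_eq_zero (ι : V →+* L⟦X⟧)
    (hdvd : ∀ x y : V, ι x ∣ ι y → x ∣ y) {x : V} (h : (ι x).order = 0) : IsUnit x := by
  rw [isUnit_iff_dvd_one]
  refine hdvd _ _ (powerSeries_dvd_of_order_le ?_)
  rw [h]
  exact zero_le

/-- Every nonzero element is a unit times a power of an element of minimal positive order. -/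
theorem exists_unit_mul_pow (ι : V →+* L⟦X⟧) (hι : Function.Injective ι)
    (hdvd : ∀ x y : V, ι x ∣ ι y → x ∣ y) {π : V} {q : ℕ} (hq : 0 < q)
    (hπq : (ι π).order = q) (hmin : ∀ y, y ≠ 0 → (ι y).order ≠ 0 → (q : ℕ∞) ≤ (ι y).order)
    {x : V} (hx : x ≠ 0) : ∃ (n : ℕ) (u : Vˣ), x = u * π ^ n := by
  have : ∀ (N : ℕ) (x : V), x ≠ 0 → (ι x).order = N → ∃ (n : ℕ) (u : Vˣ), x = u * π ^ n := by
    intro N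
    induction N using Nat.strong_induction_on with
    | _ N ih =>
      intro x hx hN
      by_cases h0 : N = 0
      · obtain ⟨u, hu⟩ := isUnit_of_order_eq_zero ι hdvd (x := x) (by rw [hN, h0]; rfl)
        exact ⟨0, u, by simp [hu]⟩
      · have h1 := hmin x hx (by rw [hN]; exact_mod_cast h0)
        obtain ⟨y, rfl⟩ := hdvd π x (powerSeries_dvd_of_order_le (by rw [hπq]; exact h1))
        have hy : y ≠ 0 := right_ne_zero_of_mul hx
        have hy' : ι y ≠ 0 := (map_ne_zero_iff ι hι).2 hy
        rw [map_mul, order_mul, hπq, ← coe_toNat_order hy'] at hN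
        have hN' : q + (ι y).order.toNat = N := by exact_mod_cast hN
        obtain ⟨n, u, hu⟩ := ih _ (by omega) y hy (coe_toNat_order hy').symm
        exact ⟨n + 1, u, by rw [hu]; ring⟩
  exact this _ x hx (coe_toNat_order ((map_ne_zero_iff ι hι).2 hx)).symm

theorem irreducible_of_minimal_order (ι : V →+* L⟦X⟧)
    (hdvd : ∀ x y : V, ι x ∣ ι y → x ∣ y) {π : V} {q : ℕ} (hπ : π ≠ 0) (hq : 0 < q)
    (hπq : (ι π).order = q)
    (hmin : ∀ y, y ≠ 0 → (ι y).order ≠ 0 → (q : ℕ∞) ≤ (ι y).order) : Irreducible π := by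
  constructor
  · intro h
    have := order_zero_of_unit (h.map ι)
    rw [hπq] at this
    exact hq.ne' (by exact_mod_cast this)
  · intro a b hab
    have ha : a ≠ 0 := by rintro rfl; simp [hab] at hπ
    have hb : b ≠ 0 := by rintro rfl; simp [hab] at hπ
    by_contra! hcon
    have h1 := hmin a ha fun h => hcon.1 (isUnit_of_order_eq_zero ι hdvd h)
    have h2 := hmin b hb fun h => hcon.2 (isUnit_of_order_eq_zero ι hdvd h)
    have h3 := add_le_add h1 h2
    rw [← order_mul, ← map_mul, ← hab, hπq] at h3
    have : q + q ≤ q := by exact_mod_cast h3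
    omega

variable [IsDomain V]

/-- By `hdvd`, divisibility in V is tested along the arc, so elements of order 0 are units and an
element of least positive order is a uniformizer. -/
theorem isDiscreteValuationRing_of_arc (ι : V →+* L⟦X⟧) (hι : Function.Injective ι)
    (hdvd : ∀ x y : V, ι x ∣ ι y → x ∣ y) (hex : ∃ x : V, x ≠ 0 ∧ (ι x).order ≠ 0) :
    IsDiscreteValuationRing V := by
  obtain ⟨π, q, hπ, hq, hπq, hmin⟩ := exists_minimal_order ι hι hex
  refine IsDiscreteValuationRing.ofHasUnitMulPowIrreducibleFactorization
    ⟨π, irreducible_of_minimal_order ι hdvd hπ hq hπq hmin, fun {x} hx => ?_⟩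
  obtain ⟨n, u, rfl⟩ := exists_unit_mul_pow ι hι hdvd hq hπq hmin hx
  exact ⟨n, u, mul_comm _ _⟩

/-- The number q is the ramification index of L⟦X⟧ over V. It may exceed 1, and for the arcs below
it is a multiple of r. -/
theorem exists_order_eq_mul_addVal [IsDiscreteValuationRing V] (ι : V →+* L⟦X⟧)
    (hι : Function.Injective ι)
    (hdvd : ∀ x y : V, ι x ∣ ι y → x ∣ y) (hex : ∃ x : V, x ≠ 0 ∧ (ι x).order ≠ 0) :
    ∃ (π : V) (q : ℕ), Irreducible π ∧ 0 < q ∧ (ι π).order = q ∧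
      ∀ x : V, x ≠ 0 → ∃ m : ℕ, IsDiscreteValuationRing.addVal V x = m ∧
        (ι x).order = (q * m : ℕ) := by
  obtain ⟨π, q, hπ, hq, hπq, hmin⟩ := exists_minimal_order ι hι hex
  have hirr := irreducible_of_minimal_order ι hdvd hπ hq hπq hmin
  refine ⟨π, q, hirr, hq, hπq, fun x hx => ?_⟩
  obtain ⟨n, u, rfl⟩ := exists_unit_mul_pow ι hι hdvd hq hπq hmin hx
  refine ⟨n, IsDiscreteValuationRing.addVal_def' u hirr n, ?_⟩
  rw [map_mul, map_pow, order_mul, order_pow, order_zero_of_unit (u.isUnit.map ι), hπq]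
  simp [mul_comm]

end DVR

section Subalgebra

variable {R : Type*} [CommRing R] [IsDomain R] (φ : R →+* L⟦X⟧) (hφ : Function.Injective φ)

/-- The extension of an arc to fraction fields. -/
noncomputable def arcField : FractionRing R →+* FractionRing L⟦X⟧ :=
  IsFractionRing.lift (g := (algebraMap L⟦X⟧ (FractionRing L⟦X⟧)).comp φ)
    ((IsFractionRing.injective L⟦X⟧ (FractionRing L⟦X⟧)).comp hφ)

theorem arcField_algebraMap (x : R) :
    arcField φ hφ (algebraMap R _ x) = algebraMap L⟦X⟧ _ (φ x) :=
  IsFractionRing.lift_algebraMap _ x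

/-- The valuation ring of an arc: the fractions which are regular along it. -/
noncomputable def arcRing : Subalgebra R (FractionRing R) where
  carrier := {x | ∃ p : L⟦X⟧, algebraMap L⟦X⟧ (FractionRing L⟦X⟧) p = arcField φ hφ x}
  mul_mem' := by
    rintro x y ⟨p, hp⟩ ⟨q, hq⟩
    exact ⟨p * q, by rw [map_mul, map_mul, hp, hq]⟩
  add_mem' := by
    rintro x y ⟨p, hp⟩ ⟨q, hq⟩
    exact ⟨p + q, by rw [map_add, map_add, hp, hq]⟩
  algebraMap_mem' x := ⟨φ x, (arcField_algebraMap φ hφ x).symm⟩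

/-- The arc on its valuation ring. -/
noncomputable def arcMap : arcRing φ hφ →+* L⟦X⟧ where
  toFun x := x.2.choose
  map_one' := IsFractionRing.injective L⟦X⟧ (FractionRing L⟦X⟧) <| by
    rw [(1 : arcRing φ hφ).2.choose_spec]; simp
  map_zero' := IsFractionRing.injective L⟦X⟧ (FractionRing L⟦X⟧) <| by
    rw [(0 : arcRing φ hφ).2.choose_spec]; simp
  map_mul' x y := IsFractionRing.injective L⟦X⟧ (FractionRing L⟦X⟧) <| by
    rw [(x * y).2.choose_spec, map_mul, x.2.choose_spec, y.2.choose_spec]; simp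
  map_add' x y := IsFractionRing.injective L⟦X⟧ (FractionRing L⟦X⟧) <| by
    rw [(x + y).2.choose_spec, map_add, x.2.choose_spec, y.2.choose_spec]; simp

theorem algebraMap_arcMap (x : arcRing φ hφ) :
    algebraMap L⟦X⟧ (FractionRing L⟦X⟧) (arcMap φ hφ x) = arcField φ hφ x :=
  x.2.choose_spec

theorem arcMap_injective : Function.Injective (arcMap φ hφ) := by
  intro x y h
  apply Subtype.ext
  apply (arcField φ hφ).injective
  rw [← algebraMap_arcMap, ← algebraMap_arcMap, h]

theorem arcMap_algebraMap (x : R) : arcMap φ hφ (algebraMap R _ x) = φ x := by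
  apply IsFractionRing.injective L⟦X⟧ (FractionRing L⟦X⟧)
  rw [algebraMap_arcMap, ← arcField_algebraMap φ hφ]
  rfl

/-- Serves to find, inside the valuation ring, elements that restrict to prescribed transcendental
constants on the arc. -/
theorem exists_arcMap_eq {a b : R} (hb : b ≠ 0) {p : L⟦X⟧} (h : φ a = φ b * p) :
    ∃ x : arcRing φ hφ, arcMap φ hφ x = p := by
  have hb' : algebraMap L⟦X⟧ (FractionRing L⟦X⟧) (φ b) ≠ 0 := by
    rw [Ne, IsFractionRing.to_map_eq_zero_iff, map_eq_zero_iff φ hφ]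
    exact hb
  have hp : algebraMap L⟦X⟧ (FractionRing L⟦X⟧) p =
      arcField φ hφ (algebraMap R _ a / algebraMap R _ b) := by
    rw [map_div₀, arcField_algebraMap, arcField_algebraMap, h, map_mul, mul_div_cancel_left₀ _ hb']
  refine ⟨⟨_, p, hp⟩, ?_⟩
  apply IsFractionRing.injective L⟦X⟧ (FractionRing L⟦X⟧)
  rw [algebraMap_arcMap, hp]

theorem dvd_of_arcMap_dvd (x y : arcRing φ hφ) (h : arcMap φ hφ x ∣ arcMap φ hφ y) : x ∣ y := by
  obtain ⟨p, hp⟩ := h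
  by_cases hx : x = 0
  · subst hx
    rw [map_zero, zero_mul, ← map_zero (arcMap φ hφ)] at hp
    rw [arcMap_injective φ hφ hp]
  have hx' : arcField φ hφ x ≠ 0 := by
    rw [Ne, _root_.map_eq_zero]
    exact fun h => hx (Subtype.ext h)
  have hmem : (y / x : FractionRing R) ∈ arcRing φ hφ := by
    refine ⟨p, ?_⟩
    rw [map_div₀, eq_div_iff hx', ← algebraMap_arcMap, ← algebraMap_arcMap, hp, map_mul, mul_comm]
  refine ⟨⟨_, hmem⟩, Subtype.ext ?_⟩
  have hx0 : (x : FractionRing R) ≠ 0 := fun h => hx (Subtype.ext h)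
  change (y : FractionRing R) = x * (y / x)
  field_simp

theorem arcRing_sameFractionField (v : arcRing φ hφ) :
    ∃ p q : R, q ≠ 0 ∧ v * algebraMap R (arcRing φ hφ) q = algebraMap R _ p := by
  obtain ⟨p, q, hq, h⟩ := IsFractionRing.div_surjective (A := R) (v : FractionRing R)
  have hq0 : q ≠ 0 := nonZeroDivisors.ne_zero hq
  refine ⟨p, q, hq0, Subtype.ext ?_⟩
  change (v : FractionRing R) * algebraMap R _ q = algebraMap R _ p
  rw [← h, div_mul_cancel₀]
  rwa [Ne, IsFractionRing.to_map_eq_zero_iff]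

end Subalgebra

end Arc

end Hyperquotient

namespace Hyperquotient

section Differentials

/-! ### Exterior powers modulo an ideal -/

section Exterior

variable {A M : Type*} [CommRing A] [AddCommGroup M] [Module A M] {n : ℕ}

theorem ιMulti_mem_smul_top (I : Ideal A) (v : Fin n → M) (i : Fin n)
    (hi : v i ∈ I • (⊤ : Submodule A M)) :
    exteriorPower.ιMulti A n v ∈ I • (⊤ : Submodule A (⋀[A]^n M)) := by
  have h1 : Submodule.map ((exteriorPower.ιMulti A n (M := M)).toMultilinearMap.toLinearMap v i)
      (I • ⊤) ≤ I • (⊤ : Submodule A (⋀[A]^n M)) := by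
    rw [Submodule.map_smul'']
    exact Submodule.smul_mono le_rfl le_top
  have h2 := h1 (Submodule.mem_map_of_mem hi)
  simpa using h2

theorem ιMulti_mem_span_of_mem_span {e v : Fin n → M}
    (hv : ∀ i, v i ∈ Submodule.span A (Set.range e)) :
    exteriorPower.ιMulti A n v ∈ Submodule.span A {exteriorPower.ιMulti A n e} := by
  have h1 : ∀ i, ∃ c : Fin n → A, ∑ j, c j • e j = v i := fun i =>
    (Submodule.mem_span_range_iff_exists_fun A).1 (hv i)
  choose c hc using h1
  have h2 : v = fun i => ∑ j, c i j • e j := funext fun i => (hc i).symm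
  rw [h2]
  have h3 := (exteriorPower.ιMulti A n (M := M)).toMultilinearMap.map_sum
    (fun i j => c i j • e j)
  rw [AlternatingMap.coe_multilinearMap] at h3
  rw [h3]
  refine Submodule.sum_mem _ fun σ _ => ?_
  have h4 := (exteriorPower.ιMulti A n (M := M)).toMultilinearMap.map_smul_univ
    (fun i => c i (σ i)) (fun i => e (σ i))
  rw [AlternatingMap.coe_multilinearMap] at h4
  rw [h4]
  refine Submodule.smul_mem _ _ ?_
  by_cases hσ : Function.Injective σ
  · have hb : Function.Bijective σ := Finite.injective_iff_bijective.1 hσ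
    have h5 := (exteriorPower.ιMulti A n (M := M)).map_perm e (Equiv.ofBijective σ hb)
    have h6 : (e ∘ (Equiv.ofBijective σ hb) : Fin n → M) = fun i => e (σ i) := rfl
    rw [h6] at h5
    rw [h5]
    rcases Int.units_eq_one_or (Equiv.Perm.sign (Equiv.ofBijective σ hb)) with h | h <;> rw [h]
    · simp
    · simp
  · obtain ⟨i, j, hij, hne⟩ : ∃ i j, σ i = σ j ∧ i ≠ j := by
      simpa [Function.Injective] using hσ
    have h5 : exteriorPower.ιMulti A n (fun i => e (σ i)) = 0 :=
      (exteriorPower.ιMulti A n (M := M)).map_eq_zero_of_eq _ (congrArg e hij) hne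
    rw [h5]
    exact Submodule.zero_mem _

/-- Split each factor of a wedge into a combination of the `e j` and an element of I M. After
expansion, only one term has no factor in I M. -/
theorem exteriorPower_span_sup_smul (I : Ideal A) (e : Fin n → M)
    (he : Submodule.span A (Set.range e) ⊔ I • (⊤ : Submodule A M) = ⊤) :
    Submodule.span A {exteriorPower.ιMulti A n e} ⊔ I • (⊤ : Submodule A (⋀[A]^n M)) = ⊤ := by
  refine top_le_iff.1 ((exteriorPower.ιMulti_span A n M).ge.trans ?_)
  rw [Submodule.span_le]
  rintro _ ⟨y, rfl⟩
  have h1 : ∀ i, ∃ v ∈ Submodule.span A (Set.range e), ∃ z ∈ I • (⊤ : Submodule A M),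
      v + z = y i := fun i => Submodule.mem_sup.1 (he.ge Submodule.mem_top)
  choose v hv z hz hvz using h1
  have h2 : y = v + z := funext fun i => (hvz i).symm
  have h3 := (exteriorPower.ιMulti A n (M := M)).toMultilinearMap.map_add_univ v z
  rw [AlternatingMap.coe_multilinearMap] at h3
  rw [h2, SetLike.mem_coe, h3]
  refine Submodule.sum_mem _ fun s _ => ?_
  by_cases hs : s = Finset.univ
  · subst hs
    rw [Finset.piecewise_univ]
    exact Submodule.mem_sup_left (ιMulti_mem_span_of_mem_span hv)
  · obtain ⟨i, hi⟩ : ∃ i, i ∉ s := by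
      by_contra! h
      exact hs (Finset.eq_univ_iff_forall.2 h)
    refine Submodule.mem_sup_right (ιMulti_mem_smul_top I _ i ?_)
    rw [Finset.piecewise_eq_of_notMem _ _ _ hi]
    exact hz i

/-- Plays the role of Nakayama's lemma: the module need not be finitely generated, so x generates
only modulo each power of I. -/
theorem span_sup_pow_smul (I : Ideal A) (x : M)
    (h : Submodule.span A {x} ⊔ I • (⊤ : Submodule A M) = ⊤) (N : ℕ) :
    Submodule.span A {x} ⊔ I ^ N • (⊤ : Submodule A M) = ⊤ := by
  induction N with
  | zero => simp
  | succ N ih =>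
    refine top_le_iff.1 (ih.ge.trans (sup_le le_sup_left ?_))
    refine Submodule.smul_le.2 fun a ha y _ => ?_
    obtain ⟨v, hv, z, hz, rfl⟩ := Submodule.mem_sup.1 (h.ge (Submodule.mem_top (x := y)))
    rw [smul_add]
    refine Submodule.add_mem_sup (Submodule.smul_mem _ _ hv) ?_
    have h1 := Submodule.smul_mem_smul ha hz
    rwa [← Submodule.smul_assoc, smul_eq_mul, ← pow_succ] at h1

end Exterior

/-! ### Differentials of a valuation ring of a divisor -/

section Kaehler

variable {V : Type*} [CommRing V] [Algebra ℂ V]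

theorem derivation_aeval_eq_zero {Q : Type*} [AddCommGroup Q] [Module ℂ Q] [Module V Q]
    (d : Derivation ℂ V Q) {σ : Type*} (θ : σ → V)
    (hθ : ∀ i, d (θ i) = 0) (c : MvPolynomial σ ℂ) : d (MvPolynomial.aeval θ c) = 0 := by
  induction c using MvPolynomial.induction_on with
  | C a => rw [MvPolynomial.aeval_C, Derivation.map_algebraMap]
  | add p q hp hq => rw [map_add, map_add, hp, hq, add_zero]
  | mul_X p i hp => rw [map_mul, MvPolynomial.aeval_X, Derivation.leibniz, hp, hθ]; simp

theorem derivation_eval₂ {Q : Type*} [AddCommGroup Q] [Module ℂ Q] [Module V Q]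
    (d : Derivation ℂ V Q) {σ : Type*} (θ : σ → V) (hθ : ∀ i, d (θ i) = 0)
    (p : Polynomial (MvPolynomial σ ℂ)) (v : V) :
    d (p.eval₂ (MvPolynomial.aeval θ : MvPolynomial σ ℂ →ₐ[ℂ] V).toRingHom v) =
      (p.derivative.eval₂ (MvPolynomial.aeval θ : MvPolynomial σ ℂ →ₐ[ℂ] V).toRingHom v) • d v := by
  induction p using Polynomial.induction_on' with
  | add p q hp hq => simp only [Polynomial.eval₂_add, map_add, hp, hq, add_smul]
  | monomial n c =>
    rw [Polynomial.eval₂_monomial, Polynomial.derivative_monomial, Polynomial.eval₂_monomial,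
      Derivation.leibniz, Derivation.leibniz_pow]
    have : d ((MvPolynomial.aeval θ : MvPolynomial σ ℂ →ₐ[ℂ] V).toRingHom c) = 0 :=
      derivation_aeval_eq_zero d θ hθ c
    rw [this, smul_zero, add_zero, map_mul, map_natCast, ← Nat.cast_smul_eq_nsmul V n, smul_smul,
      smul_smul]

/-- If the residue field of `V` is algebraic over the subfield generated by the residues of the
`θ i`, then `Ω_V` is spanned, modulo the maximal ideal, by `dπ` and the `d(θ i)`. -/
theorem kaehler_span_sup_smul [IsLocalRing V] {π : V}
    (hπ : IsLocalRing.maximalIdeal V = Ideal.span {π}) {σ : Type*} (θ : σ → V)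
    (hres : ∀ v : V, ∃ p : Polynomial (MvPolynomial σ ℂ),
      ¬ IsUnit (p.eval₂ (MvPolynomial.aeval θ : MvPolynomial σ ℂ →ₐ[ℂ] V).toRingHom v) ∧
      IsUnit (p.derivative.eval₂ (MvPolynomial.aeval θ : MvPolynomial σ ℂ →ₐ[ℂ] V).toRingHom v))
    (N : Submodule V (Ω[V⁄ℂ])) (hN : KaehlerDifferential.D ℂ V π ∈ N)
    (hNθ : ∀ i, KaehlerDifferential.D ℂ V (θ i) ∈ N) :
    N ⊔ IsLocalRing.maximalIdeal V • (⊤ : Submodule V (Ω[V⁄ℂ])) = ⊤ := by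
  set M := N ⊔ IsLocalRing.maximalIdeal V • (⊤ : Submodule V (Ω[V⁄ℂ])) with hM
  let d : Derivation ℂ V (Ω[V⁄ℂ] ⧸ M) := M.mkQ.compDer (KaehlerDifferential.D ℂ V)
  have hd : ∀ x, d x = M.mkQ (KaehlerDifferential.D ℂ V x) := fun x => rfl
  have hz : ∀ x ∈ M, M.mkQ x = 0 := fun x hx => by simpa using hx
  have hdθ : ∀ i, d (θ i) = 0 := fun i => hz _ (Submodule.mem_sup_left (hNθ i))
  have hd0 : ∀ v, d v = 0 := by
    intro v
    -- Differentiating p(v) = πy gives p′(v) dv = π dy + y dπ, which is zero modulo `M`, and p′(v)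
    -- is a unit.
    obtain ⟨p, hp, hu⟩ := hres v
    have h1 := derivation_eval₂ d θ hdθ p v
    have h2 : p.eval₂ (MvPolynomial.aeval θ : MvPolynomial σ ℂ →ₐ[ℂ] V).toRingHom v ∈
        IsLocalRing.maximalIdeal V := hp
    rw [hπ, Ideal.mem_span_singleton] at h2
    obtain ⟨y, hy⟩ := h2
    have h3 : d (π * y) = 0 := by
      rw [Derivation.leibniz, hd π, hz _ (Submodule.mem_sup_left hN), smul_zero, add_zero, hd y,
        ← map_smul]
      refine hz _ (Submodule.mem_sup_right (Submodule.smul_mem_smul ?_ Submodule.mem_top))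
      rw [hπ]
      exact Ideal.mem_span_singleton_self π
    rw [hy, h3] at h1
    exact (hu.smul_eq_zero).1 h1.symm
  rw [eq_top_iff, ← KaehlerDifferential.span_range_derivation ℂ V, Submodule.span_le]
  rintro _ ⟨v, rfl⟩
  have := hd0 v
  rw [hd] at this
  simpa using this

end Kaehler

end Differentials

end Hyperquotient

namespace Hyperquotient

/-! ### Orders of vanishing of 3-forms, measured along an arc -/

section Vanishing

open PowerSeries

variable {L : Type*} [Field L]

theorem X_pow_dvd_iff_le_order {p : L⟦X⟧} {n : ℕ} : X ^ n ∣ p ↔ (n : ℕ∞) ≤ p.order := by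
  constructor
  · rintro ⟨c, rfl⟩
    rw [order_mul, order_X_pow]
    exact le_self_add
  · intro h
    exact powerSeries_dvd_of_order_le (by rwa [order_X_pow])

/-- Pulls a 3-form back along the arc and contracts it with three derivations, so that its vanishing
can be compared with an order in X. -/
theorem exists_linear_functional {V : Type} [CommRing V] [Algebra ℂ V] [Algebra ℂ L]
    (ι : V →ₐ[ℂ] L⟦X⟧) (δ : Fin 3 → Derivation ℂ L⟦X⟧ L⟦X⟧) :
    ∃ F : (⋀[V]^3 (Ω[V⁄ℂ])) →+ L⟦X⟧, (∀ v x, F (v • x) = ι v * F x) ∧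
      ∀ u : Fin 3 → V, F (wedgeD V u) = Matrix.det (Matrix.of fun i j => δ j (ι (u i))) := by
  let : Algebra V L⟦X⟧ := ι.toRingHom.toAlgebra
  have : IsScalarTower ℂ V L⟦X⟧ := IsScalarTower.of_algebraMap_eq fun c => (ι.commutes c).symm
  let ℓ : Fin 3 → (Ω[V⁄ℂ] →ₗ[V] L⟦X⟧) := fun j =>
    ((δ j).compAlgebraMap V).liftKaehlerDifferential
  let g : (Ω[V⁄ℂ]) [⋀^Fin 3]→ₗ[V] L⟦X⟧ :=
    { ((Matrix.detRowAlternating (R := L⟦X⟧) (n := Fin 3)).toMultilinearMap.restrictScalars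
        V).compLinearMap fun _ => LinearMap.pi ℓ with
      map_eq_zero_of_eq' := fun v i j hij hne =>
        (Matrix.detRowAlternating (R := L⟦X⟧) (n := Fin 3)).map_eq_zero_of_eq _
          (congrArg (LinearMap.pi ℓ) hij) hne }
  refine ⟨(exteriorPower.alternatingMapLinearEquiv g).toAddMonoidHom, fun v x => ?_, fun u => ?_⟩
  · exact (map_smul (exteriorPower.alternatingMapLinearEquiv g) v x).trans (Algebra.smul_def _ _)
  · have h1 : exteriorPower.alternatingMapLinearEquiv g (wedgeD V u) =
        g fun i => KaehlerDifferential.D ℂ V (u i) :=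
      exteriorPower.alternatingMapLinearEquiv_apply_ιMulti _ _
    refine h1.trans ?_
    change Matrix.det (fun i => LinearMap.pi ℓ (KaehlerDifferential.D ℂ V (u i))) = Matrix.det _
    congr 1
    funext i j
    exact ((δ j).compAlgebraMap V).liftKaehlerDifferential_comp_D (u i)

/-- Let t and P be the orders of F ω₀ and F ω, and write ω = cω₀ + z with z negligible. Then P = qk
+ t with k the valuation of c. The form lies in 𝔪ᵏ times the module because c does, and not in 𝔪ᵏ⁺¹
times it because F would then have order at least q(k + 1) + t. The bound is t ≥ q. -/
theorem exists_vanishesToOrder {V : Type} [CommRing V] [IsDomain V] [IsDiscreteValuationRing V]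
    [Algebra ℂ V] (ι : V →+* L⟦X⟧) {π : V} {q : ℕ} (hπ : Irreducible π) (hq : 0 < q)
    (hπq : (ι π).order = q)
    (hord : ∀ x : V, x ≠ 0 → ∃ m : ℕ, IsDiscreteValuationRing.addVal V x = m ∧
        (ι x).order = (q * m : ℕ))
    (F : (⋀[V]^3 (Ω[V⁄ℂ])) →+ L⟦X⟧) (hF : ∀ v x, F (v • x) = ι v * F x)
    (ω₀ : ⋀[V]^3 (Ω[V⁄ℂ])) (hω₀ : Submodule.span V {ω₀} ⊔
      IsLocalRing.maximalIdeal V • (⊤ : Submodule V (⋀[V]^3 (Ω[V⁄ℂ]))) = ⊤)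
    (hFω₀ : X ^ q ∣ F ω₀) (ω : ⋀[V]^3 (Ω[V⁄ℂ])) (hω : F ω ≠ 0) :
    ∃ k : ℕ, VanishesToOrder V ω k ∧ ((q * (k + 1) : ℕ) : ℕ∞) ≤ (F ω).order := by
  have hmax := hπ.maximalIdeal_eq
  have hmem : ∀ n (x : ⋀[V]^3 (Ω[V⁄ℂ])) (t : ℕ), (∀ y, X ^ t ∣ F y) →
      x ∈ IsLocalRing.maximalIdeal V ^ n • (⊤ : Submodule V (⋀[V]^3 (Ω[V⁄ℂ]))) →
      X ^ (q * n + t) ∣ F x := by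
    intro n x t ht hx
    refine Submodule.smul_induction_on hx (fun a ha y _ => ?_) fun y z hy hz => ?_
    · rw [hmax, Ideal.span_singleton_pow, Ideal.mem_span_singleton] at ha
      obtain ⟨c, rfl⟩ := ha
      rw [hF, map_mul, map_pow, pow_add, pow_mul]
      refine mul_dvd_mul (Dvd.dvd.mul_right (pow_dvd_pow_of_dvd ?_ n) _) (ht y)
      exact X_pow_dvd_iff_le_order.2 hπq.ge
    · rw [map_add]
      exact dvd_add hy hz
  have hdec : ∀ (N : ℕ) (x : ⋀[V]^3 (Ω[V⁄ℂ])), ∃ c : V, ∃ z ∈ IsLocalRing.maximalIdeal V ^ N •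
      (⊤ : Submodule V (⋀[V]^3 (Ω[V⁄ℂ]))), c • ω₀ + z = x := by
    intro N x
    obtain ⟨y, hy, z, hz, h⟩ := Submodule.mem_sup.1
      ((span_sup_pow_smul _ ω₀ hω₀ N).ge (Submodule.mem_top (x := x)))
    obtain ⟨c, rfl⟩ := Submodule.mem_span_singleton.1 hy
    exact ⟨c, z, hz, h⟩
  obtain ⟨P, hP⟩ : ∃ P : ℕ, (F ω).order = P := ⟨_, (coe_toNat_order hω).symm⟩
  -- Precision P + 1 suffices: F z has order greater than P, so cω₀ alone accounts for the order of
  -- F ω.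
  obtain ⟨c, z, hz, hcz⟩ := hdec (P + 1) ω
  have hFz : ((P + 1 : ℕ) : ℕ∞) ≤ (F z).order := by
    have h1 := hmem (P + 1) z 0 (by simp) hz
    refine X_pow_dvd_iff_le_order.1 ((pow_dvd_pow X ?_).trans h1)
    nlinarith
  have hsum : F ω = ι c * F ω₀ + F z := by rw [← hcz, map_add, hF]
  have hmain : (ι c * F ω₀).order = P := by
    have h1 : ι c * F ω₀ = F ω + -F z := by rw [hsum]; ring
    have hlt : (F ω).order < (-F z).order := by
      rw [order_neg, hP]
      exact lt_of_lt_of_le (by exact_mod_cast P.lt_succ_self) hFz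
    rw [h1, order_add_of_order_ne _ _ hlt.ne, min_eq_left hlt.le, hP]
  have hne : ι c * F ω₀ ≠ 0 := by
    intro h
    rw [h, order_zero] at hmain
    exact ENat.natCast_ne_top _ hmain.symm
  have hω₀ne : F ω₀ ≠ 0 := right_ne_zero_of_mul hne
  have hc0 : c ≠ 0 := by
    rintro rfl
    simp at hne
  obtain ⟨k, hk, hck⟩ := hord c hc0
  obtain ⟨t, ht⟩ : ∃ t : ℕ, (F ω₀).order = t := ⟨_, (coe_toNat_order hω₀ne).symm⟩
  have hPt : q * k + t = P := by
    rw [order_mul, hck, ht] at hmain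
    exact_mod_cast hmain
  have hqt : q ≤ t := by
    have := X_pow_dvd_iff_le_order.1 hFω₀
    rw [ht] at this
    exact_mod_cast this
  -- F ω₀ has the least order among all values of F: modulo 𝔪ᵗ every form is a multiple of ω₀, and F
  -- sends 𝔪ᵗ into multiples of X^(qt).
  have hall : ∀ y, X ^ t ∣ F y := by
    intro y
    obtain ⟨c', z', hz', h'⟩ := hdec t y
    rw [← h', map_add, hF]
    refine dvd_add (Dvd.dvd.mul_left (X_pow_dvd_iff_le_order.2 ht.ge) _) ?_
    refine (pow_dvd_pow X ?_).trans (hmem t z' 0 (by simp) hz')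
    nlinarith
  have hkP : k ≤ P + 1 := by nlinarith
  refine ⟨k, ⟨?_, fun hcon => ?_⟩, ?_⟩
  · rw [← hcz]
    refine Submodule.add_mem _ (Submodule.smul_mem_smul ?_ Submodule.mem_top)
      (Submodule.smul_mono_left (Ideal.pow_le_pow_right hkP) hz)
    rw [hmax, Ideal.span_singleton_pow, Ideal.mem_span_singleton,
      ← IsDiscreteValuationRing.addVal_le_iff_dvd, hk, hπ.addVal_pow]
  · have h1 := X_pow_dvd_iff_le_order.1 (hmem (k + 1) ω t hall hcon)
    rw [hP] at h1
    have h2 : q * (k + 1) + t ≤ P := by exact_mod_cast h1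
    nlinarith
  · rw [hP]
    have : q * (k + 1) ≤ P := by nlinarith
    exact_mod_cast this

end Vanishing

end Hyperquotient

namespace Hyperquotient

/-! ### The prime divisor defined by an arc -/

section PrimeDivisor

open PowerSeries

/-- The residue field embeds into L, which bounds its transcendence degree by 2, and it contains
lifts of the independent elements `S i`. -/
theorem trdeg_residueField_of_arc {V L : Type} [CommRing V] [IsLocalRing V] [Algebra ℂ V]
    [Field L] [Algebra ℂ L] (htr : Algebra.trdeg ℂ L = 2) {S : Fin 2 → L}
    (hS : AlgebraicIndependent ℂ S) (ψ : V →ₐ[ℂ] L) (hψ : ∀ v, ψ v ≠ 0 → IsUnit v)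
    (θ : Fin 2 → V) (hθ : ∀ i, ψ (θ i) = S i) :
    Algebra.trdeg ℂ (IsLocalRing.ResidueField V) = 2 := by
  have hloc : IsLocalHom (ψ : V →+* L) := ⟨fun v hv => hψ v hv.ne_zero⟩
  let ρ : IsLocalRing.ResidueField V →ₐ[ℂ] L :=
    { IsLocalRing.ResidueField.lift (ψ : V →+* L) with
      commutes' := fun c => ψ.commutes c }
  have hρ : Function.Injective ρ := ρ.toRingHom.injective
  apply le_antisymm
  · rw [← htr]
    exact trdeg_le_of_injective ρ hρ
  · have h1 : AlgebraicIndependent ℂ (fun i => IsLocalRing.residue V (θ i)) := by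
      refine AlgebraicIndependent.of_comp ρ ?_
      have h2 : ρ ∘ (fun i => IsLocalRing.residue V (θ i)) = S := funext hθ
      rwa [h2]
    simpa using h1.cardinalMk_le_trdeg

/-- V is the ring of fractions of R that are regular along φ. The hypothesis `hθ` puts the constants
`S i` into V, `hsep` makes L separable over them so that dπ, dθ₀, dθ₁ span Ω_V modulo 𝔪, and `hδ`
says that the derivations are logarithmic along X = 0. The last property turns dπ into a multiple of
X^q and yields k + 1 rather than k in the final bound. -/
theorem exists_primeDivisor {R L : Type} [CommRing R] [IsDomain R] [Algebra ℂ R] [Field L]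
    [Algebra ℂ L] (htr : Algebra.trdeg ℂ L = 2) {S : Fin 2 → L} (hS : AlgebraicIndependent ℂ S)
    (hsep : ∀ x : L, ∃ p : Polynomial (MvPolynomial (Fin 2) ℂ),
      p.eval₂ (MvPolynomial.aeval S : MvPolynomial (Fin 2) ℂ →ₐ[ℂ] L).toRingHom x = 0 ∧
      p.derivative.eval₂ (MvPolynomial.aeval S : MvPolynomial (Fin 2) ℂ →ₐ[ℂ] L).toRingHom x ≠ 0)
    (φ : R →ₐ[ℂ] L⟦X⟧) (hφ : Function.Injective φ)
    (hloc : ∀ x, constantCoeff (φ x) ≠ 0 → IsUnit x)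
    (hθ : ∀ i, ∃ a b : R, b ≠ 0 ∧ φ a = φ b * C (S i))
    (hpos : ∃ x : R, x ≠ 0 ∧ constantCoeff (φ x) = 0)
    {r : ℕ} (hr : ∀ x : R, x ≠ 0 → ∃ m : ℕ, (φ x).order = (r * m : ℕ))
    (δ : Fin 3 → Derivation ℂ L⟦X⟧ L⟦X⟧) (hδ : ∀ j n x, X ^ n ∣ x → X ^ n ∣ δ j x) :
    ∃ (V : Type) (_ : CommRing V) (_ : IsDomain V) (_ : IsDiscreteValuationRing V)
      (_ : Algebra ℂ V) (_ : Algebra R V) (_ : IsScalarTower ℂ R V),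
      IsPrimeDivisorOver R V ∧ ∃ q : ℕ, 0 < q ∧ r ∣ q ∧
        (∀ x : R, x ≠ 0 → ∃ m : ℕ, IsDiscreteValuationRing.addVal V (algebraMap R V x) = m ∧
          (φ x).order = (q * m : ℕ)) ∧
        ∀ u : Fin 3 → R, Matrix.det (Matrix.of fun i j => δ j (φ (u i))) ≠ 0 →
          ∃ k : ℕ, VanishesToOrder V (wedgeD V fun i => algebraMap R V (u i)) k ∧
            ((q * (k + 1) : ℕ) : ℕ∞) ≤
              (Matrix.det (Matrix.of fun i j => δ j (φ (u i)))).order := by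
  have hφ' : Function.Injective (φ : R →+* L⟦X⟧) := hφ
  let V := arcRing (φ : R →+* L⟦X⟧) hφ'
  have hιR : ∀ x : R, arcMap (φ : R →+* L⟦X⟧) hφ' (algebraMap R V x) = φ x :=
    arcMap_algebraMap (φ : R →+* L⟦X⟧) hφ'
  let ι : V →ₐ[ℂ] L⟦X⟧ :=
    { arcMap (φ : R →+* L⟦X⟧) hφ' with
      commutes' := fun c => by
        have h1 : algebraMap ℂ V c = algebraMap R V (algebraMap ℂ R c) :=
          IsScalarTower.algebraMap_apply ℂ R V c
        rw [h1]
        exact (hιR _).trans (φ.commutes c) }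
  have hιR : ∀ x : R, ι (algebraMap R V x) = φ x := hιR
  have hι : Function.Injective (ι : V →+* L⟦X⟧) := arcMap_injective (φ : R →+* L⟦X⟧) hφ'
  have hdvd : ∀ x y : V, (ι : V →+* L⟦X⟧) x ∣ (ι : V →+* L⟦X⟧) y → x ∣ y :=
    dvd_of_arcMap_dvd (φ : R →+* L⟦X⟧) hφ'
  have hRV : Function.Injective (algebraMap R V) := by
    intro x y h
    apply hφ
    rw [← hιR, ← hιR, h]
  have hex : ∃ x : V, x ≠ 0 ∧ ((ι : V →+* L⟦X⟧) x).order ≠ 0 := by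
    obtain ⟨x, hx, hx0⟩ := hpos
    refine ⟨algebraMap R V x, (map_ne_zero_iff _ hRV).2 hx, ?_⟩
    have : (ι (algebraMap R V x)).order ≠ 0 := by
      rw [hιR]
      exact order_ne_zero_iff_constCoeff_eq_zero.2 hx0
    exact this
  have hDVR : IsDiscreteValuationRing V := isDiscreteValuationRing_of_arc _ hι hdvd hex
  obtain ⟨π, q, hπ, hq, hπq, hord⟩ := exists_order_eq_mul_addVal _ hι hdvd hex
  let ψ : V →ₐ[ℂ] L := 
    { (constantCoeff (R := L)).comp (ι : V →+* L⟦X⟧) with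
      commutes' := fun c => by
        have h1 : ι (algebraMap ℂ V c) = algebraMap ℂ L⟦X⟧ c := ι.commutes c
        change constantCoeff (ι (algebraMap ℂ V c)) = _
        rw [h1, PowerSeries.algebraMap_apply, constantCoeff_C] }
  have hψ0 : ∀ v, ψ v = constantCoeff (ι v) := fun v => rfl
  have hψ : ∀ v, ψ v ≠ 0 → IsUnit v := fun v hv =>
    isUnit_of_order_eq_zero (ι : V →+* L⟦X⟧) hdvd <| by
      by_contra h
      exact hv (order_ne_zero_iff_constCoeff_eq_zero.1 h)
  have hψ' : ∀ v, IsUnit v → ψ v ≠ 0 := fun v hv => (hv.map ψ).ne_zero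
  have hθ' : ∀ i, ∃ x : V, ι x = C (S i) := fun i => by
    obtain ⟨a, b, hb, hab⟩ := hθ i
    exact exists_arcMap_eq (φ : R →+* L⟦X⟧) hφ' hb hab
  choose θ hθ using hθ'
  have hψθ : ∀ i, ψ (θ i) = S i := fun i => by rw [hψ0, hθ, constantCoeff_C]
  have hcomp : ψ.toRingHom.comp (MvPolynomial.aeval θ : MvPolynomial (Fin 2) ℂ →ₐ[ℂ] V).toRingHom =
      (MvPolynomial.aeval S : MvPolynomial (Fin 2) ℂ →ₐ[ℂ] L).toRingHom := by
    have h1 : ψ.comp (MvPolynomial.aeval θ) = MvPolynomial.aeval S :=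
      MvPolynomial.algHom_ext fun i => by simp [hψθ]
    rw [← h1]
    rfl
  have hres : ∀ v : V, ∃ p : Polynomial (MvPolynomial (Fin 2) ℂ),
      ¬ IsUnit (p.eval₂ (MvPolynomial.aeval θ : MvPolynomial (Fin 2) ℂ →ₐ[ℂ] V).toRingHom v) ∧
      IsUnit (p.derivative.eval₂
        (MvPolynomial.aeval θ : MvPolynomial (Fin 2) ℂ →ₐ[ℂ] V).toRingHom v) := by
    intro v
    obtain ⟨p, hp, hp'⟩ := hsep (ψ v)
    have h1 : ∀ p : Polynomial (MvPolynomial (Fin 2) ℂ),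
        ψ (p.eval₂ (MvPolynomial.aeval θ : MvPolynomial (Fin 2) ℂ →ₐ[ℂ] V).toRingHom v) =
        p.eval₂ (MvPolynomial.aeval S : MvPolynomial (Fin 2) ℂ →ₐ[ℂ] L).toRingHom (ψ v) := by
      intro p
      rw [← hcomp]
      exact Polynomial.hom_eval₂ p _ ψ.toRingHom v
    refine ⟨p, fun h => hψ' _ h ?_, hψ _ ?_⟩
    · rw [h1, hp]
    · rw [h1]
      exact hp'
  refine ⟨V, inferInstance, inferInstance, hDVR, inferInstance, inferInstance, inferInstance,
    ⟨hRV, arcRing_sameFractionField _ hφ', ⟨fun x hx => ?_⟩,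
      trdeg_residueField_of_arc htr hS ψ hψ θ hψθ⟩, q, hq, ?_, ?_, ?_⟩
  · refine hloc x ?_
    rw [← hιR]
    exact hψ' _ hx
  -- A uniformizer is a quotient of two elements of R, whose orders are multiples of r, so q is one
  -- as well.
  · obtain ⟨a, b, hb, hab⟩ := arcRing_sameFractionField _ hφ' π
    have hab' : ι π * φ b = φ a := by
      rw [← hιR, ← hιR, ← map_mul]
      exact congrArg ι hab
    have ha : a ≠ 0 := by
      rintro rfl
      rw [map_zero] at hab
      rcases mul_eq_zero.1 hab with h | h
      · exact hπ.ne_zero h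
      · exact hb ((map_eq_zero_iff _ hRV).1 h)
    obtain ⟨m, hm⟩ := hr a ha
    obtain ⟨m', hm'⟩ := hr b hb
    have h2 : (ι π).order = q := hπq
    rw [← hab', order_mul, h2, hm'] at hm
    have h3 : q + r * m' = r * m := by exact_mod_cast hm
    exact (Nat.dvd_add_left (dvd_mul_right r m')).1 (h3 ▸ dvd_mul_right r m)
  · intro x hx
    obtain ⟨m, hm, hm'⟩ := hord _ ((map_ne_zero_iff _ hRV).2 hx)
    refine ⟨m, hm, ?_⟩
    rw [← hιR]
    exact hm'
  · intro u hu
    obtain ⟨F, hF, hFu⟩ := exists_linear_functional ι δ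
    let e : Fin 3 → V := ![π, θ 0, θ 1]
    have hspan : Submodule.span V (Set.range fun i => KaehlerDifferential.D ℂ V (e i)) ⊔
        IsLocalRing.maximalIdeal V • (⊤ : Submodule V (Ω[V⁄ℂ])) = ⊤ := by
      refine kaehler_span_sup_smul hπ.maximalIdeal_eq θ hres _ ?_ ?_
      · exact Submodule.subset_span ⟨0, rfl⟩
      · intro i
        fin_cases i
        · exact Submodule.subset_span ⟨1, rfl⟩
        · exact Submodule.subset_span ⟨2, rfl⟩
    -- Expand along the row of π: its entries are δⱼ(ι π), and logarithmic derivations preserve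
    -- divisibility by X^q.
    have hFe : X ^ q ∣ F (wedgeD V e) := by
      rw [hFu, Matrix.det_succ_row_zero]
      refine Finset.dvd_sum fun j _ => Dvd.dvd.mul_right (Dvd.dvd.mul_left ?_ _) _
      exact hδ j q (ι π) (X_pow_dvd_iff_le_order.2 hπq.ge)
    have hdet : F (wedgeD V fun i => algebraMap R V (u i)) =
        Matrix.det (Matrix.of fun i j => δ j (φ (u i))) := by
      rw [hFu]
      simp only [hιR]
    rw [← hdet] at hu ⊢
    exact exists_vanishesToOrder (ι : V →+* L⟦X⟧) hπ hq hπq hord F hF (wedgeD V e)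
      (exteriorPower_span_sup_smul _ _ hspan) hFe _ hu

end PrimeDivisor

end Hyperquotient

namespace Hyperquotient

section ArcField

/-! ### The coefficient field of the arcs -/

/-- An algebraic closure of `ℂ(s, t)`. -/
abbrev ArcField : Type := AlgebraicClosure (FractionRing (MvPolynomial (Fin 2) ℂ))

/-- The two transcendental generators of `ArcField`. -/
noncomputable def arcGen (i : Fin 2) : ArcField :=
  algebraMap (MvPolynomial (Fin 2) ℂ) ArcField (MvPolynomial.X i)

theorem aeval_arcGen (p : MvPolynomial (Fin 2) ℂ) :
    MvPolynomial.aeval arcGen p = algebraMap (MvPolynomial (Fin 2) ℂ) ArcField p := by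
  have h1 : MvPolynomial.aeval arcGen =
      IsScalarTower.toAlgHom ℂ (MvPolynomial (Fin 2) ℂ) ArcField :=
    MvPolynomial.algHom_ext fun i => by simp [arcGen]
  rw [h1]
  rfl

theorem algebraMap_arcField_injective :
    Function.Injective (algebraMap (MvPolynomial (Fin 2) ℂ) ArcField) := by
  rw [IsScalarTower.algebraMap_eq (MvPolynomial (Fin 2) ℂ)
    (FractionRing (MvPolynomial (Fin 2) ℂ)) ArcField]
  exact (algebraMap (FractionRing (MvPolynomial (Fin 2) ℂ)) ArcField).injective.comp
    (IsFractionRing.injective _ _)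

theorem algebraicIndependent_arcGen : AlgebraicIndependent ℂ arcGen := by
  rw [algebraicIndependent_iff_injective_aeval]
  intro p q h
  rw [aeval_arcGen, aeval_arcGen] at h
  exact algebraMap_arcField_injective h

instance : FaithfulSMul (MvPolynomial (Fin 2) ℂ) ArcField :=
  (faithfulSMul_iff_algebraMap_injective _ _).2 algebraMap_arcField_injective

instance : Algebra.IsAlgebraic (MvPolynomial (Fin 2) ℂ) ArcField :=
  have := IsLocalization.isAlgebraic (R := MvPolynomial (Fin 2) ℂ)
    (FractionRing (MvPolynomial (Fin 2) ℂ)) (nonZeroDivisors (MvPolynomial (Fin 2) ℂ))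
  Algebra.IsAlgebraic.trans (MvPolynomial (Fin 2) ℂ) (FractionRing (MvPolynomial (Fin 2) ℂ)) ArcField

theorem trdeg_arcField : Algebra.trdeg ℂ ArcField = 2 := by
  rw [← trdeg_add_eq ℂ (MvPolynomial (Fin 2) ℂ) (A := ArcField),
    MvPolynomial.trdeg_of_isDomain, trdeg_eq_zero]
  simp

/-- Start from any algebraic relation and differentiate while the derivative still vanishes at x. In
characteristic zero the degree drops without reaching the zero polynomial. -/
theorem arcField_exists_separable_relation (x : ArcField) :
    ∃ p : Polynomial (MvPolynomial (Fin 2) ℂ),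
      p.eval₂ (MvPolynomial.aeval arcGen : MvPolynomial (Fin 2) ℂ →ₐ[ℂ] ArcField).toRingHom x = 0 ∧
      p.derivative.eval₂
        (MvPolynomial.aeval arcGen : MvPolynomial (Fin 2) ℂ →ₐ[ℂ] ArcField).toRingHom x ≠ 0 := by
  have h0 : (MvPolynomial.aeval arcGen : MvPolynomial (Fin 2) ℂ →ₐ[ℂ] ArcField).toRingHom =
      algebraMap (MvPolynomial (Fin 2) ℂ) ArcField := RingHom.ext aeval_arcGen
  rw [h0]
  have key : ∀ (n : ℕ) (p : Polynomial (MvPolynomial (Fin 2) ℂ)), p ≠ 0 → p.natDegree = n →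
      p.eval₂ (algebraMap (MvPolynomial (Fin 2) ℂ) ArcField) x = 0 →
      ∃ p : Polynomial (MvPolynomial (Fin 2) ℂ),
        p.eval₂ (algebraMap (MvPolynomial (Fin 2) ℂ) ArcField) x = 0 ∧
        p.derivative.eval₂ (algebraMap (MvPolynomial (Fin 2) ℂ) ArcField) x ≠ 0 := by
    intro n
    induction n using Nat.strong_induction_on with
    | _ n ih =>
      intro p hp hn hpx
      by_cases hd : p.derivative.eval₂ (algebraMap (MvPolynomial (Fin 2) ℂ) ArcField) x = 0
      · have hn0 : n ≠ 0 := by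
          intro h
          rw [h] at hn
          rw [Polynomial.eq_C_of_natDegree_eq_zero hn, Polynomial.eval₂_C] at hpx
          have := (map_eq_zero_iff _ algebraMap_arcField_injective).1 hpx
          rw [Polynomial.eq_C_of_natDegree_eq_zero hn, this, Polynomial.C_0] at hp
          exact hp rfl
        refine ih _ ?_ p.derivative (fun h => hn0 ?_) rfl hd
        · rw [← hn]
          exact Polynomial.natDegree_derivative_lt (by omega)
        · rw [← hn]
          exact Polynomial.derivative_eq_zero.1 h
      · exact ⟨p, hpx, hd⟩
  obtain ⟨p, hp, hpx⟩ := Algebra.IsAlgebraic.isAlgebraic (R := MvPolynomial (Fin 2) ℂ) x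
  exact key _ p hp rfl hpx

instance : Algebra.FormallyEtale (MvPolynomial (Fin 2) ℂ) ArcField := by
  have h1 : Algebra.FormallyEtale (MvPolynomial (Fin 2) ℂ) (FractionRing (MvPolynomial (Fin 2) ℂ)) :=
    Algebra.FormallyEtale.of_isLocalization (nonZeroDivisors (MvPolynomial (Fin 2) ℂ))
  have h2 : Algebra.FormallyEtale (FractionRing (MvPolynomial (Fin 2) ℂ)) ArcField :=
    Algebra.FormallyEtale.of_isSeparable _ _
  exact Algebra.FormallyEtale.comp _ (FractionRing (MvPolynomial (Fin 2) ℂ)) _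

/-- The partial derivatives extend from ℂ[s, t] to its fraction field and then to the algebraic
closure, since both extensions are formally étale. -/
theorem exists_derivation_arcField (i : Fin 2) :
    ∃ d : Derivation ℂ ArcField ArcField, ∀ j, d (arcGen j) = if j = i then 1 else 0 := by
  let d₀ : Derivation ℂ (MvPolynomial (Fin 2) ℂ) ArcField :=
    MvPolynomial.mkDerivation ℂ fun j => if j = i then 1 else 0
  let ℓ := (LinearMap.liftBaseChange ArcField d₀.liftKaehlerDifferential).comp
    (KaehlerDifferential.tensorKaehlerEquivOfFormallyEtale ℂ (MvPolynomial (Fin 2) ℂ)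
      ArcField).symm.toLinearMap
  refine ⟨ℓ.compDer (KaehlerDifferential.D ℂ ArcField), fun j => ?_⟩
  change ℓ (KaehlerDifferential.D ℂ ArcField (arcGen j)) = _
  simp only [ℓ, LinearMap.comp_apply, LinearEquiv.coe_coe, arcGen,
    KaehlerDifferential.tensorKaehlerEquivOfFormallyEtale_symm_D_algebraMap]
  simp [d₀]

/-! ### Derivations of power series rings -/

open PowerSeries

variable {L : Type*} [Field L] [Algebra ℂ L]

/-- A derivation of the coefficients, extended to power series. -/
noncomputable def coeffDerivation (d : Derivation ℂ L L) : Derivation ℂ L⟦X⟧ L⟦X⟧ :=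
  Derivation.mk'
    { toFun := fun p => PowerSeries.mk fun n => d (coeff n p)
      map_add' := fun p q => by ext n; simp
      map_smul' := fun c p => by ext n; simp }
    fun p q => by
      ext n
      simp only [LinearMap.coe_mk, AddHom.coe_mk, coeff_mk, coeff_mul, map_sum,
        Derivation.leibniz, map_add, smul_eq_mul, Finset.sum_add_distrib]
      congr 1
      rw [← Finset.Nat.sum_antidiagonal_swap]
      rfl

theorem coeff_coeffDerivation (d : Derivation ℂ L L) (p : L⟦X⟧) (n : ℕ) :
    coeff n (coeffDerivation d p) = d (coeff n p) := by
  simp [coeffDerivation]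

theorem coeffDerivation_C_mul_X_pow (d : Derivation ℂ L L) (c : L) (n : ℕ) :
    coeffDerivation d (C c * X ^ n) = C (d c) * X ^ n := by
  ext m
  rw [coeff_coeffDerivation, coeff_C_mul, coeff_C_mul, coeff_X_pow]
  split_ifs <;> simp

theorem X_pow_dvd_coeffDerivation (d : Derivation ℂ L L) {n : ℕ} {p : L⟦X⟧} (h : X ^ n ∣ p) :
    X ^ n ∣ coeffDerivation d p := by
  rw [X_pow_dvd_iff] at h ⊢
  intro m hm
  rw [coeff_coeffDerivation, h m hm, map_zero]

variable (L) in
/-- The Euler derivation `X d/dX`. -/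
noncomputable def eulerDerivation : Derivation ℂ L⟦X⟧ L⟦X⟧ :=
  (X : L⟦X⟧) • ((PowerSeries.derivative L).restrictScalars ℂ)

theorem coeff_eulerDerivation (p : L⟦X⟧) (n : ℕ) :
    coeff n (eulerDerivation L p) = n * coeff n p := by
  change coeff n (X * PowerSeries.derivative L p) = _
  cases n with
  | zero => simp
  | succ n => rw [coeff_succ_X_mul, coeff_derivative, mul_comm]; push_cast; ring

theorem eulerDerivation_C_mul_X_pow (c : L) (n : ℕ) :
    eulerDerivation L (C c * X ^ n) = C (n * c) * X ^ n := by
  ext m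
  rw [coeff_eulerDerivation, coeff_C_mul, coeff_C_mul, coeff_X_pow]
  split_ifs with h
  · simp [h]
  · simp

theorem X_pow_dvd_eulerDerivation {n : ℕ} {p : L⟦X⟧} (h : X ^ n ∣ p) :
    X ^ n ∣ eulerDerivation L p := by
  rw [X_pow_dvd_iff] at h ⊢
  intro m hm
  rw [coeff_eulerDerivation, h m hm, mul_zero]

end ArcField

end Hyperquotient

namespace Hyperquotient

section Division

open MvPowerSeries
open scoped NNReal ENNReal

/-! ### Solving linear equations in convergent power series -/

/-- The weighted `ℓ¹` norm of a power series on the polydisc of radius `ρ`. -/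
noncomputable def wnorm (ρ : ℝ≥0) (h : MvPowerSeries (Fin 4) ℂ) : ℝ≥0∞ :=
  ∑' n : Fin 4 →₀ ℕ, ((‖coeff n h‖₊ * ρ ^ n.degree : ℝ≥0) : ℝ≥0∞)

theorem wnorm_ne_top_iff {ρ : ℝ≥0} {h : MvPowerSeries (Fin 4) ℂ} :
    wnorm ρ h ≠ ∞ ↔ Summable fun n : Fin 4 →₀ ℕ => ‖coeff n h‖ * (ρ : ℝ) ^ n.degree := by
  rw [wnorm, ENNReal.tsum_coe_ne_top_iff_summable, ← NNReal.summable_coe]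
  push_cast
  rfl

theorem isConvergent_iff_wnorm {h : MvPowerSeries (Fin 4) ℂ} :
    IsConvergent h ↔ ∃ ρ : ℝ≥0, 0 < ρ ∧ wnorm ρ h ≠ ∞ := by
  constructor
  · rintro ⟨ρ, hρ, hs⟩
    exact ⟨⟨ρ, hρ.le⟩, hρ, wnorm_ne_top_iff.2 hs⟩
  · rintro ⟨ρ, hρ, hs⟩
    exact ⟨ρ, hρ, wnorm_ne_top_iff.1 hs⟩

theorem wnorm_mono {ρ ρ' : ℝ≥0} (h : ρ ≤ ρ') (k : MvPowerSeries (Fin 4) ℂ) :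
    wnorm ρ k ≤ wnorm ρ' k :=
  ENNReal.tsum_le_tsum fun n => by gcongr

theorem wnorm_add_le (ρ : ℝ≥0) (h k : MvPowerSeries (Fin 4) ℂ) :
    wnorm ρ (h + k) ≤ wnorm ρ h + wnorm ρ k := by
  rw [wnorm, wnorm, wnorm, ← ENNReal.tsum_add]
  refine ENNReal.tsum_le_tsum fun n => ?_
  rw [← ENNReal.coe_add, ← add_mul, map_add]
  gcongr
  exact nnnorm_add_le _ _

theorem wnorm_mul_le (ρ : ℝ≥0) (h k : MvPowerSeries (Fin 4) ℂ) :
    wnorm ρ (h * k) ≤ wnorm ρ h * wnorm ρ k := by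
  classical
  calc wnorm ρ (h * k)
      ≤ ∑' n, ∑' p : Finset.HasAntidiagonal.antidiagonal n,
          (((‖coeff p.1.1 h‖₊ * ρ ^ p.1.1.degree : ℝ≥0) : ℝ≥0∞) *
            ((‖coeff p.1.2 k‖₊ * ρ ^ p.1.2.degree : ℝ≥0) : ℝ≥0∞)) := by
        refine ENNReal.tsum_le_tsum fun n => ?_
        rw [tsum_fintype, Finset.sum_coe_sort (Finset.HasAntidiagonal.antidiagonal n) (fun p =>
          (((‖coeff p.1 h‖₊ * ρ ^ p.1.degree : ℝ≥0) : ℝ≥0∞) *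
            ((‖coeff p.2 k‖₊ * ρ ^ p.2.degree : ℝ≥0) : ℝ≥0∞)))]
        have h1 : ∀ p ∈ Finset.HasAntidiagonal.antidiagonal n,
            (((‖coeff p.1 h‖₊ * ρ ^ p.1.degree : ℝ≥0) : ℝ≥0∞) *
            ((‖coeff p.2 k‖₊ * ρ ^ p.2.degree : ℝ≥0) : ℝ≥0∞)) =
            ((‖coeff p.1 h * coeff p.2 k‖₊ * ρ ^ n.degree : ℝ≥0) : ℝ≥0∞) := by
          intro p hp
          rw [← Finset.HasAntidiagonal.mem_antidiagonal.1 hp, map_add, pow_add, nnnorm_mul,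
            ← ENNReal.coe_mul]
          congr 1
          ring
        rw [Finset.sum_congr rfl h1, ← ENNReal.ofNNReal_finsetSum, ← Finset.sum_mul, coeff_mul]
        gcongr
        exact nnnorm_sum_le _ _
    _ = ∑' p : (Fin 4 →₀ ℕ) × (Fin 4 →₀ ℕ),
          (((‖coeff p.1 h‖₊ * ρ ^ p.1.degree : ℝ≥0) : ℝ≥0∞) *
            ((‖coeff p.2 k‖₊ * ρ ^ p.2.degree : ℝ≥0) : ℝ≥0∞)) := by
        rw [← ENNReal.tsum_sigma]
        exact Finset.HasAntidiagonal.sigmaAntidiagonalEquivProd.tsum_eq (fun p =>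
          (((‖coeff p.1 h‖₊ * ρ ^ p.1.degree : ℝ≥0) : ℝ≥0∞) *
            ((‖coeff p.2 k‖₊ * ρ ^ p.2.degree : ℝ≥0) : ℝ≥0∞)))
    _ = wnorm ρ h * wnorm ρ k := by
        rw [ENNReal.tsum_prod (f := fun a b =>
          (((‖coeff a h‖₊ * ρ ^ a.degree : ℝ≥0) : ℝ≥0∞) *
            ((‖coeff b k‖₊ * ρ ^ b.degree : ℝ≥0) : ℝ≥0∞)))]
        simp_rw [ENNReal.tsum_mul_left]
        rw [ENNReal.tsum_mul_right]
        rfl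

/-- Division by the monomial `x^s`, dropping the terms which are not divisible. -/
noncomputable def shift (s : Fin 4 →₀ ℕ) (h : MvPowerSeries (Fin 4) ℂ) :
    MvPowerSeries (Fin 4) ℂ := fun n => coeff (n + s) h

theorem coeff_shift (s n : Fin 4 →₀ ℕ) (h : MvPowerSeries (Fin 4) ℂ) :
    coeff n (shift s h) = coeff (n + s) h := rfl

theorem wnorm_shift_le (ρ : ℝ≥0) (s : Fin 4 →₀ ℕ) (h : MvPowerSeries (Fin 4) ℂ) :
    (ρ : ℝ≥0∞) ^ s.degree * wnorm ρ (shift s h) ≤ wnorm ρ h := by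
  rw [wnorm, ← ENNReal.tsum_mul_left]
  have h1 := ENNReal.tsum_comp_le_tsum_of_injective (add_left_injective s)
    (fun n : Fin 4 →₀ ℕ => ((‖coeff n h‖₊ * ρ ^ n.degree : ℝ≥0) : ℝ≥0∞))
  refine le_trans (le_of_eq ?_) h1
  refine tsum_congr fun n => ?_
  rw [coeff_shift, map_add, pow_add]
  push_cast
  ring

theorem wnorm_le_pow_mul {ρ ρ₀ : ℝ≥0} (hρ₀ : 0 < ρ₀) (h : ρ ≤ ρ₀) {t : ℕ}
    {k : MvPowerSeries (Fin 4) ℂ} (hk : ∀ n, coeff n k ≠ 0 → t ≤ n.degree) :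
    wnorm ρ k ≤ ((ρ ^ t / ρ₀ ^ t : ℝ≥0) : ℝ≥0∞) * wnorm ρ₀ k := by
  rw [wnorm, wnorm, ← ENNReal.tsum_mul_left]
  refine ENNReal.tsum_le_tsum fun n => ?_
  rw [← ENNReal.coe_mul, ENNReal.coe_le_coe]
  by_cases hn : coeff n k = 0
  · simp [hn]
  obtain ⟨m, hm⟩ := Nat.exists_eq_add_of_le (hk n hn)
  rw [hm, pow_add, pow_add]
  have : ρ ^ t / ρ₀ ^ t * (‖coeff n k‖₊ * (ρ₀ ^ t * ρ₀ ^ m)) =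
      ‖coeff n k‖₊ * (ρ ^ t * ρ₀ ^ m) := by
    have := (pow_pos hρ₀ t).ne'
    field_simp
  rw [this]
  gcongr

/-- A series vanishing to order t + 1 has norm O(ρ^(t+1)). One factor ρ is spent on making the
constant at most 1/2. -/
theorem exists_wnorm_le {k : MvPowerSeries (Fin 4) ℂ} (hk : IsConvergent k) {t : ℕ}
    (hkt : ∀ n, coeff n k ≠ 0 → t + 1 ≤ n.degree) :
    ∃ ρ₁ : ℝ≥0, 0 < ρ₁ ∧ ∀ ρ ≤ ρ₁, wnorm ρ k ≤ (ρ : ℝ≥0∞) ^ t * ((1 / 2 : ℝ≥0) : ℝ≥0∞) := by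
  obtain ⟨ρ₀, hρ₀, hfin⟩ := isConvergent_iff_wnorm.1 hk
  lift wnorm ρ₀ k to ℝ≥0 using hfin with c hc
  refine ⟨min ρ₀ (ρ₀ ^ (t + 1) / (2 * (c + 1))), lt_min hρ₀ (by positivity), fun ρ hρ => ?_⟩
  refine (wnorm_le_pow_mul hρ₀ (hρ.trans (min_le_left _ _)) hkt).trans ?_
  rw [← hc, ← ENNReal.coe_mul, ← ENNReal.coe_pow, ← ENNReal.coe_mul, ENNReal.coe_le_coe]
  have h1 : ρ ≤ ρ₀ ^ (t + 1) / (2 * (c + 1)) := hρ.trans (min_le_right _ _)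
  rw [pow_succ, mul_div_assoc, mul_assoc]
  gcongr
  rw [le_div_iff₀ (by positivity)] at h1
  have h2 := (pow_pos hρ₀ (t + 1))
  rw [div_mul_eq_mul_div, div_le_iff₀ h2, one_div, inv_mul_eq_div, le_div_iff₀ (by norm_num)]
  calc ρ * c * 2 = ρ * (2 * c) := by ring
    _ ≤ ρ * (2 * (c + 1)) := by gcongr; exact le_self_add
    _ ≤ _ := h1

/-- The iterates of `q ↦ H + (k q) / x^s`. -/
noncomputable def iterSeries (s : Fin 4 →₀ ℕ) (k H : MvPowerSeries (Fin 4) ℂ) :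
    ℕ → MvPowerSeries (Fin 4) ℂ
  | 0 => 0
  | m + 1 => H + shift s (k * iterSeries s k H m)

theorem coeff_shift_mul_congr {s : Fin 4 →₀ ℕ} {k : MvPowerSeries (Fin 4) ℂ}
    (hks : ∀ n, coeff n k ≠ 0 → s.degree + 1 ≤ n.degree) {m : ℕ}
    {u v : MvPowerSeries (Fin 4) ℂ} (huv : ∀ n, n.degree < m → coeff n u = coeff n v)
    (n : Fin 4 →₀ ℕ) (hn : n.degree < m + 1) :
    coeff n (shift s (k * u)) = coeff n (shift s (k * v)) := by
  classical
  rw [coeff_shift, coeff_shift, coeff_mul, coeff_mul]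
  refine Finset.sum_congr rfl fun p hp => ?_
  by_cases h0 : coeff p.1 k = 0
  · simp [h0]
  have h1 := hks _ h0
  have h2 := congrArg Finsupp.degree (Finset.HasAntidiagonal.mem_antidiagonal.1 hp)
  rw [map_add, map_add] at h2
  rw [huv p.2 (by omega)]

/-- The map q ↦ H + (kq)/x^s is a contraction on a small polydisc: division by x^s costs ρ^(−|s|),
while k has norm at most ρ^|s|/2. Since k vanishes to order |s| + 1, the coefficients of the
iterates stabilise degree by degree, and the uniform bound 2‖H‖ makes the formal limit converge. -/
theorem exists_convergent_solution {s : Fin 4 →₀ ℕ} {k H : MvPowerSeries (Fin 4) ℂ}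
    (hk : IsConvergent k) (hH : IsConvergent H)
    (hks : ∀ n, coeff n k ≠ 0 → s.degree + 1 ≤ n.degree) :
    ∃ q, IsConvergent q ∧ q = H + shift s (k * q) := by
  set Q := iterSeries s k H with hQ
  have hstep : ∀ m n, n.degree < m → coeff n (Q m) = coeff n (Q (m + 1)) := by
    intro m
    induction m with
    | zero => intro n hn; omega
    | succ m ih =>
      intro n hn
      change coeff n (H + shift s (k * Q m)) = coeff n (H + shift s (k * Q (m + 1)))
      rw [map_add, map_add, coeff_shift_mul_congr hks ih n hn]
  have hstab : ∀ n m, n.degree < m → coeff n (Q m) = coeff n (Q (n.degree + 1)) := by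
    intro n m hm
    induction m, hm using Nat.le_induction with
    | base => rfl
    | succ m hm ih => rw [← hstep m n hm, ih]
  let q : MvPowerSeries (Fin 4) ℂ := fun n => coeff n (Q (n.degree + 1))
  have hq : ∀ n, coeff n q = coeff n (Q (n.degree + 1)) := fun n => rfl
  refine ⟨q, ?_, ?_⟩
  · obtain ⟨ρ₁, hρ₁, h1⟩ := exists_wnorm_le hk hks
    obtain ⟨ρ₂, hρ₂, h2⟩ := isConvergent_iff_wnorm.1 hH
    set ρ := min ρ₁ ρ₂ with hρ
    have hρ0 : 0 < ρ := lt_min hρ₁ hρ₂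
    have hHρ : wnorm ρ H ≠ ∞ := ((wnorm_mono (min_le_right _ _) H).trans_lt h2.lt_top).ne
    have hkρ := h1 ρ (min_le_left _ _)
    have hρne : (ρ : ℝ≥0∞) ^ s.degree ≠ 0 := pow_ne_zero _ (by exact_mod_cast hρ0.ne')
    have hρtop : (ρ : ℝ≥0∞) ^ s.degree ≠ ∞ := ENNReal.pow_ne_top ENNReal.coe_ne_top
    have hT : ∀ u, wnorm ρ (shift s (k * u)) ≤ ((1 / 2 : ℝ≥0) : ℝ≥0∞) * wnorm ρ u := by
      intro u
      have h3 := (wnorm_shift_le ρ s (k * u)).trans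
        ((wnorm_mul_le ρ k u).trans (mul_le_mul_left hkρ _))
      rw [mul_assoc] at h3
      exact (ENNReal.mul_le_mul_iff_right hρne hρtop).1 h3
    have hbound : ∀ m, wnorm ρ (Q m) ≤ 2 * wnorm ρ H := by
      intro m
      induction m with
      | zero =>
        change wnorm ρ 0 ≤ _
        simp [wnorm]
      | succ m ih =>
        change wnorm ρ (H + shift s (k * Q m)) ≤ _
        refine (wnorm_add_le _ _ _).trans ?_
        calc wnorm ρ H + wnorm ρ (shift s (k * Q m))
            ≤ wnorm ρ H + ((1 / 2 : ℝ≥0) : ℝ≥0∞) * (2 * wnorm ρ H) := by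
              gcongr
              exact (hT _).trans (by gcongr)
          _ = 2 * wnorm ρ H := by
              rw [← mul_assoc]
              have : ((1 / 2 : ℝ≥0) : ℝ≥0∞) * 2 = 1 := by
                have h4 : ((1 / 2 : ℝ≥0) : ℝ≥0∞) * ((2 : ℝ≥0) : ℝ≥0∞) = 1 := by
                  rw [← ENNReal.coe_mul]
                  norm_num
                exact h4
              rw [this, one_mul, two_mul]
    refine isConvergent_iff_wnorm.2 ⟨ρ, hρ0, ?_⟩
    refine ne_top_of_le_ne_top (ENNReal.mul_ne_top ENNReal.ofNat_ne_top hHρ) (b := 2 * wnorm ρ H) ?_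
    rw [wnorm, ENNReal.tsum_eq_iSup_sum]
    refine iSup_le fun t => ?_
    have h5 : ∀ n ∈ t, coeff n q = coeff n (Q (t.sup Finsupp.degree + 1)) := fun n hn => by
      rw [hq, hstab n _ (Nat.lt_succ_of_le (Finset.le_sup (f := Finsupp.degree) hn))]
    rw [Finset.sum_congr rfl fun n hn => by rw [h5 n hn]]
    exact (ENNReal.sum_le_tsum t).trans (hbound _)
  · ext n
    rw [hq]
    change coeff n (H + shift s (k * Q n.degree)) = _
    rw [map_add, map_add, coeff_shift_mul_congr hks (m := n.degree) (v := q) ?_ n (by omega)]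
    intro j hj
    rw [hq, hstab j _ hj]

/-- A convergent power series with nonzero constant term is invertible. -/
theorem ConvSeries.isUnit_of_constantCoeff_ne_zero {h : ConvSeries}
    (h0 : constantCoeff h.1 ≠ 0) : IsUnit h := by
  set c := constantCoeff h.1 with hc
  have hk : IsConvergent (1 - C c⁻¹ * h.1) :=
    ConvSeries.sub_mem ConvSeries.one_mem (ConvSeries.mul_mem (isConvergent_C c⁻¹) h.2)
  -- The geometric series: with k = 1 − c⁻¹h, the equation q = 1 + kq says that q is inverse to
  -- c⁻¹h.
  obtain ⟨q, hq, hqe⟩ := exists_convergent_solution (s := 0) hk (ConvSeries.one_mem : IsConvergent 1)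
    (by
      intro n hn
      rw [map_zero, zero_add, Nat.one_le_iff_ne_zero]
      intro h1
      rw [Finsupp.degree_eq_zero_iff] at h1
      subst h1
      apply hn
      rw [coeff_zero_eq_constantCoeff_apply, map_sub, map_mul, map_one, constantCoeff_C, ← hc,
        inv_mul_cancel₀ h0, sub_self])
  have h1 : shift 0 ((1 - C c⁻¹ * h.1) * q) = (1 - C c⁻¹ * h.1) * q := by
    ext n
    rw [coeff_shift, add_zero]
  rw [h1] at hqe
  have h2 : h.1 * (C c⁻¹ * q) = 1 := by linear_combination hqe
  exact IsUnit.of_mul_eq_one ⟨C c⁻¹ * q, ConvSeries.mul_mem (isConvergent_C c⁻¹) hq⟩ (Subtype.ext h2)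

/-- Division by `x₁² + g`: the remainder has degree at most one in `x₁`. -/
theorem ConvSeries.exists_division {g : ConvSeries} (hg : ∀ n, coeff n g.1 ≠ 0 → 3 ≤ n.degree)
    (h : ConvSeries) : ∃ q p : ConvSeries, h = (coord 0 ^ 2 + g) * q + p ∧
      ∀ n, coeff n p.1 ≠ 0 → n 0 ≤ 1 := by
  have hsh : IsConvergent (shift (Finsupp.single 0 2) h.1) := by
    obtain ⟨ρ, hρ, hfin⟩ := isConvergent_iff_wnorm.1 h.2
    refine isConvergent_iff_wnorm.2 ⟨ρ, hρ, fun htop => ?_⟩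
    have h1 := wnorm_shift_le ρ (Finsupp.single 0 2) h.1
    rw [htop, ENNReal.mul_top (pow_ne_zero _ (by exact_mod_cast hρ.ne')), top_le_iff] at h1
    exact hfin h1
  -- The quotient is the solution of q = (h − gq)/x₀², where terms not divisible by x₀² are dropped;
  -- those terms form the remainder.
  obtain ⟨q, hq, hqe⟩ := exists_convergent_solution (s := Finsupp.single 0 2) (k := -g.1)
    (ConvSeries.neg_mem g.2) hsh (by
      intro n hn
      rw [map_neg, neg_ne_zero] at hn
      simpa using hg n hn)
  refine ⟨⟨q, hq⟩, h - (coord 0 ^ 2 + g) * ⟨q, hq⟩, by ring, fun n hn => ?_⟩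
  by_contra! hlt
  apply hn
  obtain ⟨m, rfl⟩ : ∃ m, n = m + Finsupp.single 0 2 :=
    ⟨n - Finsupp.single 0 2, (tsub_add_cancel_of_le (Finsupp.single_le_iff.2 hlt)).symm⟩
  change coeff (m + Finsupp.single 0 2) (h.1 - (X 0 ^ 2 + g.1) * q) = 0
  have h2 := congrArg (coeff m) hqe
  rw [map_add, coeff_shift, coeff_shift] at h2
  rw [add_mul, map_sub, map_add, X_pow_eq, add_comm m, coeff_add_monomial_mul, one_mul, h2,
    neg_mul, map_neg, add_comm m]
  ring

end Division

end Hyperquotient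

namespace Hyperquotient

section Arcs

open PowerSeries

/-! ### Square roots of power series -/

variable {L : Type*} [Field L]

section Sqrt

variable [CharZero L]

theorem exists_sq_eq_one_add {w : L⟦X⟧} (hw : constantCoeff w = 0) : ∃ u : L⟦X⟧, u ^ 2 = 1 + w := by
  have hs : PowerSeries.HasSubst w := PowerSeries.HasSubst.of_constantCoeff_zero' hw
  have h1 : (binomialSeries L (1 / 2 : ℚ)) ^ 2 = 1 + X := by
    rw [pow_two, ← binomialSeries_add]
    have h2 := binomialSeries_nat (R := ℚ) (A := L) 1
    rw [pow_one] at h2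
    rw [← h2]
    norm_num
  refine ⟨PowerSeries.substAlgHom (R := L) hs (binomialSeries L (1 / 2 : ℚ)), ?_⟩
  rw [← map_pow, h1, map_add, map_one, substAlgHom_X]

theorem exists_sq_eq [IsAlgClosed L] {v : L⟦X⟧} (hv : constantCoeff v ≠ 0) :
    ∃ u : L⟦X⟧, u ^ 2 = v ∧ constantCoeff u ≠ 0 := by
  obtain ⟨c, hc⟩ := IsAlgClosed.exists_pow_nat_eq (constantCoeff v) (n := 2) (by norm_num)
  obtain ⟨u, hu⟩ := exists_sq_eq_one_add (w := C (constantCoeff v)⁻¹ * v - 1)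
    (by rw [map_sub, map_mul, constantCoeff_C, map_one, inv_mul_cancel₀ hv, sub_self])
  have h1 : (C c * u) ^ 2 = v := by
    rw [mul_pow, ← map_pow, hc, hu, add_sub_cancel, ← mul_assoc, ← map_mul, mul_inv_cancel₀ hv,
      map_one, one_mul]
  refine ⟨C c * u, h1, fun h0 => hv ?_⟩
  rw [← h1, map_pow, h0, zero_pow two_ne_zero]

theorem exists_sq_eq_of_order [IsAlgClosed L] {p : L⟦X⟧} {m : ℕ} (hp : p.order = (2 * m : ℕ)) :
    ∃ u : L⟦X⟧, (X ^ m * u) ^ 2 = p ∧ constantCoeff u ≠ 0 := by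
  have hp0 : p ≠ 0 := by
    rintro rfl
    rw [order_zero] at hp
    exact ENat.natCast_ne_top _ hp.symm
  have hm : p.order.toNat = 2 * m := by rw [hp]; rfl
  obtain ⟨u, hu, hu0⟩ := exists_sq_eq (v := divXPowOrder p)
    ((isUnit_iff_constantCoeff.1 (isUnit_divided_by_X_pow_order hp0)).ne_zero)
  refine ⟨u, ?_, hu0⟩
  rw [mul_pow, hu, ← pow_mul, mul_comm m 2, ← hm, X_pow_order_mul_divXPowOrder]

/-- A square root of a semi-invariant series is semi-invariant up to sign. The sign is + because u
has a nonzero constant term, which rescaling does not change. -/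
theorem rescale_X_pow_mul_of_sq {η : L} (hη : η ≠ 0) {m : ℕ} {u p : L⟦X⟧}
    (hu : (X ^ m * u) ^ 2 = p)
    (hu0 : constantCoeff u ≠ 0) (hp : rescale η p = C (η ^ (2 * m)) * p) :
    rescale η (X ^ m * u) = C (η ^ m) * (X ^ m * u) := by
  have hX : rescale η (X ^ m) = C (η ^ m) * X ^ m := by
    rw [map_pow, rescale_X, mul_pow, ← map_pow]
  have h1 : (rescale η u) ^ 2 = u ^ 2 := by
    rw [← hu, map_pow, map_mul, hX, mul_pow, mul_pow, mul_pow, ← map_pow, ← pow_mul,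
      mul_comm m 2] at hp
    have h2 : (C (η ^ (2 * m)) * (X ^ m) ^ 2 : L⟦X⟧) ≠ 0 :=
      mul_ne_zero ((map_ne_zero_iff C C_injective).2 (pow_ne_zero _ hη))
        (pow_ne_zero _ (pow_ne_zero _ X_ne_zero))
    apply mul_left_cancel₀ h2
    linear_combination hp
  have h3 : rescale η u = u := by
    rcases sq_eq_sq_iff_eq_or_eq_neg.1 h1 with h | h
    · exact h
    · exfalso
      have h4 := congrArg constantCoeff h
      rw [← coeff_zero_eq_constantCoeff_apply, coeff_rescale, pow_zero, one_mul,
        coeff_zero_eq_constantCoeff_apply, map_neg] at h4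
      exact hu0 (self_eq_neg.1 h4)
  rw [map_mul, h3, hX, mul_assoc]

end Sqrt

/-! ### Substitution of power series into convergent power series -/

variable [Algebra ℂ L]

/-- The homomorphism sending the coordinate `xᵢ` to `A i`. -/
noncomputable def evalArc (A : Fin 4 → L⟦X⟧) (hA : ∀ i, constantCoeff (A i) = 0) :
    ConvSeries →ₐ[ℂ] L⟦X⟧ :=
  (MvPowerSeries.substAlgHom
    (MvPowerSeries.hasSubst_of_constantCoeff_zero (a := A) hA)).comp ConvSeries.val

variable {A : Fin 4 → L⟦X⟧} (hA : ∀ i, constantCoeff (A i) = 0)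

theorem evalArc_coord (i : Fin 4) : evalArc A hA (coord i) = A i :=
  MvPowerSeries.substAlgHom_X (MvPowerSeries.hasSubst_of_constantCoeff_zero (a := A) hA) i

theorem coeff_evalArc (h : ConvSeries) (N : ℕ) :
    coeff N (evalArc A hA h) =
      ∑ᶠ n : Fin 4 →₀ ℕ, MvPowerSeries.coeff n h.1 • coeff N (∏ i, A i ^ n i) := by
  have hs := MvPowerSeries.hasSubst_of_constantCoeff_zero (a := A) hA
  have h1 : evalArc A hA h = MvPowerSeries.subst A h.1 :=
    MvPowerSeries.substAlgHom_apply hs h.1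
  rw [h1]
  refine (MvPowerSeries.coeff_subst hs h.1 (Finsupp.single () N)).trans ?_
  refine finsum_congr fun n => ?_
  rw [Finsupp.prod_fintype _ _ (by simp)]
  rfl

theorem evalArc_eq_of_congr {B : Fin 4 → L⟦X⟧} (hB : ∀ i, constantCoeff (B i) = 0)
    (h : ConvSeries)
    (hAB : ∀ n, MvPowerSeries.coeff n h.1 ≠ 0 → ∀ i, n i ≠ 0 → A i = B i) :
    evalArc A hA h = evalArc B hB h := by
  ext N
  rw [coeff_evalArc, coeff_evalArc]
  refine finsum_congr fun n => ?_
  by_cases hn : MvPowerSeries.coeff n h.1 = 0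
  · rw [hn, zero_smul, zero_smul]
  congr 2
  refine Finset.prod_congr rfl fun i _ => ?_
  by_cases hi : n i = 0
  · rw [hi, pow_zero, pow_zero]
  · rw [hAB n hn i hi]

theorem constantCoeff_evalArc (h : ConvSeries) :
    constantCoeff (evalArc A hA h) = algebraMap ℂ L (MvPowerSeries.constantCoeff h.1) := by
  rw [← coeff_zero_eq_constantCoeff_apply, coeff_evalArc, finsum_eq_single _ 0]
  · simp [Algebra.smul_def]
  · intro n hn
    obtain ⟨i, hi⟩ : ∃ i, n i ≠ 0 := by
      by_contra! hcon
      exact hn (Finsupp.ext hcon)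
    rw [coeff_zero_eq_constantCoeff_apply, map_prod, Finset.prod_eq_zero (Finset.mem_univ i),
      smul_zero]
    rw [map_pow, hA, zero_pow hi]

theorem rescale_evalArc {η : L} {c : Fin 4 → ℂ}
    (hc : ∀ i, rescale η (A i) = C (algebraMap ℂ L (c i)) * A i) {h k : ConvSeries}
    (hk : ∀ n, MvPowerSeries.coeff n k.1 = (∏ i, c i ^ n i) * MvPowerSeries.coeff n h.1) :
    rescale η (evalArc A hA h) = evalArc A hA k := by
  have hs := MvPowerSeries.hasSubst_of_constantCoeff_zero (a := A) hA
  ext N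
  rw [coeff_rescale, coeff_evalArc, coeff_evalArc, ← smul_eq_mul, smul_finsum]
  refine finsum_congr fun n => ?_
  have h1 : rescale η (∏ i, A i ^ n i) =
      C (algebraMap ℂ L (∏ i, c i ^ n i)) * ∏ i, A i ^ n i := by
    rw [map_prod, map_prod, map_prod, ← Finset.prod_mul_distrib]
    refine Finset.prod_congr rfl fun i _ => ?_
    rw [map_pow, hc, mul_pow, map_pow, map_pow]
  have h2 := congrArg (coeff N) h1
  rw [coeff_rescale, coeff_C_mul] at h2
  rw [smul_eq_mul, hk, mul_comm (∏ i, c i ^ n i), mul_smul, mul_smul_comm, h2, Algebra.smul_def (∏ i, c i ^ n i)]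

/-! ### Monomial arcs -/

/-- The weight of an exponent. -/
def wt (b : Fin 4 → ℕ) (n : Fin 4 →₀ ℕ) : ℕ := ∑ i, b i * n i

theorem coeff_evalArc_monomial {b : Fin 4 → ℕ} (hb : ∀ i, 0 < b i) {σ : Fin 4 → L}
    (hAσ : ∀ i, i ≠ 0 → A i = C (σ i) * X ^ b i) {h : ConvSeries}
    (h0 : ∀ n, MvPowerSeries.coeff n h.1 ≠ 0 → n 0 = 0) (N : ℕ) :
    ∃ F : Finset (Fin 4 →₀ ℕ), (∀ n, n ∈ F ↔ wt b n = N) ∧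
    coeff N (evalArc A hA h) = ∑ n ∈ F, MvPowerSeries.coeff n h.1 • ∏ i, σ i ^ n i := by
  classical
  have hle : ∀ n : Fin 4 →₀ ℕ, wt b n = N → n ≤ Finsupp.equivFunOnFinite.symm fun _ => N := by
    intro n hn i
    change n i ≤ N
    calc n i ≤ b i * n i := Nat.le_mul_of_pos_left _ (hb i)
      _ ≤ wt b n := Finset.single_le_sum (f := fun i => b i * n i) (fun _ _ => Nat.zero_le _)
          (Finset.mem_univ i)
      _ = N := hn
  set F := (Finset.Iic (Finsupp.equivFunOnFinite.symm fun _ : Fin 4 => N)).filter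
    fun n => wt b n = N with hF
  have hFmem : ∀ n, n ∈ F ↔ wt b n = N := fun n => by
    rw [hF, Finset.mem_filter, Finset.mem_Iic]
    exact ⟨fun h => h.2, fun h => ⟨hle n h, h⟩⟩
  have hcoeff : ∀ n : Fin 4 →₀ ℕ, n 0 = 0 → coeff N (∏ i, A i ^ n i) =
      if wt b n = N then ∏ i, σ i ^ n i else 0 := by
    intro n hn
    have h1 : ∏ i, A i ^ n i = C (∏ i, σ i ^ n i) * X ^ wt b n := by
      rw [map_prod, wt, ← Finset.prod_pow_eq_pow_sum, ← Finset.prod_mul_distrib]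
      refine Finset.prod_congr rfl fun i _ => ?_
      by_cases hi : i = 0
      · subst hi
        rw [hn]
        simp
      · rw [hAσ i hi, mul_pow, map_pow, pow_mul]
    rw [h1, coeff_C_mul, coeff_X_pow]
    simp [eq_comm]
  refine ⟨F, hFmem, ?_⟩
  rw [coeff_evalArc, finsum_eq_sum_of_support_subset (s := F)]
  · refine Finset.sum_congr rfl fun n hn => ?_
    by_cases hn0 : MvPowerSeries.coeff n h.1 = 0
    · rw [hn0, zero_smul, zero_smul]
    · rw [hcoeff n (h0 n hn0), if_pos ((hFmem n).1 hn)]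
  · intro n hn
    rw [Finset.mem_coe, hFmem]
    by_contra hcon
    apply hn
    by_cases hn0 : MvPowerSeries.coeff n h.1 = 0
    · simp [hn0]
    · simp [hcoeff n (h0 n hn0), if_neg hcon]

/-- No cancellation occurs in degree N: the coefficient is a polynomial in s₀, s₁, and distinct
exponents of weight N give distinct monomials in it. Indeed n₀ = 0, and n₁ is determined by n₂, n₃
and the weight because b₁ > 0. -/
theorem order_evalArc_monomial {b : Fin 4 → ℕ} (hb : ∀ i, 0 < b i) {s : Fin 2 → L}
    (hs : AlgebraicIndependent ℂ s)
    (hAσ : ∀ i, i ≠ 0 → A i = C ((![1, 1, s 0, s 1] : Fin 4 → L) i) * X ^ b i) {h : ConvSeries}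
    (h0 : ∀ n, MvPowerSeries.coeff n h.1 ≠ 0 → n 0 = 0) {N : ℕ}
    (hN : ∃ n, MvPowerSeries.coeff n h.1 ≠ 0 ∧ wt b n = N)
    (hmin : ∀ n, MvPowerSeries.coeff n h.1 ≠ 0 → N ≤ wt b n) :
    (evalArc A hA h).order = N := by
  classical
  rw [order_eq_nat]
  constructor
  · obtain ⟨F, hF, hc⟩ := coeff_evalArc_monomial hA hb hAσ h0 N
    rw [hc]
    let e : (Fin 4 →₀ ℕ) → (Fin 2 →₀ ℕ) := fun n => Finsupp.equivFunOnFinite.symm ![n 2, n 3]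
    let P : MvPolynomial (Fin 2) ℂ := ∑ n ∈ F, MvPolynomial.monomial (e n) (MvPowerSeries.coeff n h.1)
    have h1 : MvPolynomial.aeval s P =
        ∑ n ∈ F, MvPowerSeries.coeff n h.1 • ∏ i, (![1, 1, s 0, s 1] : Fin 4 → L) i ^ n i := by
      rw [map_sum]
      refine Finset.sum_congr rfl fun n _ => ?_
      rw [MvPolynomial.aeval_monomial, Finsupp.prod_fintype _ _ (by simp), Algebra.smul_def,
        Fin.prod_univ_two, Fin.prod_univ_four]
      simp [e]
    rw [← h1]
    intro hzero
    have hP : P = 0 := by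
      apply (algebraicIndependent_iff_injective_aeval.1 hs)
      rw [hzero, map_zero]
    obtain ⟨m, hm, hmN⟩ := hN
    have hcm : MvPolynomial.coeff (e m) P = MvPowerSeries.coeff m h.1 := by
      rw [MvPolynomial.coeff_sum, Finset.sum_eq_single m]
      · rw [MvPolynomial.coeff_monomial, if_pos rfl]
      · intro n hn hne
        rw [MvPolynomial.coeff_monomial]
        split_ifs with hen
        · by_contra hcn
          apply hne
          have h2 : n 2 = m 2 := by simpa [e] using DFunLike.congr_fun hen 0
          have h3 : n 3 = m 3 := by simpa [e] using DFunLike.congr_fun hen 1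
          have h4 := h0 n hcn
          have h5 := h0 m hm
          have h6 := (hF n).1 hn
          rw [← hmN, wt, wt, Fin.sum_univ_four, Fin.sum_univ_four, h2, h3, h4, h5] at h6
          have h7 : b 1 * n 1 = b 1 * m 1 := by omega
          have h8 := Nat.eq_of_mul_eq_mul_left (hb 1) h7
          ext i
          fin_cases i
          · exact h4.trans h5.symm
          · exact h8
          · exact h2
          · exact h3
        · rfl
      · intro hcon
        exact absurd ((hF m).2 hmN) hcon
    rw [hP, MvPolynomial.coeff_zero] at hcm
    exact hm hcm.symm
  · intro i hi
    obtain ⟨F, hF, hc⟩ := coeff_evalArc_monomial hA hb hAσ h0 i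
    rw [hc]
    refine Finset.sum_eq_zero fun n hn => ?_
    have : MvPowerSeries.coeff n h.1 = 0 := by
      by_contra hcon
      have := hmin n hcon
      rw [(hF n).1 hn] at this
      omega
    rw [this, zero_smul]

end Arcs

end Hyperquotient

namespace Hyperquotient

/-! ### Equivariant arcs on Y attached to weights -/

section ArcOfWeight

open PowerSeries

theorem xi_pow_self {r : ℕ} (hr : r ≠ 0) : xi r ^ r = 1 :=
  (Complex.isPrimitiveRoot_exp r hr).pow_eq_one

theorem isPrimitiveRoot_xi {r : ℕ} (hr : r ≠ 0) : IsPrimitiveRoot (xi r) r :=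
  Complex.isPrimitiveRoot_exp r hr

theorem xi_pow_eq_xi_pow_iff {r : ℕ} (hr : r ≠ 0) {m n : ℕ} :
    xi r ^ m = xi r ^ n ↔ m ≡ n [MOD r] := by
  rw [((isPrimitiveRoot_xi hr).isOfFinOrder hr).pow_eq_pow_iff_modEq,
    ← (isPrimitiveRoot_xi hr).eq_orderOf]

theorem coeff_mu (r : ℕ) (a : Fin 4 → ℕ) (h : ConvSeries) (n : Fin 4 →₀ ℕ) :
    MvPowerSeries.coeff n (mu r a h).1 =
      (∏ i, (xi r ^ a i) ^ n i) * MvPowerSeries.coeff n h.1 := by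
  change MvPowerSeries.coeff n (MvPowerSeries.rescale _ h.1) = _
  rw [MvPowerSeries.coeff_rescale, Finsupp.prod_fintype _ _ (by simp)]

theorem prod_xi_pow (r : ℕ) (a : Fin 4 → ℕ) (n : Fin 4 →₀ ℕ) :
    ∏ i, (xi r ^ a i) ^ n i = xi r ^ wt a n := by
  simp_rw [wt, ← pow_mul]
  exact Finset.prod_pow_eq_pow_sum _ _ _

theorem wt_modEq_of_semiInvariant {r : ℕ} (hr : r ≠ 0) {a : Fin 4 → ℕ} {e : ℕ} {f : ConvSeries}
    (hf : mu r a f = xi r ^ e • f) {n : Fin 4 →₀ ℕ} (hn : MvPowerSeries.coeff n f.1 ≠ 0) :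
    wt a n ≡ e [MOD r] := by
  have h1 := coeff_mu r a f n
  rw [hf, prod_xi_pow] at h1
  have h2 : MvPowerSeries.coeff n (xi r ^ e • f).1 = xi r ^ e * MvPowerSeries.coeff n f.1 := rfl
  rw [h2] at h1
  exact (xi_pow_eq_xi_pow_iff hr).1 (mul_right_cancel₀ hn h1).symm

theorem wt_modEq {r j : ℕ} {a b : Fin 4 → ℕ} (hab : ∀ i, b i ≡ j * a i [MOD r])
    (n : Fin 4 →₀ ℕ) : wt b n ≡ j * wt a n [MOD r] := by
  rw [wt, wt, Finset.mul_sum]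
  refine Nat.ModEq.sum fun i _ => ?_
  rw [← mul_assoc]
  exact (hab i).mul_right _

/-- `ArcField` is algebraic over ℂ[s₀, s₁], which contains the generators `arcGen i`. Two elements
with this property in a field of transcendence degree 2 are independent. -/
theorem algebraicIndependent_of_pow {m : ℕ} {s : Fin 2 → ArcField}
    (hs : ∀ i, s i ^ m = arcGen i) : AlgebraicIndependent ℂ s := by
  let B := Algebra.adjoin ℂ (Set.range s)
  have hmem : ∀ i, arcGen i ∈ B := fun i => by
    rw [← hs]
    exact pow_mem (Algebra.subset_adjoin (Set.mem_range_self i)) m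
  let S : Fin 2 → B := fun i => ⟨arcGen i, hmem i⟩
  let ψ : MvPolynomial (Fin 2) ℂ →ₐ[ℂ] B := MvPolynomial.aeval S
  have hψ : ∀ p, (ψ p : ArcField) = algebraMap (MvPolynomial (Fin 2) ℂ) ArcField p := by
    intro p
    rw [← aeval_arcGen]
    have h1 : B.val.comp ψ = MvPolynomial.aeval arcGen :=
      MvPolynomial.algHom_ext fun i => by simp [ψ, S]
    exact DFunLike.congr_fun h1 p
  have halg : Algebra.IsAlgebraic B ArcField := ⟨fun x => by
    obtain ⟨p, hp, hpx⟩ := Algebra.IsAlgebraic.isAlgebraic (R := MvPolynomial (Fin 2) ℂ) x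
    have hinj : Function.Injective ψ.toRingHom := by
      intro p q h
      apply algebraMap_arcField_injective
      rw [← hψ, ← hψ]
      exact congrArg Subtype.val h
    refine ⟨p.map ψ.toRingHom, (Polynomial.map_ne_zero_iff hinj).2 hp, ?_⟩
    rw [Polynomial.aeval_def, Polynomial.eval₂_map]
    have h2 : (algebraMap B ArcField).comp ψ.toRingHom =
        algebraMap (MvPolynomial (Fin 2) ℂ) ArcField := RingHom.ext hψ
    rw [h2]
    exact hpx⟩
  refine (Algebra.IsAlgebraic.isTranscendenceBasis_of_le_trdeg_of_finite ℂ s ?_).1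
  rw [trdeg_arcField]
  simp

/-- Since g has even order 2b₀ along the monomial part of the arc, −g has a square root there, and
it is taken as x₀. Rescaling X by ξ_r acts on the arc as μʲ, because bᵢ ≡ jaᵢ. The exponent r b₁ is
chosen so that `arcGen i` becomes a quotient of monomials in the invariant functions xₗ^r. -/
theorem exists_arc {r j e : ℕ} (hr : r ≠ 0) {a b : Fin 4 → ℕ} (hb : ∀ i, 0 < b i)
    (hab : ∀ i, b i ≡ j * a i [MOD r]) {g : ConvSeries}
    (hg0 : ∀ n, MvPowerSeries.coeff n g.1 ≠ 0 → n 0 = 0)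
    (hge : ∀ n, MvPowerSeries.coeff n g.1 ≠ 0 → wt a n ≡ e [MOD r])
    (hex : ∃ n, MvPowerSeries.coeff n g.1 ≠ 0 ∧ wt b n = 2 * b 0)
    (hmin : ∀ n, MvPowerSeries.coeff n g.1 ≠ 0 → 2 * b 0 ≤ wt b n) :
    ∃ (s : Fin 2 → ArcField) (φ : ConvSeries →ₐ[ℂ] ArcField⟦X⟧),
      (∀ i, s i ^ (r * b 1) = arcGen i) ∧ φ (coord 0 ^ 2 + g) = 0 ∧
      (φ (coord 0)).order = b 0 ∧
      (∀ i, i ≠ 0 → φ (coord i) = C ((![1, 1, s 0, s 1] : Fin 4 → ArcField) i) * X ^ b i) ∧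
      (∀ h : ConvSeries, constantCoeff (φ h) =
        algebraMap ℂ ArcField (MvPowerSeries.constantCoeff h.1)) ∧
      (∀ h : ConvSeries, (∀ n, MvPowerSeries.coeff n h.1 ≠ 0 → n 0 = 0) → φ h = 0 → h = 0) ∧
      (∀ h : ConvSeries, rescale (algebraMap ℂ ArcField (xi r)) (φ h) =
        φ (mu r (fun i => j * a i) h)) := by
  have hrb : 0 < r * b 1 := Nat.mul_pos (Nat.pos_of_ne_zero hr) (hb 1)
  choose s hs using fun i => IsAlgClosed.exists_pow_nat_eq (arcGen i) hrb
  have hsi := algebraicIndependent_of_pow hs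
  set σ : Fin 4 → ArcField := ![1, 1, s 0, s 1] with hσ
  set η : ArcField := algebraMap ℂ ArcField (xi r) with hη
  have hη0 : η ≠ 0 := by
    rw [hη, Ne, _root_.map_eq_zero, ← norm_eq_zero, norm_xi]
    exact one_ne_zero
  have hηpow : ∀ m, η ^ m = algebraMap ℂ ArcField (xi r ^ m) := fun m => (map_pow _ _ _).symm
  have hmono : ∀ i, constantCoeff (C (σ i) * X ^ b i) = 0 := fun i => by
    rw [map_mul, map_pow, constantCoeff_X, zero_pow (hb i).ne', mul_zero]
  let B : Fin 4 → ArcField⟦X⟧ := fun i => if i = 0 then 0 else C (σ i) * X ^ b i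
  have hB : ∀ i, constantCoeff (B i) = 0 := fun i => by
    by_cases hi : i = 0
    · simp [B, hi]
    · simp only [B, if_neg hi, hmono]
  have hBσ : ∀ i, i ≠ 0 → B i = C (σ i) * X ^ b i := fun i hi => if_neg hi
  have hγ := order_evalArc_monomial hB hb hsi hBσ hg0 hex hmin
  set γ := evalArc B hB g with hγdef
  obtain ⟨u, hu, hu0⟩ := exists_sq_eq_of_order (p := -γ) (m := b 0) (by rw [order_neg, hγ])
  let A : Fin 4 → ArcField⟦X⟧ := fun i => if i = 0 then X ^ b 0 * u else C (σ i) * X ^ b i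
  have hA : ∀ i, constantCoeff (A i) = 0 := fun i => by
    by_cases hi : i = 0
    · simp [A, hi, zero_pow (hb 0).ne']
    · simp only [A, if_neg hi, hmono]
  have hAσ : ∀ i, i ≠ 0 → A i = C (σ i) * X ^ b i := fun i hi => if_neg hi
  have hA0 : A 0 = X ^ b 0 * u := if_pos rfl
  have hAg : evalArc A hA g = γ := evalArc_eq_of_congr hA hB g fun n hn i hi => by
    have : i ≠ 0 := by
      rintro rfl
      exact hi (hg0 n hn)
    rw [hAσ i this, hBσ i this]
  have hc : ∀ i, i ≠ 0 → rescale η (C (σ i) * X ^ b i) =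
      C (algebraMap ℂ ArcField (xi r ^ (j * a i))) * (C (σ i) * X ^ b i) := by
    intro i _
    have h1 : rescale η (C (σ i)) = C (σ i) := by
      ext m
      rw [coeff_rescale, coeff_C]
      split_ifs with hm <;> simp [hm]
    rw [map_mul, map_pow, rescale_X, h1, mul_pow, ← map_pow, hηpow,
      (xi_pow_eq_xi_pow_iff hr).2 (hab i)]
    ring
  -- All monomials of g have the same μʲ-weight mod r, and one of them has b-weight 2b₀.
  have hwt : ∀ n, MvPowerSeries.coeff n g.1 ≠ 0 → wt (fun i => j * a i) n ≡ 2 * b 0 [MOD r] := by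
    intro n hn
    obtain ⟨m, hm, hmb⟩ := hex
    have h1 : wt (fun i => j * a i) n = j * wt a n := by
      simp only [wt, Finset.mul_sum, mul_assoc]
    rw [h1, ← hmb]
    exact ((hge n hn).mul_left j).trans (((hge m hm).mul_left j).symm.trans (wt_modEq hab m).symm)
  have hγη : rescale η γ = C (η ^ (2 * b 0)) * γ := by
    have h1 : rescale η (evalArc B hB g) = evalArc B hB (xi r ^ (2 * b 0) • g) := by
      refine rescale_evalArc hB (c := fun i => xi r ^ (j * a i)) (fun i => ?_) fun n => ?_
      · by_cases hi : i = 0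
        · simp [B, hi]
        · rw [hBσ i hi]
          exact hc i hi
      · rw [prod_xi_pow]
        change xi r ^ (2 * b 0) * MvPowerSeries.coeff n g.1 = _
        by_cases hn : MvPowerSeries.coeff n g.1 = 0
        · rw [hn, mul_zero, mul_zero]
        · rw [(xi_pow_eq_xi_pow_iff hr).2 (hwt n hn)]
    rw [hγdef, h1, map_smul, hηpow]
    ext n
    rw [coeff_C_mul, ← Algebra.smul_def]
    rfl
  have hcA : ∀ i, rescale η (A i) = C (algebraMap ℂ ArcField (xi r ^ (j * a i))) * A i := by
    intro i
    by_cases hi : i = 0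
    · subst hi
      rw [hA0, rescale_X_pow_mul_of_sq hη0 hu hu0 (by rw [map_neg, hγη, mul_neg]), hηpow,
        (xi_pow_eq_xi_pow_iff hr).2 (hab 0)]
    · rw [hAσ i hi]
      exact hc i hi
  refine ⟨s, evalArc A hA, hs, ?_, ?_, fun i hi => ?_, constantCoeff_evalArc hA, fun h h0 hh => ?_,
    fun h => ?_⟩
  · rw [map_add, map_pow, evalArc_coord, hA0, hu, hAg, neg_add_cancel]
  · rw [evalArc_coord, hA0, order_mul, order_X_pow, order_zero_of_unit
      (isUnit_iff_constantCoeff.2 hu0.isUnit), add_zero]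
  · rw [evalArc_coord]
    exact hAσ i hi
  · by_contra hne
    have h1 : ∃ N, ∃ n, MvPowerSeries.coeff n h.1 ≠ 0 ∧ wt b n = N := by
      by_contra! hcon
      apply hne
      refine Subtype.ext (MvPowerSeries.ext fun n => ?_)
      by_contra hn
      exact hcon _ n hn rfl
    classical
    have h2 := order_evalArc_monomial hA hb hsi hAσ h0 (Nat.find_spec h1)
      fun n hn => Nat.find_min' h1 ⟨n, hn, rfl⟩
    rw [hh, order_zero] at h2
    exact ENat.natCast_ne_top _ h2.symm
  · exact rescale_evalArc hA hcA fun n => coeff_mu r _ h n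

end ArcOfWeight

end Hyperquotient

namespace Hyperquotient

section LocalRing

/-! ### The local ring of the quotient -/

theorem mem_localRingX_iff {r : ℕ} {a : Fin 4 → ℕ} {f : ConvSeries} {x : LocalRingY f} :
    x ∈ LocalRingX r a f ↔ ∃ h : ConvSeries, toY f (mu r a h) = toY f h ∧ toY f h = x := by
  rw [LocalRingX, Subalgebra.mem_map]
  exact Iff.rfl

theorem toY_eq_iff {f h k : ConvSeries} : toY f h = toY f k ↔ f ∣ h - k := by
  rw [← Ideal.mem_span_singleton]
  exact Ideal.Quotient.mk_eq_mk_iff_sub_mem h k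

theorem toY_eq_zero_iff {f h : ConvSeries} : toY f h = 0 ↔ f ∣ h := by
  rw [← Ideal.mem_span_singleton]
  exact Ideal.Quotient.eq_zero_iff_mem

theorem ConvSeries.ext_coeff {h k : ConvSeries}
    (H : ∀ n, MvPowerSeries.coeff n h.1 = MvPowerSeries.coeff n k.1) : h = k :=
  Subtype.ext (MvPowerSeries.ext H)

theorem toY_mu_mul {r : ℕ} {a : Fin 4 → ℕ} {e : ℕ} {f : ConvSeries}
    (hf : mu r a f = xi r ^ e • f) {h : ConvSeries} (hh : toY f (mu r a h) = toY f h) (j : ℕ) :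
    toY f (mu r (fun i => j * a i) h) = toY f h := by
  induction j with
  | zero =>
    congr 1
    refine ConvSeries.ext_coeff fun n => ?_
    rw [coeff_mu]
    simp
  | succ j ih =>
    have h1 : mu r (fun i => (j + 1) * a i) h = mu r a (mu r (fun i => j * a i) h) := by
      refine ConvSeries.ext_coeff fun n => ?_
      rw [coeff_mu, coeff_mu, coeff_mu, ← mul_assoc, ← Finset.prod_mul_distrib]
      congr 1
      refine Finset.prod_congr rfl fun i _ => ?_
      rw [← mul_pow, ← pow_add]
      ring_nf
    rw [h1, ← hh]
    rw [toY_eq_iff] at ih ⊢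
    rw [← map_sub]
    obtain ⟨k, hk⟩ := ih
    rw [hk, map_mul, hf, smul_mul_assoc, ← mul_smul_comm]
    exact dvd_mul_right _ _

theorem isUnit_localRingX {r : ℕ} {a : Fin 4 → ℕ} {f h : ConvSeries}
    (hh : toY f (mu r a h) = toY f h) (hu : IsUnit h) (x : LocalRingX r a f)
    (hx : (x : LocalRingY f) = toY f h) : IsUnit x := by
  obtain ⟨k, hk⟩ := hu.exists_right_inv
  have h1 : toY f h * toY f k = 1 := by rw [← map_mul, hk, map_one]
  have h2 : toY f (mu r a k) = toY f k := by
    calc toY f (mu r a k) = toY f (mu r a k) * (toY f (mu r a h) * toY f k) := by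
          rw [hh, h1, mul_one]
      _ = toY f (mu r a (h * k)) * toY f k := by rw [map_mul, map_mul]; ring
      _ = toY f k := by rw [hk, map_one, map_one, one_mul]
  have h3 : toY f k ∈ LocalRingX r a f := mem_localRingX_iff.2 ⟨k, h2, rfl⟩
  refine IsUnit.of_mul_eq_one ⟨_, h3⟩ (Subtype.ext ?_)
  change (x : LocalRingY f) * toY f k = 1
  rw [hx, h1]

theorem mu_coord_pow {r : ℕ} (hr : r ≠ 0) (a : Fin 4 → ℕ) (i : Fin 4) :
    mu r a (coord i ^ r) = coord i ^ r := by
  have h1 : mu r a (coord i) = xi r ^ a i • coord i := by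
    refine ConvSeries.ext_coeff fun n => ?_
    change _ = xi r ^ a i * MvPowerSeries.coeff n (MvPowerSeries.X i)
    rw [coeff_mu]
    change _ * MvPowerSeries.coeff n (MvPowerSeries.X i) = _
    classical
    rw [MvPowerSeries.coeff_X]
    split_ifs with hn
    · subst hn
      rw [mul_one, mul_one, Finset.prod_eq_single i]
      · simp
      · intro j _ hj
        simp [hj.symm]
      · simp
    · rw [mul_zero, mul_zero]
  rw [map_pow, h1, smul_pow, ← pow_mul, mul_comm, pow_mul, xi_pow_self hr, one_pow, one_smul]

/-- Since mld < 1 and the infimum of the empty set is ⊤, there is at least one prime divisor, and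
𝒪_X embeds into its valuation ring. -/
theorem isDomain_localRingX {ε : ℝ} {r : ℕ} {a : Fin 4 → ℕ} {e : ℕ} {f : ConvSeries}
    (hX : IsHyperquotientSingularity ε r a e f) : IsDomain (LocalRingX r a f) := by
  have h1 : (logDiscrepancies r a f).Nonempty := by
    by_contra hne
    rw [Set.not_nonempty_iff_eq_empty] at hne
    have h2 := hX.mld_lt
    rw [mld, hne, Set.image_empty, sInf_empty] at h2
    exact not_top_lt h2
  obtain ⟨c, V, _, _, _, _, _, _, hV, _⟩ := h1
  exact Function.Injective.isDomain (algebraMap (LocalRingX r a f) V) hV.injective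

/-- The reflection `x₁ ↦ -x₁`. -/
noncomputable def reflection : ConvSeries →ₐ[ℂ] ConvSeries := mu 2 ![1, 0, 0, 0]

theorem coeff_reflection (h : ConvSeries) (n : Fin 4 →₀ ℕ) :
    MvPowerSeries.coeff n (reflection h).1 = (-1) ^ n 0 * MvPowerSeries.coeff n h.1 := by
  have h1 : xi 2 = -1 := (isPrimitiveRoot_xi two_ne_zero).eq_neg_one_of_two_right
  rw [reflection, coeff_mu, Fin.prod_univ_four, h1]
  simp

theorem reflection_reflection (h : ConvSeries) : reflection (reflection h) = h := by
  refine ConvSeries.ext_coeff fun n => ?_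
  rw [coeff_reflection, coeff_reflection, ← mul_assoc, ← mul_pow]
  simp

theorem mu_reflection (r : ℕ) (a : Fin 4 → ℕ) (h : ConvSeries) :
    mu r a (reflection h) = reflection (mu r a h) := by
  refine ConvSeries.ext_coeff fun n => ?_
  rw [coeff_mu, coeff_reflection, coeff_reflection, coeff_mu]
  ring

theorem reflection_eq_self {h : ConvSeries} (h0 : ∀ n, MvPowerSeries.coeff n h.1 ≠ 0 → n 0 = 0) :
    reflection h = h := by
  refine ConvSeries.ext_coeff fun n => ?_
  rw [coeff_reflection]
  by_cases hn : MvPowerSeries.coeff n h.1 = 0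
  · rw [hn, mul_zero]
  · rw [h0 n hn, pow_zero, one_mul]

theorem reflection_coord_sq : reflection (coord 0 ^ 2) = coord 0 ^ 2 :=
  mu_coord_pow two_ne_zero _ 0

/-- Averaging the division of h with its reflection removes the part of the remainder that is linear
in x₀. -/
theorem exists_even_remainder {g : ConvSeries}
    (hg0 : ∀ n, MvPowerSeries.coeff n g.1 ≠ 0 → n 0 = 0)
    (hg3 : ∀ n, MvPowerSeries.coeff n g.1 ≠ 0 → 3 ≤ n.degree) {h : ConvSeries}
    (hh : reflection h = h) : ∃ q p : ConvSeries, h = (coord 0 ^ 2 + g) * q + p ∧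
      ∀ n, MvPowerSeries.coeff n p.1 ≠ 0 → n 0 = 0 := by
  obtain ⟨q, p, hqp, hp⟩ := ConvSeries.exists_division hg3 h
  refine ⟨(1 / 2 : ℂ) • (q + reflection q), (1 / 2 : ℂ) • (p + reflection p), ?_, fun n hn => ?_⟩
  · have h1 : h = (coord 0 ^ 2 + g) * reflection q + reflection p := by
      conv_lhs => rw [← hh, hqp]
      rw [map_add, map_mul, map_add, reflection_coord_sq, reflection_eq_self hg0]
    have h2 : h = (1 / 2 : ℂ) • (h + h) := by
      rw [← two_smul ℂ h, smul_smul]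
      norm_num
    rw [h2]
    nth_rewrite 1 [hqp]
    rw [h1, mul_smul_comm, ← smul_add]
    congr 1
    ring
  · by_contra hne
    apply hn
    change (1 / 2 : ℂ) * (MvPowerSeries.coeff n p.1 + MvPowerSeries.coeff n (reflection p).1) = 0
    rw [coeff_reflection]
    by_cases hpn : MvPowerSeries.coeff n p.1 = 0
    · simp [hpn]
    · have h1 : n 0 = 1 := by
        have := hp n hpn
        omega
      rw [h1]
      ring

/-- A norm argument. The product of h with its reflection is even in x₀, hence congruent mod f to a
series in x₁, x₂, x₃. That series vanishes along the arc, so it is zero. As 𝒪_X is a domain, h or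
its reflection vanishes on Y, and the reflection preserves f. -/
theorem injective_of_arc {A : Type*} [CommRing A] [IsDomain A] [Algebra ℂ A]
    {r : ℕ} {a : Fin 4 → ℕ} {f g : ConvSeries} (hfg : f = coord 0 ^ 2 + g)
    (hg0 : ∀ n, MvPowerSeries.coeff n g.1 ≠ 0 → n 0 = 0)
    (hg3 : ∀ n, MvPowerSeries.coeff n g.1 ≠ 0 → 3 ≤ n.degree) [IsDomain (LocalRingX r a f)]
    (φ : ConvSeries →ₐ[ℂ] A) (hφf : φ f = 0)
    (hφ0 : ∀ h : ConvSeries, (∀ n, MvPowerSeries.coeff n h.1 ≠ 0 → n 0 = 0) → φ h = 0 → h = 0)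
    {h : ConvSeries} (hh : toY f (mu r a h) = toY f h) (hφh : φ h = 0) : toY f h = 0 := by
  by_contra hne
  have hf : reflection f = f := by
    rw [hfg, map_add, reflection_coord_sq, reflection_eq_self hg0]
  have hne' : toY f (reflection h) ≠ 0 := by
    intro h0
    apply hne
    rw [toY_eq_zero_iff] at h0 ⊢
    obtain ⟨k, hk⟩ := h0
    refine ⟨reflection k, ?_⟩
    rw [← reflection_reflection h, hk, map_mul, hf]
  have hh' : toY f (mu r a (reflection h)) = toY f (reflection h) := by
    rw [mu_reflection]
    rw [toY_eq_iff] at hh ⊢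
    obtain ⟨k, hk⟩ := hh
    refine ⟨reflection k, ?_⟩
    rw [← map_sub, hk, map_mul, hf]
  let x : LocalRingX r a f := ⟨_, mem_localRingX_iff.2 ⟨h, hh, rfl⟩⟩
  let y : LocalRingX r a f := ⟨_, mem_localRingX_iff.2 ⟨_, hh', rfl⟩⟩
  have hx : x ≠ 0 := fun h0 => hne (congrArg Subtype.val h0)
  have hy : y ≠ 0 := fun h0 => hne' (congrArg Subtype.val h0)
  have key : ∀ {B : Type} [CommRing B] [IsDomain B] {x y : B}, x * y = 0 → x = 0 ∨ y = 0 :=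
    mul_eq_zero.1
  refine (key (x := x) (y := y) (Subtype.ext ?_)).elim hx hy
  change toY f h * toY f (reflection h) = 0
  rw [← map_mul, toY_eq_zero_iff]
  obtain ⟨q, p, hqp, hp⟩ := exists_even_remainder hg0 hg3 (h := h * reflection h)
    (by rw [map_mul, reflection_reflection, mul_comm])
  rw [← hfg] at hqp
  have h1 := congrArg φ hqp
  rw [map_mul, hφh, zero_mul, map_add, map_mul, hφf, zero_mul, zero_add] at h1
  rw [hqp, hφ0 p hp h1.symm, add_zero]
  exact dvd_mul_right _ _

/-! ### The Jacobian -/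

theorem partialDeriv_coord_pow (j i : Fin 4) (m : ℕ) :
    partialDeriv j (coord i ^ m) = if j = i then (m : ConvSeries) * coord i ^ (m - 1) else 0 := by
  apply Subtype.ext
  have h1 : (partialDeriv j (coord i ^ m)).1 =
      MvPowerSeries.pderiv ℂ j ((MvPowerSeries.X i : MvPowerSeries (Fin 4) ℂ) ^ m) := rfl
  rw [h1, Derivation.leibniz_pow]
  split_ifs with hij
  · subst hij
    rw [MvPowerSeries.pderiv_X_self]
    rw [smul_eq_mul, mul_one, nsmul_eq_mul]
    rfl
  · rw [MvPowerSeries.pderiv_X_of_ne (Ne.symm hij)]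
    simp

theorem partialDeriv_zero_eq {g : ConvSeries}
    (hg0 : ∀ n, MvPowerSeries.coeff n g.1 ≠ 0 → n 0 = 0) :
    partialDeriv 0 (coord 0 ^ 2 + g) = 2 * coord 0 := by
  have h1 : partialDeriv 0 g = 0 := by
    refine ConvSeries.ext_coeff fun n => ?_
    change MvPowerSeries.coeff n (MvPowerSeries.pderiv ℂ 0 g.1) = 0
    rw [MvPowerSeries.coeff_pderiv]
    by_cases hn : MvPowerSeries.coeff (n + Finsupp.single 0 1) g.1 = 0
    · rw [hn, zero_mul]
    · have := hg0 _ hn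
      simp at this
  have h2 : partialDeriv 0 (coord 0 ^ 2 + g) = partialDeriv 0 (coord 0 ^ 2) + partialDeriv 0 g :=
    Subtype.ext (map_add _ _ _)
  rw [h2, h1, add_zero, partialDeriv_coord_pow, if_pos rfl]
  norm_num

/-- The rows of the powers xᵢ^r have only their diagonal entry, so ∂f/∂x₀ = 2x₀ is the only
contribution of f. -/
theorem jacobian_coord_pow {g : ConvSeries}
    (hg0 : ∀ n, MvPowerSeries.coeff n g.1 ≠ 0 → n 0 = 0) (r : ℕ) :
    jacobian (coord 0 ^ 2 + g) (fun i => coord i.succ ^ r) =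
      2 * coord 0 * ((r : ConvSeries) ^ 3 * (coord 1 * coord 2 * coord 3) ^ (r - 1)) := by
  rw [jacobian, Matrix.det_of_isUpperTriangular]
  · rw [Fin.prod_univ_succ, Fin.prod_univ_three]
    simp only [Matrix.of_apply, Fin.cons_zero, Fin.cons_succ, partialDeriv_coord_pow, if_true,
      partialDeriv_zero_eq hg0]
    have h1 : (Fin.succ 0 : Fin 4) = 1 := rfl
    have h2 : (Fin.succ 1 : Fin 4) = 2 := rfl
    have h3 : (Fin.succ 2 : Fin 4) = 3 := rfl
    rw [h1, h2, h3, mul_pow, mul_pow]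
    ring
  · intro i j hij
    obtain ⟨i, rfl⟩ := Fin.exists_succ_eq.2 (Fin.ne_zero_of_lt hij)
    simp only [Matrix.of_apply, Fin.cons_succ, partialDeriv_coord_pow]
    rw [if_neg]
    exact hij.ne

end LocalRing

end Hyperquotient

namespace Hyperquotient

/-! ### The log discrepancy of the divisor of an arc -/

section KeyInequality

open PowerSeries

theorem order_C_mul_X_pow {L : Type*} [Field L] {c : L} (hc : c ≠ 0) (n : ℕ) :
    (C c * X ^ n : L⟦X⟧).order = n := by
  rw [order_mul, order_X_pow, order_zero_of_unit, zero_add]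
  exact isUnit_iff_constantCoeff.2 (by rw [constantCoeff_C]; exact hc.isUnit)

theorem dvd_order_of_rescale_eq {L : Type*} [Field L] {η : L} {r : ℕ} (hη : IsPrimitiveRoot η r)
    {p : L⟦X⟧} (hp : rescale η p = p) (h0 : p ≠ 0) : ∃ m : ℕ, p.order = (r * m : ℕ) := by
  have h1 := congrArg (coeff p.order.toNat) hp
  rw [coeff_rescale] at h1
  have h2 : η ^ p.order.toNat = 1 :=
    mul_right_cancel₀ (coeff_order h0) (h1.trans (one_mul _).symm)
  obtain ⟨m, hm⟩ := hη.dvd_of_pow_eq_one _ h2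
  exact ⟨m, by rw [← hm, coe_toNat_order h0]⟩

theorem derivation_eq_zero_of_pow {L : Type*} [Field L] [CharZero L] [Algebra ℂ L]
    (d : Derivation ℂ L L) {x : L} (hx : x ≠ 0) {m : ℕ} (hm : m ≠ 0) :
    d (x ^ m) = 0 ↔ d x = 0 := by
  rw [Derivation.leibniz_pow, smul_eq_mul, nsmul_eq_mul, mul_eq_zero, mul_eq_zero,
    Nat.cast_eq_zero, pow_eq_zero_iff']
  tauto

/-- The matrix is lower triangular, because `d i` kills the other generator. Its diagonal entries
are nonzero: `d i` is 1 on `arcGen i`, a power of `s i`, so it does not kill `s i`. -/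
theorem det_arc {r : ℕ} (hr : r ≠ 0) {b : Fin 4 → ℕ} (hb : ∀ i, 0 < b i) {s : Fin 2 → ArcField}
    (hs : ∀ i, s i ^ (r * b 1) = arcGen i) {d : Fin 2 → Derivation ℂ ArcField ArcField}
    (hd : ∀ i j, d i (arcGen j) = if j = i then 1 else 0) {u : Fin 3 → ArcField⟦X⟧}
    (hu : ∀ i, u i = (C ((![1, s 0, s 1] : Fin 3 → ArcField) i) * X ^ b i.succ) ^ r) :
    (Matrix.det (Matrix.of fun i j => (![eulerDerivation ArcField, coeffDerivation (d 0),
      coeffDerivation (d 1)] : Fin 3 → Derivation ℂ ArcField⟦X⟧ ArcField⟦X⟧) j (u i))).order =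
      (r * (b 1 + b 2 + b 3) : ℕ) := by
  have hrb : r * b 1 ≠ 0 := mul_ne_zero hr (hb 1).ne'
  have hgen : ∀ i, arcGen i ≠ 0 := fun i => by
    rw [arcGen, Ne, map_eq_zero_iff _ algebraMap_arcField_injective]
    exact MvPolynomial.X_ne_zero i
  have hs0 : ∀ i, s i ≠ 0 := fun i h => by
    have := hs i
    rw [h, zero_pow hrb] at this
    exact hgen i this.symm
  have hds : ∀ i j, d i (s j ^ r) = 0 ↔ i ≠ j := fun i j => by
    rw [derivation_eq_zero_of_pow _ (hs0 j) hr, ← derivation_eq_zero_of_pow _ (hs0 j) hrb, hs, hd]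
    by_cases h : j = i
    · simp [h]
    · simp [h, Ne.symm h]
  have hu' : ∀ i, u i = C ((![1, s 0, s 1] : Fin 3 → ArcField) i ^ r) * X ^ (r * b i.succ) :=
    fun i => by rw [hu, mul_pow, map_pow, ← pow_mul, mul_comm r]
  have e1 : (Fin.succ 0 : Fin 4) = 1 := rfl
  have e2 : (Fin.succ 1 : Fin 4) = 2 := rfl
  have e3 : (Fin.succ 2 : Fin 4) = 3 := rfl
  have h01 : d 0 (s 1 ^ r) = 0 := (hds 0 1).2 (by decide)
  have h10 : d 1 (s 0 ^ r) = 0 := (hds 1 0).2 (by decide)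
  rw [Matrix.det_fin_three]
  simp only [Matrix.of_apply, Matrix.cons_val_zero, Matrix.cons_val_one, Matrix.cons_val, hu',
    eulerDerivation_C_mul_X_pow, coeffDerivation_C_mul_X_pow, one_pow, Derivation.map_one_eq_zero,
    h01, h10, e1, e2, e3, map_zero, zero_mul, mul_zero, sub_zero, add_zero]
  rw [order_mul, order_mul, order_C_mul_X_pow, order_C_mul_X_pow, order_C_mul_X_pow]
  · push_cast
    ring
  · exact fun h => (hds 1 1).1 h rfl
  · exact fun h => (hds 0 0).1 h rfl
  · rw [mul_one]
    exact_mod_cast hrb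

/-- Compute with uᵢ = xᵢ^r for i = 1, 2, 3 and B = b₁ + b₂ + b₃. Along the arc du₁ ∧ du₂ ∧ du₃ gives
rB ≥ q(k + 1), and the Jacobian has order b₀ + (r − 1)B, so q times the log discrepancy is at most B
− b₀. Equality is not needed, since the mld bounds the log discrepancy from below and q ≥ r. -/
theorem key_inequality {ε : ℝ} (hε : 0 < ε) {r : ℕ} {a : Fin 4 → ℕ} {e : ℕ} {f g : ConvSeries}
    (hX : IsHyperquotientSingularity ε r a e f) (hfg : f = coord 0 ^ 2 + g)
    (hg0 : ∀ n, MvPowerSeries.coeff n g.1 ≠ 0 → n 0 = 0)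
    (hg3 : ∀ n, MvPowerSeries.coeff n g.1 ≠ 0 → 3 ≤ n.degree)
    (hge : ∀ n, MvPowerSeries.coeff n g.1 ≠ 0 → wt a n ≡ e [MOD r])
    {j : ℕ} {b : Fin 4 → ℕ} (hb : ∀ i, 0 < b i) (hab : ∀ i, b i ≡ j * a i [MOD r])
    (hex : ∃ n, MvPowerSeries.coeff n g.1 ≠ 0 ∧ wt b n = 2 * b 0)
    (hmin : ∀ n, MvPowerSeries.coeff n g.1 ≠ 0 → 2 * b 0 ≤ wt b n) :
    (5 / 6 + ε) * r ≤ (b 1 + b 2 + b 3 : ℝ) - b 0 := by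
  have hr : r ≠ 0 := (Nat.zero_lt_of_lt (hX.a_lt 0)).ne'
  obtain ⟨s, φ, hs, hφf, hφ0, hφi, hφc, hφinj, hφη⟩ := exists_arc hr hb hab hg0 hge hex hmin
  rw [← hfg] at hφf
  have hdom := isDomain_localRingX hX
  have hker : ∀ h ∈ Ideal.span {f}, φ h = 0 := by
    intro h hh
    obtain ⟨k, rfl⟩ := Ideal.mem_span_singleton.1 hh
    rw [map_mul, hφf, zero_mul]
  let φX : LocalRingX r a f →ₐ[ℂ] ArcField⟦X⟧ :=
    (Ideal.Quotient.liftₐ (Ideal.span {f}) φ hker).comp (LocalRingX r a f).val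
  have hφX : ∀ (x : LocalRingX r a f) (h : ConvSeries), toY f h = (x : LocalRingY f) →
      φX x = φ h := by
    intro x h hx
    change Ideal.Quotient.liftₐ (Ideal.span {f}) φ hker (x : LocalRingY f) = φ h
    rw [← hx]
    rfl
  have hinj : Function.Injective φX := by
    refine (injective_iff_map_eq_zero φX).2 fun x hx => ?_
    obtain ⟨h, hh, hhx⟩ := mem_localRingX_iff.1 x.2
    rw [hφX x h hhx] at hx
    apply Subtype.ext
    rw [← hhx]
    exact injective_of_arc hfg hg0 hg3 φ hφf hφinj hh hx
  have hmem : ∀ i, toY f (coord i ^ r) ∈ LocalRingX r a f := fun i =>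
    mem_localRingX_iff.2 ⟨_, by rw [mu_coord_pow hr], rfl⟩
  let y : Fin 4 → LocalRingX r a f := fun i => ⟨_, hmem i⟩
  have hφy : ∀ i, φX (y i) = φ (coord i) ^ r := fun i => by
    rw [hφX (y i) (coord i ^ r) rfl, map_pow]
  have hrb : r * b 1 ≠ 0 := mul_ne_zero hr (hb 1).ne'
  have hφ1 : φX (y 1) = X ^ (r * b 1) := by
    rw [hφy, hφi 1 (by decide), mul_comm r, pow_mul]
    simp
  choose d hd using exists_derivation_arcField
  let δ : Fin 3 → Derivation ℂ ArcField⟦X⟧ ArcField⟦X⟧ :=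
    ![eulerDerivation ArcField, coeffDerivation (d 0), coeffDerivation (d 1)]
  obtain ⟨V, _, _, _, _, _, _, hV, q, hq, hrq, hord, hdet⟩ := exists_primeDivisor trdeg_arcField
    algebraicIndependent_arcGen arcField_exists_separable_relation φX hinj
    (fun x hx => by
      obtain ⟨h, hh, hhx⟩ := mem_localRingX_iff.1 x.2
      rw [hφX x h hhx, hφc, Ne, _root_.map_eq_zero] at hx
      exact isUnit_localRingX hh (ConvSeries.isUnit_of_constantCoeff_ne_zero hx) x hhx.symm)
    (fun i => by
      -- On the arc the powers of X in this quotient cancel, leaving `s i` to the power r b₁, which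
      -- is `arcGen i`.
      refine ⟨y i.succ.succ ^ b 1, y 1 ^ b i.succ.succ, ?_, ?_⟩
      · intro h0
        have h1 := congrArg φX h0
        rw [map_pow, hφ1, map_zero, ← pow_mul] at h1
        exact pow_ne_zero _ X_ne_zero h1
      · rw [map_pow, map_pow, hφ1, hφy, hφi _ (Fin.succ_ne_zero _), ← hs i, ← pow_mul, ← pow_mul,
          mul_pow, ← map_pow, ← pow_mul, mul_comm]
        congr 1
        · ring
        · fin_cases i <;> rfl)
    ⟨y 1, fun h0 => by
      have h1 := congrArg φX h0
      rw [hφ1, map_zero] at h1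
      exact pow_ne_zero _ X_ne_zero h1, by
      rw [hφ1, map_pow, constantCoeff_X, zero_pow hrb]⟩
    (r := r) (fun x hx => by
      obtain ⟨h, hh, hhx⟩ := mem_localRingX_iff.1 x.2
      -- An invariant function takes the same value on the arc before and after μʲ, that is, after
      -- rescaling X by ξ_r. Hence only exponents divisible by r occur.
      have h1 : φX x = φ (mu r (fun i => j * a i) h) :=
        hφX x _ ((toY_mu_mul hX.semiInvariant hh j).trans hhx)
      have h2 := hφη h
      rw [← h1, ← hφX x h hhx] at h2
      exact dvd_order_of_rescale_eq ((isPrimitiveRoot_xi hr).map_of_injective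
        (algebraMap ℂ ArcField).injective) h2 ((map_ne_zero_iff φX hinj).2 hx))
    δ (fun i n x hx => by
      fin_cases i
      · exact X_pow_dvd_eulerDerivation hx
      · exact X_pow_dvd_coeffDerivation _ hx
      · exact X_pow_dvd_coeffDerivation _ hx)
  set Bs := b 1 + b 2 + b 3 with hBs
  have hdeto := det_arc hr hb hs hd (u := fun i => φX (y i.succ)) (fun i => by
    rw [hφy, hφi _ (Fin.succ_ne_zero _)]
    fin_cases i <;> rfl)
  obtain ⟨k, hk, hkq⟩ := hdet (fun i => y i.succ) (by
    intro h0
    change Matrix.det (Matrix.of fun i j => δ j ((fun i => φX (y i.succ)) i)) = 0 at h0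
    rw [h0, order_zero] at hdeto
    exact ENat.natCast_ne_top _ hdeto.symm)
  have hkq' : q * (k + 1) ≤ r * Bs := by
    have := hkq.trans hdeto.le
    exact_mod_cast this
  have hjac := jacobian_coord_pow hg0 r
  rw [← hfg] at hjac
  have hJmem : toY f (jacobian f fun i => coord i.succ ^ r) ^ r ∈ LocalRingX r a f := by
    rw [← map_pow]
    refine mem_localRingX_iff.2 ⟨_, ?_, rfl⟩
    congr 1
    -- The r-th power of the Jacobian is a constant times a product of the invariant functions xᵢ^r.
    have h1 : (jacobian f fun i => coord i.succ ^ r) ^ r = (2 * (r : ConvSeries) ^ 3) ^ r *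
        (coord 0 ^ r * (coord 1 ^ r * coord 2 ^ r * coord 3 ^ r) ^ (r - 1)) := by
      rw [hjac]
      ring
    rw [h1]
    simp only [map_mul, map_pow (mu r a) (_ * _), map_pow (mu r a) (r : ConvSeries), map_natCast,
      map_ofNat, mu_coord_pow hr]
  let J : LocalRingX r a f := ⟨_, hJmem⟩
  have hφJ : (φX J).order = (r * (b 0 + (r - 1) * Bs) : ℕ) := by
    have hco : ∀ i : Fin 4, (φ (coord i)).order = b i := by
      intro i
      by_cases hi : i = 0
      · rw [hi, hφ0]
      · rw [hφi i hi, order_C_mul_X_pow]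
        have hgen : ∀ i, s i ≠ 0 := fun i h => by
          have h1 := hs i
          rw [h, zero_pow hrb] at h1
          rw [eq_comm, arcGen, map_eq_zero_iff _ algebraMap_arcField_injective] at h1
          exact MvPolynomial.X_ne_zero i h1
        fin_cases i
        · exact absurd rfl hi
        · exact one_ne_zero
        · exact hgen 0
        · exact hgen 1
    have hnat : ∀ m : ℕ, m ≠ 0 → (m : ArcField⟦X⟧).order = 0 := fun m hm => by
      refine order_zero_of_unit (isUnit_iff_constantCoeff.2 ?_)
      rw [map_natCast]
      exact (Nat.cast_ne_zero.2 hm).isUnit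
    rw [hφX J _ (map_pow _ _ _), hjac, map_pow, order_pow, map_mul, map_mul, map_mul, map_pow,
      map_pow, map_mul, map_mul, map_natCast, map_ofNat, order_mul, order_mul, order_mul,
      order_pow, order_pow, order_mul, order_mul, hco, hco, hco, hco, hnat r hr]
    have h2 := hnat 2 two_ne_zero
    rw [Nat.cast_ofNat] at h2
    rw [h2, hBs]
    simp only [nsmul_eq_mul]
    push_cast
    ring
  have hJ0 : J ≠ 0 := by
    intro h0
    rw [h0, map_zero, order_zero] at hφJ
    exact ENat.natCast_ne_top _ hφJ.symm
  obtain ⟨m, hm, hmq⟩ := hord J hJ0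
  have hmq' : q * m = r * (b 0 + (r - 1) * Bs) := by
    rw [hφJ] at hmq
    exact_mod_cast hmq.symm
  have hc : (1 + (k : ℝ) - (m : ℝ) / r) ∈ logDiscrepancies r a f :=
    ⟨V, _, _, _, _, _, _, hV, fun i => y i.succ, fun i => coord i.succ ^ r, J, k, m,
      fun i => rfl, rfl, hJ0, hk, hm, rfl⟩
  have hle : (5 / 6 + ε : ℝ) ≤ 1 + (k : ℝ) - (m : ℝ) / r := by
    have h1 := hX.le_mld.trans (sInf_le (Set.mem_image_of_mem _ hc))
    exact_mod_cast h1
  have hrpos : (0 : ℝ) < r := by exact_mod_cast Nat.pos_of_ne_zero hr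
  have hrq' : (r : ℝ) ≤ q := by exact_mod_cast Nat.le_of_dvd hq hrq
  -- Here q(k + 1) ≤ rB and qm/r = b₀ + (r − 1)B, where B is `Bs`.
  have h1 : (q : ℝ) * (1 + k - m / r) ≤ Bs - b 0 := by
    have h2 : (q : ℝ) * (k + 1) ≤ r * Bs := by exact_mod_cast hkq'
    have h3 : (q : ℝ) * m = r * (b 0 + (r - 1) * Bs) := by
      have h4 : ((q * m : ℕ) : ℝ) = ((r * (b 0 + (r - 1) * Bs) : ℕ) : ℝ) := congrArg _ hmq'
      rw [Nat.cast_mul, Nat.cast_mul, Nat.cast_add, Nat.cast_mul,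
        Nat.cast_sub (Nat.pos_of_ne_zero hr), Nat.cast_one] at h4
      exact h4
    have h5 : (q : ℝ) * (m / r) = b 0 + (r - 1) * Bs := by
      rw [← mul_div_assoc, h3, mul_div_cancel_left₀ _ hrpos.ne']
    rw [mul_sub, h5]
    linarith
  have h2 : (5 / 6 + ε) * r ≤ q * (1 + k - m / r) := by
    rw [mul_comm]
    exact mul_le_mul hrq' hle (by linarith) (by positivity)
  refine h2.trans (h1.trans (le_of_eq ?_))
  rw [hBs]
  push_cast
  ring

end KeyInequality

end Hyperquotient

namespace Hyperquotient

section Freeness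

open PowerSeries

/-! ### Consequences of freeness of the action -/

theorem evalArc_eq_zero {L : Type*} [Field L] [Algebra ℂ L] {A : Fin 4 → L⟦X⟧}
    (hA : ∀ i, constantCoeff (A i) = 0) {h : ConvSeries}
    (hh : ∀ n, MvPowerSeries.coeff n h.1 ≠ 0 → ∃ i, n i ≠ 0 ∧ A i = 0) : evalArc A hA h = 0 := by
  ext N
  rw [coeff_evalArc, map_zero, finsum_eq_zero_of_forall_eq_zero]
  intro n
  by_cases hn : MvPowerSeries.coeff n h.1 = 0
  · rw [hn, zero_smul]
  · obtain ⟨i, hi, hAi⟩ := hh n hn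
    rw [Finset.prod_eq_zero (Finset.mem_univ i) (by rw [hAi, zero_pow hi]), map_zero, smul_zero]

theorem map_eq_zero_of_mem_radical {A : Type*} [CommRing A] [IsDomain A] [Algebra ℂ A]
    (φ : ConvSeries →ₐ[ℂ] A) {S : Set ConvSeries} (hS : ∀ h ∈ S, φ h = 0) {h : ConvSeries}
    (hh : h ∈ (Ideal.span S).radical) : φ h = 0 := by
  obtain ⟨m, hm⟩ := hh
  have h1 : Ideal.span S ≤ RingHom.ker φ := Ideal.span_le.2 fun h hh => hS h hh
  have h2 : φ (h ^ m) = 0 := h1 hm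
  rw [map_pow] at h2
  exact eq_zero_of_pow_eq_zero h2

/-- The form in which freeness is used: an arc on Y that is fixed pointwise by a nontrivial power of
μ is constant at the origin. -/
theorem ActsFreelyOutsideOrigin.map_coord_eq_zero {r : ℕ} {a : Fin 4 → ℕ} {f : ConvSeries}
    (hfree : ActsFreelyOutsideOrigin r a f) {j : ℕ} (hj : ¬ r ∣ j) {A : Type*} [CommRing A]
    [IsDomain A] [Algebra ℂ A] (φ : ConvSeries →ₐ[ℂ] A) (hf : φ f = 0)
    (hφ : ∀ l, ¬ r ∣ j * a l → φ (coord l) = 0) (i : Fin 4) : φ (coord i) = 0 := by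
  refine map_eq_zero_of_mem_radical φ ?_ (hfree j hj i)
  rintro h (rfl | ⟨l, hl, rfl⟩)
  · exact hf
  · exact hφ l hl

theorem not_dvd_div_gcd {r c : ℕ} (hr : r ≠ 0) (hc : c ∣ r) (hc1 : c ≠ 1) : ¬ r ∣ r / c := by
  obtain ⟨m, rfl⟩ := hc
  have hc0 : 0 < c := Nat.pos_of_ne_zero (left_ne_zero_of_mul hr)
  have hm0 : 0 < m := Nat.pos_of_ne_zero (right_ne_zero_of_mul hr)
  rw [Nat.mul_div_cancel_left _ hc0]
  intro h
  have := Nat.le_of_dvd hm0 h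
  have : 2 ≤ c := by omega
  nlinarith

theorem dvd_div_mul {r c x : ℕ} (hc : c ∣ r) (hx : c ∣ x) : r ∣ r / c * x := by
  obtain ⟨y, rfl⟩ := hx
  rw [← mul_assoc, Nat.div_mul_cancel hc]
  exact dvd_mul_right _ _

theorem coord_sq_coeff (i : Fin 4) (n : Fin 4 →₀ ℕ) :
    MvPowerSeries.coeff n (coord i ^ 2).1 = if n = Finsupp.single i 2 then 1 else 0 := by
  classical
  exact MvPowerSeries.coeff_X_pow n i 2

/-- Two coordinates `x₁, x₂` with `f = x₁² + x₂² + …` have weights generating the unit ideal. -/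
theorem eq_one_of_dvd_of_isOddType {r : ℕ} {a : Fin 4 → ℕ} {f : ConvSeries} (hr : r ≠ 0)
    (hfree : ActsFreelyOutsideOrigin r a f) (hodd : IsOddType r a f) {c : ℕ} (hc : c ∣ r)
    (hc0 : c ∣ a 0) (hc1 : c ∣ a 1) : c = 1 := by
  by_contra hne
  obtain ⟨-, g, hfg, hg⟩ := hodd
  -- A line on Y, since g involves only x₂ and x₃ and has no constant term. It is fixed by the power
  -- r/c of μ.
  let A : Fin 4 → ℂ⟦X⟧ := ![X, C Complex.I * X, 0, 0]
  have hA : ∀ i, constantCoeff (A i) = 0 := by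
    intro i
    fin_cases i <;> simp [A]
  have hg0 : evalArc A hA g = 0 := by
    refine evalArc_eq_zero hA fun n hn => ?_
    obtain ⟨h0, h1, h3⟩ := hg n hn
    rw [Finsupp.degree_eq_sum, Fin.sum_univ_four, h0, h1] at h3
    by_cases h2 : n 2 = 0
    · exact ⟨3, by omega, rfl⟩
    · exact ⟨2, h2, rfl⟩
  have hf0 : evalArc A hA f = 0 := by
    rw [hfg, map_add, map_add, map_pow, map_pow, evalArc_coord, evalArc_coord, hg0, add_zero]
    change X ^ 2 + (C Complex.I * X) ^ 2 = 0
    rw [mul_pow, ← map_pow, Complex.I_sq, map_neg, map_one]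
    ring
  have h1 := hfree.map_coord_eq_zero (not_dvd_div_gcd hr hc hne) (evalArc A hA) hf0 (fun l hl => by
    rw [evalArc_coord]
    fin_cases l
    · exact absurd (dvd_div_mul hc hc0) hl
    · exact absurd (dvd_div_mul hc hc1) hl
    · rfl
    · rfl) 0
  rw [evalArc_coord] at h1
  exact X_ne_zero h1

/-- Let p = gcd(aᵢ, r) and take the curve in Y with only x₀ and xᵢ nonzero. If g vanishes on the
xᵢ-axis, this is the axis itself, which is fixed by the power r/p of μ. Otherwise some xᵢⁿ occurs in
g, so p ∣ naᵢ forces p ∣ e; by `hgcd` then p ∣ a₀, and x₀ is fixed as well. -/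
theorem coprime_of_isCDEType {r : ℕ} {a : Fin 4 → ℕ} {e : ℕ} {f g : ConvSeries} (hr : r ≠ 0)
    (hfree : ActsFreelyOutsideOrigin r a f) (hfg : f = coord 0 ^ 2 + g)
    (hg0 : ∀ n, MvPowerSeries.coeff n g.1 ≠ 0 → n 0 = 0)
    (hg3 : ∀ n, MvPowerSeries.coeff n g.1 ≠ 0 → 3 ≤ n.degree)
    (hge : ∀ n, MvPowerSeries.coeff n g.1 ≠ 0 → wt a n ≡ e [MOD r])
    (hgcd : Nat.gcd (a 0) r = Nat.gcd e r) {i : Fin 4} (hi : i ≠ 0) : Nat.Coprime (a i) r := by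
  by_contra hne
  set p := Nat.gcd (a i) r with hp
  have hpr : p ∣ r := Nat.gcd_dvd_right _ _
  -- The square makes the order of g along the curve even, so that x₀ = √(−g) is a power series.
  let B : Fin 4 → ℂ⟦X⟧ := fun l => if l = i then X ^ 2 else 0
  have hB : ∀ l, constantCoeff (B l) = 0 := by
    intro l
    by_cases hl : l = i <;> simp [B, hl]
  set γ := evalArc B hB g with hγ
  have hcoeff : ∀ N, coeff N γ ≠ 0 → ∃ n, MvPowerSeries.coeff n g.1 ≠ 0 ∧
      (∀ l, l ≠ i → n l = 0) ∧ N = 2 * n i := by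
    intro N hN
    rw [hγ, coeff_evalArc] at hN
    obtain ⟨n, hn⟩ := not_forall.1 fun h => hN (finsum_eq_zero_of_forall_eq_zero h)
    have hn1 := left_ne_zero_of_smul hn
    have hn2 := right_ne_zero_of_smul hn
    have hn3 : ∀ l, l ≠ i → n l = 0 := by
      intro l hl
      by_contra hnl
      rw [Finset.prod_eq_zero (Finset.mem_univ l) (by simp [B, hl, zero_pow hnl]), map_zero] at hn2
      exact hn2 rfl
    refine ⟨n, hn1, hn3, ?_⟩
    rw [Finset.prod_eq_single i (fun l _ hl => by rw [hn3 l hl, pow_zero]) (by simp)] at hn2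
    simp only [B, if_true, ← pow_mul, coeff_X_pow] at hn2
    by_contra hcon
    rw [if_neg hcon] at hn2
    exact hn2 rfl
  obtain ⟨A₀, hA₀, hA₀c, hA₀r⟩ : ∃ A₀ : ℂ⟦X⟧, A₀ ^ 2 = -γ ∧ constantCoeff A₀ = 0 ∧
      (¬ r ∣ r / p * a 0 → A₀ = 0) := by
    by_cases hγ0 : γ = 0
    · exact ⟨0, by simp [hγ0], map_zero _, fun _ => rfl⟩
    · obtain ⟨n, hn, hn0, hN⟩ := hcoeff _ (coeff_order hγ0)
      obtain ⟨u, hu, -⟩ := exists_sq_eq_of_order (p := -γ) (m := n i)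
        (by rw [order_neg, ← hN, coe_toNat_order hγ0])
      refine ⟨X ^ n i * u, hu, ?_, fun hcon => absurd (dvd_div_mul hpr ?_) hcon⟩
      · have h3 := hg3 n hn
        rw [Finsupp.degree_eq_sum, Finset.sum_eq_single i (fun l _ hl => hn0 l hl) (by simp)] at h3
        rw [map_mul, map_pow, constantCoeff_X, zero_pow (by omega), zero_mul]
      · have h4 : p ∣ e := by
          refine ((hge n hn).dvd_iff hpr).1 ?_
          rw [wt, Finset.sum_eq_single i (fun l _ hl => by rw [hn0 l hl, mul_zero]) (by simp)]
          exact (Nat.gcd_dvd_left _ _).mul_right _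
        have h5 : p ∣ Nat.gcd (a 0) r := by
          rw [hgcd]
          exact Nat.dvd_gcd h4 hpr
        exact h5.trans (Nat.gcd_dvd_left _ _)
  let A : Fin 4 → ℂ⟦X⟧ := fun l => if l = 0 then A₀ else B l
  have hA : ∀ l, constantCoeff (A l) = 0 := by
    intro l
    by_cases hl : l = 0
    · simp [A, hl, hA₀c]
    · simp [A, hl, hB]
  have hAg : evalArc A hA g = γ := evalArc_eq_of_congr hA hB g fun n hn l hl => by
    have : l ≠ 0 := by
      rintro rfl
      exact hl (hg0 n hn)
    exact if_neg this
  have hf0 : evalArc A hA f = 0 := by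
    rw [hfg, map_add, map_pow, evalArc_coord, hAg]
    change A₀ ^ 2 + γ = 0
    rw [hA₀, neg_add_cancel]
  have h1 := hfree.map_coord_eq_zero (not_dvd_div_gcd hr hpr hne) (evalArc A hA) hf0
    (fun l hl => by
      rw [evalArc_coord]
      by_cases hl0 : l = 0
      · subst hl0
        exact hA₀r hl
      · by_cases hli : l = i
        · subst hli
          exact absurd (dvd_div_mul hpr (Nat.gcd_dvd_left _ _)) hl
        · simp [A, B, hl0, hli]) i
  rw [evalArc_coord] at h1
  simp [A, B, hi] at h1

/-- Otherwise f = x₀² is singular along all of x₀ = 0, in particular along the x₁-axis. -/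
theorem exists_coeff_ne_zero {f g : ConvSeries} (hiso : HasIsolatedSingularity f)
    (hfg : f = coord 0 ^ 2 + g) : ∃ n, MvPowerSeries.coeff n g.1 ≠ 0 := by
  by_contra! hcon
  have hg : g = 0 := ConvSeries.ext_coeff hcon
  rw [hg, add_zero] at hfg
  let A : Fin 4 → ℂ⟦X⟧ := ![0, X, 0, 0]
  have hA : ∀ i, constantCoeff (A i) = 0 := by
    intro i
    fin_cases i <;> simp [A]
  have hA0 : evalArc A hA (coord 0) = 0 := evalArc_coord hA 0
  have h1 := map_eq_zero_of_mem_radical (evalArc A hA) (fun h hh => by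
    rcases hh with rfl | ⟨l, rfl⟩
    · rw [hfg, map_pow, hA0, zero_pow two_ne_zero]
    · rw [hfg]
      change evalArc A hA (partialDeriv l (coord 0 ^ 2)) = 0
      rw [partialDeriv_coord_pow]
      split_ifs
      · simp [hA0]
      · exact map_zero _) (hiso 1)
  rw [evalArc_coord] at h1
  exact X_ne_zero h1

end Freeness

end Hyperquotient

namespace Hyperquotient

section Arithmetic

/-! ### Residues of multiples of the weights -/

/-- Write a residue mod Rd as a low digit mod R plus R times a high digit mod d. As s varies, the
high digits run through 0, …, d − 1 once each, because x is invertible mod d; the low digits are at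
most R − 1. -/
theorem sum_mod_le {R d x k : ℕ} (hR : 0 < R) (hd : 0 < d) (hx : Nat.Coprime x d) :
    2 * ∑ s ∈ Finset.range d, (k + R * s) * x % (R * d) ≤
      2 * (d * (R - 1)) + R * (d * (d - 1)) := by
  have h1 : ∀ s, (k + R * s) * x % (R * d) =
      (k + R * s) * x % R + R * ((k * x / R + s * x) % d) := by
    intro s
    rw [Nat.mod_mul, show (k + R * s) * x = k * x + R * (s * x) by ring,
      Nat.add_mul_div_left _ _ hR]
  have h2 : ∑ s ∈ Finset.range d, (k * x / R + s * x) % d = ∑ s ∈ Finset.range d, s := by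
    have hmaps : Set.MapsTo (fun s => (k * x / R + s * x) % d) (Finset.range d)
        (Finset.range d) := fun s _ => by
      simpa using Nat.mod_lt _ hd
    have hinj : Set.InjOn (fun s => (k * x / R + s * x) % d) (Finset.range d) := by
      intro s hs t ht hst
      have h3 : k * x / R + s * x ≡ k * x / R + t * x [MOD d] := hst
      have h4 : s ≡ t [MOD d] :=
        Nat.ModEq.cancel_right_of_coprime hx.symm (Nat.ModEq.add_left_cancel' _ h3)
      exact h4.eq_of_lt_of_lt (by simpa using hs) (by simpa using ht)
    exact Finset.sum_nbij _ hmaps hinj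
      (Finset.surjOn_of_injOn_of_card_le _ hmaps hinj le_rfl) fun _ _ => rfl
  simp_rw [h1, Finset.sum_add_distrib, ← Finset.mul_sum]
  rw [h2, mul_add]
  have h3 : ∑ s ∈ Finset.range d, (k + R * s) * x % R ≤ d * (R - 1) := by
    calc ∑ s ∈ Finset.range d, (k + R * s) * x % R ≤ ∑ _s ∈ Finset.range d, (R - 1) :=
          Finset.sum_le_sum fun s _ => Nat.le_sub_one_of_lt (Nat.mod_lt _ hR)
      _ = d * (R - 1) := by simp
  have h4 := Finset.sum_range_id_mul_two d
  calc _ ≤ 2 * (d * (R - 1)) + R * ((∑ i ∈ Finset.range d, i) * 2) := by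
        rw [mul_comm _ 2, mul_left_comm R 2]
        omega
    _ = _ := by rw [h4]

/-- With d = gcd(e, r), r = Rd and a₀ = da′, the residue of ka₀ depends only on k mod R. If R ≠ 1, a
class is chosen in which this residue is just below r/2. The identity `hres` makes b₁ + b₂ + b₃
large for every member, whereas the average of each bᵢ over the class is bounded by `sum_mod_le`. -/
theorem eq_gcd_of_residues {r e : ℕ} {a : Fin 4 → ℕ} (hr : 0 < r)
    (htwo : 2 * a 0 ≡ e [MOD r]) (hgcd : Nat.gcd (a 0) r = Nat.gcd e r)
    (hseven : 7 ≤ Nat.gcd (a 0) r) (hcop : ∀ i, i ≠ 0 → Nat.Coprime (a i) r)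
    (hres : ∀ k, 0 < k → k < r → ¬ r ∣ k * e → 2 * (k * a 0 % r) < r →
      k * a 1 % r + k * a 2 % r + k * a 3 % r = k * a 0 % r + r + k) :
    r = Nat.gcd e r := by
  obtain ⟨d, hd⟩ : ∃ d, d = Nat.gcd e r := ⟨_, rfl⟩
  have hd7 : 7 ≤ d := by rw [hd, ← hgcd]; exact hseven
  have hd0 : 0 < d := by omega
  obtain ⟨a', ha'⟩ : d ∣ a 0 := by rw [hd, ← hgcd]; exact Nat.gcd_dvd_left _ _
  obtain ⟨e', he'⟩ : d ∣ e := by rw [hd]; exact Nat.gcd_dvd_left _ _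
  obtain ⟨R, hR⟩ : d ∣ r := by rw [hd]; exact Nat.gcd_dvd_right _ _
  have hR0 : 0 < R := by
    rcases Nat.eq_zero_or_pos R with rfl | h
    · omega
    · exact h
  have hea : Nat.Coprime e' R := by
    have h1 : d * Nat.gcd e' R = d * 1 := by rw [← Nat.gcd_mul_left, ← he', ← hR, ← hd, mul_one]
    exact Nat.eq_of_mul_eq_mul_left hd0 h1
  have haa : Nat.Coprime a' R := by
    have h1 : d * Nat.gcd a' R = d * 1 := by
      rw [← Nat.gcd_mul_left, ← ha', ← hR, hgcd, ← hd, mul_one]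
    exact Nat.eq_of_mul_eq_mul_left hd0 h1
  rw [← hd]
  by_contra hne
  have hR1 : R ≠ 1 := by
    rintro rfl
    exact hne (by rw [hR, mul_one])
  have h2 : 2 * a' ≡ e' [MOD R] := by
    refine Nat.ModEq.mul_left_cancel' hd0.ne' ?_
    rw [← hR, ← he', mul_left_comm, ← ha']
    exact htwo
  -- If R were even, 2a′ ≡ e′ mod R would make e′ even, although it is prime to R.
  obtain ⟨q, hq⟩ : Odd R := by
    rw [← Nat.not_even_iff_odd]
    intro hev
    have h3 : 2 ∣ e' := (h2.dvd_iff hev.two_dvd).1 (dvd_mul_right _ _)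
    have h4 := Nat.dvd_gcd h3 hev.two_dvd
    rw [hea] at h4
    omega
  have hq0 : 0 < q := by omega
  -- With R = 2q + 1, the class of k solves ka′ ≡ q mod R, so that ka₀ has residue dq, the largest
  -- multiple of d below r/2.
  obtain ⟨m, -, hm⟩ := Nat.exists_mul_mod_eq_of_coprime q haa hR0.ne'
  obtain ⟨k, hk⟩ : ∃ k, k = m % R := ⟨_, rfl⟩
  have hkR : k < R := hk ▸ Nat.mod_lt _ hR0
  have hka : k * a' % R = q := by
    rw [hk, Nat.mod_mul_mod, mul_comm, hm, Nat.mod_eq_of_lt (by omega)]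
  have hk0 : 0 < k := by
    rcases Nat.eq_zero_or_pos k with h | h
    · rw [h, zero_mul, Nat.zero_mod] at hka
      omega
    · exact h
  have hs : ∀ s ∈ Finset.range d, (k + R * s) * a 1 % (R * d) + (k + R * s) * a 2 % (R * d) +
      (k + R * s) * a 3 % (R * d) = d * q + R * d + k + R * s := by
    intro s hs
    have hsd : s < d := by simpa using hs
    have hlt : k + R * s < R * d := by
      calc k + R * s < R * (s + 1) := by rw [mul_add]; omega
        _ ≤ R * d := Nat.mul_le_mul_left _ hsd
    have h3 : (k + R * s) * a 0 % r = d * q := by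
      rw [ha', hR, mul_left_comm, Nat.mul_mod_mul_left,
        show (k + R * s) * a' = k * a' + R * (s * a') by ring, Nat.add_mul_mod_self_left, hka]
    have h4 : ¬ r ∣ (k + R * s) * e := by
      rw [hR, he', mul_left_comm, Nat.mul_dvd_mul_iff_left hd0]
      intro h
      have h5 : R ∣ k + R * s := hea.symm.dvd_of_dvd_mul_right h
      have h6 : R ∣ k := (Nat.dvd_add_left (dvd_mul_right _ _)).1 h5
      exact absurd (Nat.le_of_dvd hk0 h6) (by omega)
    have h5 := hres (k + R * s) (by omega) (by rw [hR, mul_comm d]; exact hlt) h4 (by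
      rw [h3, hR, hq]
      nlinarith)
    rw [h3, hR, mul_comm d R] at h5
    rw [h5]
    ring
  have hsum := Finset.sum_congr rfl hs
  simp only [Finset.sum_add_distrib, ← Finset.mul_sum, Finset.sum_const, Finset.card_range,
    smul_eq_mul] at hsum
  rw [← Finset.mul_sum] at hsum
  have hcd : ∀ i, i ≠ 0 → Nat.Coprime (a i) d := fun i hi =>
    (hcop i hi).coprime_dvd_right ⟨R, hR⟩
  have b1 := sum_mod_le (k := k) hR0 hd0 (hcd 1 (by decide))
  have b2 := sum_mod_le (k := k) hR0 hd0 (hcd 2 (by decide))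
  have b3 := sum_mod_le (k := k) hR0 hd0 (hcd 3 (by decide))
  have h4 := Finset.sum_range_id_mul_two d
  obtain ⟨D, rfl⟩ : ∃ D, d = D + 1 := ⟨d - 1, by omega⟩
  obtain rfl : R = 2 * q + 1 := hq
  simp only [Nat.add_sub_cancel] at *
  have h5 : 2 * ((D + 1) * ((D + 1) * q) + (D + 1) * ((2 * q + 1) * (D + 1)) + (D + 1) * k) +
      (2 * q + 1) * ((D + 1) * D) ≤
      3 * (2 * ((D + 1) * (2 * q)) + (2 * q + 1) * ((D + 1) * D)) := by
    have h6 : (2 * q + 1) * ((D + 1) * D) =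
        2 * ((2 * q + 1) * ∑ s ∈ Finset.range (D + 1), s) := by
      rw [← h4]
      ring
    linarith
  have h6 : 2 * ((D + 1) * q + (2 * q + 1) * (D + 1) + k) + (2 * q + 1) * D ≤
      3 * (2 * (2 * q) + (2 * q + 1) * D) := by
    refine le_of_mul_le_mul_left (a := D + 1) ?_ (by omega)
    linarith
  -- After cancellation `h6` reads dq + R + k ≤ 6q with d = D + 1 and R = 2q + 1, which is
  -- impossible for d ≥ 7.
  nlinarith

end Arithmetic

end Hyperquotient

namespace Hyperquotient

section WeightInequality

/-! ### Weights of the defining equation -/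

theorem coeff_eq_of_apply_zero {f g : ConvSeries} (hfg : f = coord 0 ^ 2 + g) {n : Fin 4 →₀ ℕ}
    (hn : n 0 = 0) : MvPowerSeries.coeff n f.1 = MvPowerSeries.coeff n g.1 := by
  have h1 : MvPowerSeries.coeff n f.1 =
      MvPowerSeries.coeff n (coord 0 ^ 2).1 + MvPowerSeries.coeff n g.1 := by
    rw [hfg]
    exact map_add _ _ _
  rw [h1, coord_sq_coeff, if_neg, zero_add]
  rintro rfl
  simp at hn

theorem coeff_single_zero_ne_zero {f g : ConvSeries} (hfg : f = coord 0 ^ 2 + g)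
    (hg0 : ∀ n, MvPowerSeries.coeff n g.1 ≠ 0 → n 0 = 0) :
    MvPowerSeries.coeff (Finsupp.single 0 2) f.1 ≠ 0 := by
  have h1 : MvPowerSeries.coeff (Finsupp.single 0 2) f.1 =
      MvPowerSeries.coeff (Finsupp.single 0 2) (coord 0 ^ 2).1 +
        MvPowerSeries.coeff (Finsupp.single 0 2) g.1 := by
    rw [hfg]
    exact map_add _ _ _
  have h2 : MvPowerSeries.coeff (Finsupp.single 0 2) g.1 = 0 := by
    by_contra h
    simpa using hg0 _ h
  rw [h1, h2, add_zero, coord_sq_coeff, if_pos rfl]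
  exact one_ne_zero

theorem wt_single (b : Fin 4 → ℕ) (i : Fin 4) (m : ℕ) : wt b (Finsupp.single i m) = b i * m := by
  rw [wt, Finset.sum_eq_single i (fun l _ hl => by
    rw [Finsupp.single_eq_of_ne hl, mul_zero]) (by simp), Finsupp.single_eq_same]

theorem wt_congr {b c : Fin 4 → ℕ} {n : Fin 4 →₀ ℕ} (hn : n 0 = 0) (h : ∀ i, i ≠ 0 → b i = c i) :
    wt b n = wt c n := by
  refine Finset.sum_congr rfl fun i _ => ?_
  by_cases hi : i = 0
  · rw [hi, hn, mul_zero, mul_zero]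
  · rw [h i hi]

theorem wt_mul_left (l : ℕ) (b : Fin 4 → ℕ) (n : Fin 4 →₀ ℕ) :
    wt (fun i => l * b i) n = l * wt b n := by
  rw [wt, wt, Finset.mul_sum]
  exact Finset.sum_congr rfl fun i _ => mul_assoc _ _ _

theorem exists_min_wt {f : ConvSeries} (b : Fin 4 → ℕ)
    (hf : ∃ n, MvPowerSeries.coeff n f.1 ≠ 0) :
    ∃ W, (∀ n, MvPowerSeries.coeff n f.1 ≠ 0 → W ≤ wt b n) ∧
      ∃ n, MvPowerSeries.coeff n f.1 ≠ 0 ∧ wt b n = W := by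
  classical
  obtain ⟨n₀, hn₀⟩ := hf
  have hex : ∃ G, ∃ n, MvPowerSeries.coeff n f.1 ≠ 0 ∧ wt b n = G := ⟨_, n₀, hn₀, rfl⟩
  exact ⟨Nat.find hex, fun n hn => Nat.find_le ⟨n, hn, rfl⟩, Nat.find_spec hex⟩

/-- Let G be the b-weight of g. Semi-invariance and 2a₀ ≡ e give G = 2b₀ + rt for an integer t. If t
is even, replacing b₀ by G/2 stays in the class ja mod r and balances the two parts of f. If t is
odd, the weight (G, 2b₁, 2b₂, 2b₃) in the class 2ja is balanced instead. -/
theorem weight_inequality {ε : ℝ} (hε : 0 < ε) (hε1 : ε < 1 / 6) {r : ℕ} {a : Fin 4 → ℕ} {e : ℕ}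
    {f g : ConvSeries} (hX : IsHyperquotientSingularity ε r a e f) (hfg : f = coord 0 ^ 2 + g)
    (hg0 : ∀ n, MvPowerSeries.coeff n g.1 ≠ 0 → n 0 = 0)
    (hg3 : ∀ n, MvPowerSeries.coeff n g.1 ≠ 0 → 3 ≤ n.degree)
    (hge : ∀ n, MvPowerSeries.coeff n g.1 ≠ 0 → wt a n ≡ e [MOD r])
    (htwo : 2 * a 0 ≡ e [MOD r]) {j : ℕ} {b : Fin 4 → ℕ} (hb : ∀ i, 0 < b i)
    (hab : ∀ i, b i ≡ j * a i [MOD r]) {W : ℕ}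
    (hW : ∀ n, MvPowerSeries.coeff n f.1 ≠ 0 → W ≤ wt b n) :
    (5 / 6 + ε) * r ≤ ∑ i, (b i : ℝ) - W := by
  have hgW : ∀ n, MvPowerSeries.coeff n g.1 ≠ 0 → W ≤ wt b n := fun n hn =>
    hW n (by rwa [coeff_eq_of_apply_zero hfg (hg0 n hn)])
  have hW0 : W ≤ 2 * b 0 := by
    have := hW _ (coeff_single_zero_ne_zero hfg hg0)
    rwa [wt_single, mul_comm] at this
  obtain ⟨G, hG, n, hn, hnG⟩ := exists_min_wt b (exists_coeff_ne_zero hX.isolated hfg)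
  have hGW : W ≤ G := hnG ▸ hgW n hn
  have hGpos : 0 < G := by
    have h3 := hg3 n hn
    obtain ⟨i, hi⟩ : ∃ i, n i ≠ 0 := by
      by_contra! h
      have : n = 0 := Finsupp.ext h
      simp [this] at h3
    rw [← hnG]
    exact lt_of_lt_of_le (Nat.mul_pos (hb i) (Nat.pos_of_ne_zero hi))
      (Finset.single_le_sum (f := fun i => b i * n i) (fun _ _ => Nat.zero_le _)
        (Finset.mem_univ i))
  have hGmod : 2 * b 0 ≡ G [MOD r] := by
    have h1 : G ≡ j * e [MOD r] := hnG ▸ (wt_modEq hab n).trans ((hge n hn).mul_left j)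
    refine Nat.ModEq.trans ?_ h1.symm
    calc 2 * b 0 ≡ 2 * (j * a 0) [MOD r] := (hab 0).mul_left 2
      _ = j * (2 * a 0) := by ring
      _ ≡ j * e [MOD r] := htwo.mul_left j
  obtain ⟨t, ht⟩ := (Nat.modEq_iff_dvd).1 hGmod
  rw [Fin.sum_univ_four]
  have hr0 : (0 : ℝ) ≤ r := Nat.cast_nonneg r
  rcases Int.even_or_odd' t with ⟨u, hu | hu⟩
  · obtain ⟨c, hc⟩ : ∃ c, G = 2 * c := by
      have h1 : (2 : ℤ) ∣ G := ⟨b 0 + r * u, by rw [hu] at ht; push_cast at ht; linarith⟩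
      exact_mod_cast h1
    have hcu : (c : ℤ) - b 0 = r * u := by
      rw [hu, hc] at ht
      push_cast at ht
      linarith
    have hc0 : b 0 ≡ c [MOD r] := Nat.modEq_iff_dvd.2 ⟨u, hcu⟩
    let b' : Fin 4 → ℕ := Function.update b 0 c
    have hb'0 : b' 0 = c := Function.update_self _ _ _
    have hb' : ∀ i, i ≠ 0 → b' i = b i := fun i hi => Function.update_of_ne hi _ _
    have hkey := key_inequality hε hX hfg hg0 hg3 hge (j := j) (b := b') (fun i => by
        by_cases hi : i = 0
        · rw [hi, hb'0]
          omega
        · rw [hb' i hi]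
          exact hb i) (fun i => by
        by_cases hi : i = 0
        · rw [hi, hb'0]
          exact hc0.symm.trans (hab 0)
        · rw [hb' i hi]
          exact hab i)
      ⟨n, hn, by rw [hb'0, wt_congr (hg0 n hn) hb', hnG, hc]⟩
      (fun m hm => by rw [hb'0, wt_congr (hg0 m hm) hb', ← hc]; exact hG m hm)
    rw [hb'0, hb' 1 (by decide), hb' 2 (by decide), hb' 3 (by decide)] at hkey
    -- W is at most both 2b₀ and G = 2c, hence at most their mean; so Σ bᵢ − W is at least b₁ + b₂ +
    -- b₃ − c.
    have h2 : W ≤ b 0 + c := by omega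
    have h3 : (W : ℝ) ≤ b 0 + c := by exact_mod_cast h2
    linarith
  · let b' : Fin 4 → ℕ := Function.update (fun i => 2 * b i) 0 G
    have hb'0 : b' 0 = G := Function.update_self _ _ _
    have hb' : ∀ i, i ≠ 0 → b' i = 2 * b i := fun i hi => Function.update_of_ne hi _ _
    have hwt : ∀ m, MvPowerSeries.coeff m g.1 ≠ 0 → wt b' m = 2 * wt b m := fun m hm => by
      rw [← wt_mul_left]
      exact wt_congr (hg0 m hm) hb'
    have hkey := key_inequality hε hX hfg hg0 hg3 hge (j := 2 * j) (b := b') (fun i => by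
        by_cases hi : i = 0
        · rw [hi, hb'0]
          exact hGpos
        · rw [hb' i hi]
          exact Nat.mul_pos two_pos (hb i)) (fun i => by
        rw [mul_assoc]
        by_cases hi : i = 0
        · rw [hi, hb'0]
          exact hGmod.symm.trans ((hab 0).mul_left 2)
        · rw [hb' i hi]
          exact (hab i).mul_left 2)
      ⟨n, hn, by rw [hb'0, hwt n hn, hnG]⟩
      (fun m hm => by rw [hb'0, hwt m hm]; exact Nat.mul_le_mul_left 2 (hG m hm))
    rw [hb'0, hb' 1 (by decide), hb' 2 (by decide), hb' 3 (by decide)] at hkey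
    push_cast at hkey
    -- As t is odd, 2b₀ and G differ by at least r, so the minimum lies r/2 below their mean. This
    -- gain compensates for halving the bound of the doubled weight, because 5/6 + ε ≤ 1.
    have h2 : 2 * W + r ≤ 2 * b 0 + G := by
      rw [hu] at ht
      push_cast at ht
      rcases le_or_gt 0 u with h | h
      · have h4 : (0 : ℤ) ≤ r * u := by positivity
        have h5 : (r : ℤ) ≤ G - 2 * b 0 := by rw [ht]; linarith
        omega
      · have h4 : (r : ℤ) * u ≤ r * (-1) := by gcongr; omega
        have h5 : (r : ℤ) ≤ 2 * b 0 - G := by linarith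
        omega
    have h3 : (2 * W + r : ℝ) ≤ 2 * b 0 + G := by exact_mod_cast h2
    nlinarith

end WeightInequality

end Hyperquotient

namespace Hyperquotient

section MinimalWeight

/-! ### The special alternative and weights of the defining equation -/

theorem weight_div {r : ℕ} {f : ConvSeries} {b : Fin 4 → ℕ} {W : ℕ}
    (hW : ∀ n, MvPowerSeries.coeff n f.1 ≠ 0 → W ≤ wt b n)
    (hWex : ∃ n, MvPowerSeries.coeff n f.1 ≠ 0 ∧ wt b n = W) :
    weight (fun i => (b i : ℚ) / r) f = (W : ℝ) / r := by
  have h1 : ∀ n : Fin 4 →₀ ℕ, ((∑ i, (b i : ℚ) / r * n i : ℚ) : ℝ) = (wt b n : ℝ) / r := by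
    intro n
    push_cast [wt]
    rw [Finset.sum_div]
    exact Finset.sum_congr rfl fun i _ => by ring
  refine IsLeast.csInf_eq ⟨?_, ?_⟩
  · obtain ⟨n, hn, hnW⟩ := hWex
    exact ⟨n, hn, by rw [h1, hnW]⟩
  · rintro s ⟨n, hn, rfl⟩
    rw [h1]
    have h2 : (W : ℝ) ≤ wt b n := by exact_mod_cast hW n hn
    gcongr

theorem alpha_eq {r : ℕ} {a b : Fin 4 → ℕ} {k : ℕ} (hb : ∀ i, b i = k * a i % r) :
    (fun i => (b i : ℚ) / r) = alpha r a k := by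
  funext i
  rw [alpha, hb, ← Int.fract_div_natCast_eq_div_natCast_mod]
  push_cast
  rfl

theorem mem_weightSet_div {r : ℕ} (hr : 0 < r) {a b : Fin 4 → ℕ} {k : ℕ}
    (hab : ∀ i, b i ≡ k * a i [MOD r]) (hb : 0 < b 0) :
    (fun i => (b i : ℚ) / r) ∈ weightSet r a := by
  have hr' : (r : ℚ) ≠ 0 := by exact_mod_cast hr.ne'
  refine ⟨fun i => by positivity, fun h => ?_, k, fun i => ?_⟩
  · have h1 := congrFun h 0
    simp only [Pi.zero_apply, div_eq_zero_iff, Nat.cast_eq_zero] at h1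
    omega
  · obtain ⟨m, hm⟩ := Nat.modEq_iff_dvd.1 (hab i).symm
    refine ⟨m, ?_⟩
    have h2 : (b i : ℚ) - k * a i = r * m := by exact_mod_cast hm
    field_simp
    push_cast
    linarith

/-- The multiples `r v` of the weights `v ∈ N` are natural and proportional to `a` mod `r`. -/
theorem exists_nat_of_mem_weightSet {r : ℕ} (hr : 0 < r) {a : Fin 4 → ℕ} {v : Fin 4 → ℚ}
    (hv : v ∈ weightSet r a) :
    ∃ (j : ℕ) (b : Fin 4 → ℕ), (∀ i, b i ≡ j * a i [MOD r]) ∧ ∀ i, v i = (b i : ℚ) / r := by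
  obtain ⟨h0, -, j, hj⟩ := hv
  have hr' : (0 : ℚ) < r := by exact_mod_cast hr
  choose m hm using hj
  have h1 : ∀ i, (r : ℚ) * v i = (j * a i + r * m i : ℤ) := fun i => by
    rw [hm]
    push_cast
    field_simp
  have h2 : ∀ i, (0 : ℤ) ≤ j * a i + r * m i := fun i => by
    have h3 : (0 : ℚ) ≤ (j * a i + r * m i : ℤ) := h1 i ▸ mul_nonneg hr'.le (h0 i)
    exact_mod_cast h3
  choose b hb using fun i => Int.eq_ofNat_of_zero_le (h2 i)
  have hrz : (r : ℤ) ≠ 0 := by exact_mod_cast hr.ne'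
  obtain ⟨k, hk⟩ := Int.eq_ofNat_of_zero_le (Int.emod_nonneg j hrz)
  refine ⟨k, b, fun i => ?_, fun i => ?_⟩
  · rw [← Int.natCast_modEq_iff, ← hb]
    push_cast
    rw [← hk]
    calc j * (a i : ℤ) + r * m i ≡ j * a i [ZMOD r] := by
          rw [Int.ModEq, Int.add_mul_emod_self_left]
      _ ≡ j % r * a i [ZMOD r] := ((Int.mod_modEq j r).symm).mul_right _
  · rw [eq_div_iff hr'.ne', mul_comm, h1, hb]
    rfl

/-- The value (Σ bᵢ − W)/r of β = α_k cannot lie below 1: if β is primitive it would be in Ψ₁ ∩ N⁰,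
and hypothesis 3 would give r ∣ ke; if β = lv with l ≥ 2, the value is at least 2(5/6 + ε) > 1. It
is not 1 either, since Σ bᵢ − W ≡ k mod r. -/
theorem add_lt_sum_of_not_dvd {ε : ℝ} (hε : 0 < ε) {M r : ℕ} (hr : 0 < r) {a : Fin 4 → ℕ} {e : ℕ}
    {f : ConvSeries} (hsum : (∑ i, (a i : ℤ)) - (e : ℤ) ≡ 1 [ZMOD (r : ℤ)])
    (hS : SpecialAlternative M ε r a e f)
    (hfe : ∀ n, MvPowerSeries.coeff n f.1 ≠ 0 → wt a n ≡ e [MOD r])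
    (hkey : ∀ (j : ℕ) (b : Fin 4 → ℕ), (∀ i, 0 < b i) → (∀ i, b i ≡ j * a i [MOD r]) →
      ∀ W : ℕ, (∀ n, MvPowerSeries.coeff n f.1 ≠ 0 → W ≤ wt b n) →
        (5 / 6 + ε) * r ≤ ∑ i, (b i : ℝ) - W)
    {k : ℕ} (hk0 : 0 < k) (hkr : k < r) (hke : ¬ r ∣ k * e) {b : Fin 4 → ℕ} (hb : ∀ i, 0 < b i)
    (hab : ∀ i, b i = k * a i % r) {W : ℕ}
    (hW : ∀ n, MvPowerSeries.coeff n f.1 ≠ 0 → W ≤ wt b n)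
    (hWex : ∃ n, MvPowerSeries.coeff n f.1 ≠ 0 ∧ wt b n = W) :
    W + r < ∑ i, b i := by
  have hr' : (0 : ℝ) < r := by exact_mod_cast hr
  have hmod : ∀ i, b i ≡ k * a i [MOD r] := fun i => by rw [hab]; exact Nat.mod_modEq _ _
  by_contra! hcon
  have hne : ∑ i, b i ≠ W + r := by
    intro heq
    obtain ⟨n, hn, hnW⟩ := hWex
    have h1 : W ≡ k * e [MOD r] := hnW ▸ (wt_modEq hmod n).trans ((hfe n hn).mul_left k)
    have h2 : ∑ i, b i ≡ ∑ i, k * a i [MOD r] := Nat.ModEq.sum fun i _ => hmod i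
    rw [← Finset.mul_sum] at h2
    have h3 : ((k : ℤ) * ((∑ i, (a i : ℤ)) - e)) ≡ r [ZMOD r] := by
      have h4 : ((∑ i, b i : ℕ) : ℤ) - W ≡ (k * ∑ i, a i : ℕ) - (k * e : ℕ) [ZMOD r] :=
        ((Int.natCast_modEq_iff).2 h2).sub ((Int.natCast_modEq_iff).2 h1)
      rw [heq] at h4
      push_cast at h4
      rw [mul_sub]
      simpa using h4.symm
    have h5 : (k : ℤ) * 1 ≡ r [ZMOD r] := (hsum.symm.mul_left k).trans h3
    have h6 : (k : ℤ) ≡ 0 [ZMOD r] := by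
      rw [mul_one] at h5
      exact h5.trans (by simp [Int.ModEq])
    have h7 : r ∣ k := by exact_mod_cast Int.modEq_zero_iff_dvd.1 h6
    exact absurd (Nat.le_of_dvd hk0 h7) (by omega)
  have hlt : (∑ i, (b i : ℝ)) - W < r := by
    have h1 : ∑ i, b i < W + r := lt_of_le_of_ne hcon hne
    have h2 : (∑ i, (b i : ℝ)) < W + r := by exact_mod_cast h1
    linarith
  obtain ⟨β, hβ⟩ : ∃ β : Fin 4 → ℚ, β = fun i => (b i : ℚ) / r := ⟨_, rfl⟩
  have hβN : β ∈ weightSet r a := hβ ▸ mem_weightSet_div hr hmod (hb 0)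
  have hβsum : ((∑ i, β i : ℚ) : ℝ) - weight β f = ((∑ i, (b i : ℝ)) - W) / r := by
    rw [hβ, weight_div hW hWex]
    push_cast
    rw [← Finset.sum_div, sub_div]
  have hbr : ∀ i, b i < r := fun i => by rw [hab]; exact Nat.mod_lt _ hr
  by_cases hprim : IsPrimitive r a β
  · refine hke (hS.dvd_mul β ⟨⟨hprim, ?_, ?_⟩, hβN, fun i => ?_, fun h => ?_⟩ k hk0 hkr
      (hβ.trans (alpha_eq hab)))
    · rw [hβsum, le_div_iff₀ hr']
      exact hkey k b hb hmod W hW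
    · rw [hβsum, div_lt_one hr']
      exact hlt
    · rw [hβ]
      have h1 : (b i : ℚ) ≤ r := by exact_mod_cast (hbr i).le
      exact div_le_one_of_le₀ h1 (Nat.cast_nonneg r)
    · have hrq : (r : ℚ) ≠ 0 := by exact_mod_cast hr.ne'
      have hb0 := hb 0
      have hbr0 := hbr 0
      rcases h 0 with h | h
      · rw [hβ] at h
        simp only [div_eq_zero_iff, Nat.cast_eq_zero] at h
        omega
      · rw [hβ] at h
        simp only [div_eq_one_iff_eq hrq, Nat.cast_inj] at h
        omega
  · obtain ⟨l, hl, v, hv, hβv⟩ : ∃ l : ℕ, 2 ≤ l ∧ ∃ v ∈ weightSet r a, β = (l : ℚ) • v := by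
      by_contra! h
      exact hprim ⟨hβN, h⟩
    obtain ⟨j, b', hb', hvb'⟩ := exists_nat_of_mem_weightSet hr hv
    have hbb' : ∀ i, b i = l * b' i := fun i => by
      have h1 := congrFun hβv i
      have hrq : (r : ℚ) ≠ 0 := by exact_mod_cast hr.ne'
      rw [hβ] at h1
      simp only [Pi.smul_apply, smul_eq_mul, hvb'] at h1
      rw [← mul_div_assoc, div_left_inj' hrq] at h1
      exact_mod_cast h1
    have hbl : b = fun i => l * b' i := funext hbb'
    obtain ⟨n, hn, hnW⟩ := hWex
    rw [hbl, wt_mul_left] at hnW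
    have h1 := hkey j b' (fun i => Nat.pos_of_mul_pos_left (hbb' i ▸ hb i)) hb' (wt b' n)
      (fun m hm => by
        have h2 := hW m hm
        rw [hbl, wt_mul_left, ← hnW] at h2
        exact le_of_mul_le_mul_left h2 (by omega))
    have h3 : (∑ i, (b i : ℝ)) - W = l * (∑ i, (b' i : ℝ) - wt b' n) := by
      rw [← hnW, mul_sub, Finset.mul_sum]
      push_cast
      congr 1
      exact Finset.sum_congr rfl fun i _ => by rw [hbb' i]; push_cast; rfl
    have h4 : (2 : ℝ) ≤ l := by exact_mod_cast hl
    rw [h3] at hlt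
    nlinarith [mul_pos hε hr']

/-- The strict inequality for k gives b₁ + b₂ + b₃ − b₀ > r, and the one for r − k, whose residues
are r − bᵢ, gives b₁ + b₂ + b₃ − b₀ < 2r. Modulo r this number is k, because a₁ + a₂ + a₃ − a₀ ≡ Σ
aᵢ − e ≡ 1. -/
theorem residues_of_small {r : ℕ} (hr : 0 < r) {a : Fin 4 → ℕ} {e : ℕ} {f : ConvSeries}
    (hsum : (∑ i, (a i : ℤ)) - (e : ℤ) ≡ 1 [ZMOD (r : ℤ)]) (htwo : 2 * a 0 ≡ e [MOD r])
    (hcop : ∀ i, i ≠ 0 → Nat.Coprime (a i) r)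
    (hfe : ∀ n, MvPowerSeries.coeff n f.1 ≠ 0 → wt a n ≡ e [MOD r])
    (hf0 : MvPowerSeries.coeff (Finsupp.single 0 2) f.1 ≠ 0)
    (hlt : ∀ k, 0 < k → k < r → ¬ r ∣ k * e → ∀ b : Fin 4 → ℕ, (∀ i, 0 < b i) →
      (∀ i, b i = k * a i % r) → ∀ W : ℕ,
      (∀ n, MvPowerSeries.coeff n f.1 ≠ 0 → W ≤ wt b n) →
      (∃ n, MvPowerSeries.coeff n f.1 ≠ 0 ∧ wt b n = W) → W + r < ∑ i, b i)
    {k : ℕ} (hk0 : 0 < k) (hkr : k < r) (hke : ¬ r ∣ k * e) (hsmall : 2 * (k * a 0 % r) < r) :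
    k * a 1 % r + k * a 2 % r + k * a 3 % r = k * a 0 % r + r + k := by
  have hW2 : ∀ {j : ℕ} {b : Fin 4 → ℕ} {W : ℕ}, (∀ i, b i ≡ j * a i [MOD r]) →
      (∃ n, MvPowerSeries.coeff n f.1 ≠ 0 ∧ wt b n = W) → (r : ℤ) ∣ 2 * b 0 - W := by
    rintro j b W hab ⟨n, hn, hnW⟩
    have h1 : W ≡ j * e [MOD r] := hnW ▸ (wt_modEq hab n).trans ((hfe n hn).mul_left j)
    have h2 : 2 * b 0 ≡ j * e [MOD r] := by
      calc 2 * b 0 ≡ 2 * (j * a 0) [MOD r] := (hab 0).mul_left 2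
        _ = j * (2 * a 0) := by ring
        _ ≡ j * e [MOD r] := htwo.mul_left j
    exact_mod_cast Nat.modEq_iff_dvd.1 (h1.trans h2.symm)
  have hnd : ∀ i, ¬ r ∣ k * a i := by
    intro i hi
    by_cases h0 : i = 0
    · subst h0
      refine hke (((htwo.mul_left k).dvd_iff dvd_rfl).1 ?_)
      rw [mul_left_comm]
      exact hi.mul_left 2
    · exact absurd (Nat.le_of_dvd hk0 ((hcop i h0).symm.dvd_of_dvd_mul_right hi)) (by omega)
  obtain ⟨b, hb⟩ : ∃ b : Fin 4 → ℕ, ∀ i, b i = k * a i % r := ⟨_, fun _ => rfl⟩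
  have hbr : ∀ i, b i < r := fun i => by rw [hb]; exact Nat.mod_lt _ hr
  have hbpos : ∀ i, 0 < b i := fun i => by
    rw [hb]
    exact Nat.pos_of_ne_zero fun h => hnd i (Nat.dvd_of_mod_eq_zero h)
  have hmod : ∀ i, b i ≡ k * a i [MOD r] := fun i => by rw [hb]; exact Nat.mod_modEq _ _
  have hke' : ¬ r ∣ (r - k) * e := by
    intro h
    refine hke ?_
    have h1 : r ∣ (r - k) * e + k * e := by
      rw [← add_mul, Nat.sub_add_cancel hkr.le]
      exact dvd_mul_right _ _
    exact (Nat.dvd_add_right h).1 h1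
  have hb' : ∀ i, r - b i = (r - k) * a i % r := fun i => by
    have h1 : r - b i ≡ (r - k) * a i [MOD r] := by
      have h2 : (r - b i) + b i ≡ (r - k) * a i + k * a i [MOD r] := by
        rw [← add_mul, Nat.sub_add_cancel hkr.le, Nat.sub_add_cancel (hbr i).le]
        exact (Nat.modEq_zero_iff_dvd.2 dvd_rfl).trans
          (Nat.modEq_zero_iff_dvd.2 (dvd_mul_right _ _)).symm
      exact Nat.ModEq.add_right_cancel (hmod i) h2
    have h3 : r - b i < r := by have := hbpos i; omega
    rw [← Nat.mod_eq_of_lt h3]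
    exact h1
  rw [← hb 0] at hsmall
  simp only [← hb]
  obtain ⟨W, hW, hWex⟩ := exists_min_wt b ⟨_, hf0⟩
  obtain ⟨W', hW', hWex'⟩ := exists_min_wt (fun i => r - b i) ⟨_, hf0⟩
  have h1 := hlt k hk0 hkr hke b hbpos hb W hW hWex
  have h2 := hlt (r - k) (by omega) (by omega) hke' (fun i => r - b i)
    (fun i => by have := hbr i; omega) hb' W' hW' hWex'
  have h3 := hW _ hf0
  have h4 := hW' _ hf0
  have h5 := hW2 hmod hWex
  have h6 := hW2 (fun i => by rw [hb' i]; exact Nat.mod_modEq _ _) hWex'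
  rw [wt_single] at h3 h4
  rw [Fin.sum_univ_four] at h1 h2
  have hb0 := hbr 0
  have hb1 := hbr 1
  have hb2 := hbr 2
  have hb3 := hbr 3
  have hbpos0 := hbpos 0
  -- W ≤ 2b₀ < r and W ≡ 2b₀ mod r.
  have hWeq : W = 2 * b 0 := by
    have := Int.eq_zero_of_dvd_of_nonneg_of_lt (by omega) (by omega) h5
    omega
  -- Here W′ ≡ −2b₀ mod r and W′ ≥ 0, so W′ ≥ r − 2b₀ because 0 < 2b₀ < r.
  have hWge : r ≤ W' + 2 * b 0 := by
    obtain ⟨t, ht⟩ := h6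
    by_contra! hcon
    have h7 : (1 : ℤ) < t := by
      by_contra! h8
      have h9 : (r : ℤ) * t ≤ r * 1 := by gcongr
      push_cast [hb0.le] at ht
      omega
    have h9 : (r : ℤ) * 2 ≤ r * t := by gcongr; omega
    push_cast [hb0.le] at ht
    omega
  have h7 : (r : ℤ) ∣ (b 1 + b 2 + b 3 - b 0 - r) - k := by
    have h8 : ∀ i, (b i : ℤ) ≡ k * a i [ZMOD r] := fun i => by
      exact_mod_cast (Int.natCast_modEq_iff).2 (hmod i)
    have h9 : (e : ℤ) ≡ 2 * a 0 [ZMOD r] := by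
      exact_mod_cast ((Int.natCast_modEq_iff).2 htwo).symm
    have h10 : (b 1 + b 2 + b 3 - b 0 - r : ℤ) ≡ k * a 1 + k * a 2 + k * a 3 - k * a 0 - 0
        [ZMOD r] := ((((h8 1).add (h8 2)).add (h8 3)).sub (h8 0)).sub (by simp [Int.ModEq])
    have h11 : (k * a 1 + k * a 2 + k * a 3 - k * a 0 - 0 : ℤ) ≡ k [ZMOD r] := by
      have h12 : (k : ℤ) * ((∑ i, (a i : ℤ)) - 2 * a 0) ≡ k * 1 [ZMOD r] :=
        (((Int.ModEq.refl _).sub h9.symm).trans hsum).mul_left k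
      rw [Fin.sum_univ_four] at h12
      rw [mul_one] at h12
      convert h12 using 1
      ring
    exact (h10.trans h11).symm.dvd
  have h8 := Int.eq_zero_of_abs_lt_dvd h7 (by rw [abs_lt]; constructor <;> omega)
  omega

end MinimalWeight

end Hyperquotient

namespace Hyperquotient

/-! ### Exclusion of the odd type and conclusion -/

section Main

/-- From x₁² in f comes d ∣ 2a₁ for d = gcd(a₀, r), so d or d/2 divides a₀, a₁ and r. It exceeds 1
because d ≥ 7, against `eq_one_of_dvd_of_isOddType`. -/
theorem not_isOddType {ε : ℝ} {M r : ℕ} {a : Fin 4 → ℕ} {e : ℕ} {f : ConvSeries}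
    (hX : IsHyperquotientSingularity ε r a e f) (hS : SpecialAlternative M ε r a e f) :
    ¬ IsOddType r a f := by
  intro hodd
  have hr : 0 < r := lt_of_le_of_lt (Nat.zero_le _) (hX.a_lt 0)
  obtain ⟨g, hfg, hg⟩ := hodd.2
  have h1 : MvPowerSeries.coeff (Finsupp.single 1 2) f.1 ≠ 0 := by
    have h2 : MvPowerSeries.coeff (Finsupp.single 1 2) f.1 =
        MvPowerSeries.coeff (Finsupp.single 1 2) (coord 0 ^ 2).1 +
          MvPowerSeries.coeff (Finsupp.single 1 2) (coord 1 ^ 2).1 +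
          MvPowerSeries.coeff (Finsupp.single 1 2) g.1 := by
      rw [hfg]
      rfl
    have h3 : MvPowerSeries.coeff (Finsupp.single 1 2) g.1 = 0 := by
      by_contra h
      simpa using (hg _ h).2.1
    rw [h2, h3, coord_sq_coeff, coord_sq_coeff, if_neg (fun h => by
      simpa using DFunLike.congr_fun h 1), if_pos rfl]
    simp
  have h2 := wt_modEq_of_semiInvariant hr.ne' hX.semiInvariant h1
  rw [wt_single] at h2
  obtain ⟨d, hd⟩ : ∃ d, d = Nat.gcd (a 0) r := ⟨_, rfl⟩
  have hd7 : 7 ≤ d := hd ▸ hS.seven_le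
  have hdr : d ∣ r := hd ▸ Nat.gcd_dvd_right _ _
  have hd0 : d ∣ a 0 := hd ▸ Nat.gcd_dvd_left _ _
  have hde : d ∣ e := by
    rw [hd, hS.gcd_eq]
    exact Nat.gcd_dvd_left _ _
  have hd1 : d ∣ a 1 * 2 := (h2.dvd_iff hdr).2 hde
  obtain ⟨m, hm | hm⟩ := Nat.even_or_odd' d
  · have hmd : m ∣ d := ⟨2, by omega⟩
    have := eq_one_of_dvd_of_isOddType hr.ne' hX.indexOneCover.1 hodd (hmd.trans hdr)
      (hmd.trans hd0) (by
        rw [hm, mul_comm] at hd1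
        exact Nat.dvd_of_mul_dvd_mul_right two_pos hd1)
    omega
  · have hcop : Nat.Coprime d 2 := by
      rw [Nat.coprime_two_right, hm]
      exact odd_two_mul_add_one m
    have := eq_one_of_dvd_of_isOddType hr.ne' hX.indexOneCover.1 hodd hdr hd0
      (hcop.dvd_of_dvd_mul_right hd1)
    omega

/-- Under the special alternative the index `r` divides the weight `e` of the equation. -/
theorem index_eq_gcd {ε : ℝ} (hε₀ : 0 < ε) (hε₁ : ε < 1 / 6) {M r : ℕ} {a : Fin 4 → ℕ} {e : ℕ}
    {f : ConvSeries} (hX : IsHyperquotientSingularity ε r a e f)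
    (hsum : (∑ i, (a i : ℤ)) - (e : ℤ) ≡ 1 [ZMOD (r : ℤ)]) (hf : IsCDEType f)
    (hS : SpecialAlternative M ε r a e f) : r = Nat.gcd e r := by
  have hr : 0 < r := lt_of_le_of_lt (Nat.zero_le _) (hX.a_lt 0)
  obtain ⟨g, hfg, hg⟩ := hf
  have hg0 := fun n hn => (hg n hn).1
  have hg3 := fun n hn => (hg n hn).2
  have hfe : ∀ n, MvPowerSeries.coeff n f.1 ≠ 0 → wt a n ≡ e [MOD r] := fun n hn =>
    wt_modEq_of_semiInvariant hr.ne' hX.semiInvariant hn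
  have hge : ∀ n, MvPowerSeries.coeff n g.1 ≠ 0 → wt a n ≡ e [MOD r] := fun n hn =>
    hfe n (by rwa [coeff_eq_of_apply_zero hfg (hg0 n hn)])
  have hcop : ∀ i, i ≠ 0 → Nat.Coprime (a i) r := fun i hi =>
    coprime_of_isCDEType hr.ne' hX.indexOneCover.1 hfg hg0 hg3 hge hS.gcd_eq hi
  refine eq_gcd_of_residues hr hS.two_mul_modEq hS.gcd_eq hS.seven_le hcop
    fun k hk0 hkr hke hsmall => ?_
  refine residues_of_small hr hsum hS.two_mul_modEq hcop hfe (coeff_single_zero_ne_zero hfg hg0)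
    (fun k hk0 hkr hke b hb hab W hW hWex => ?_) hk0 hkr hke hsmall
  exact add_lt_sum_of_not_dvd hε₀ hr hsum hS hfe
    (fun j b hb hab W hW => weight_inequality hε₀ hε₁ hX hfg hg0 hg3 hge hS.two_mul_modEq hb hab hW)
    hk0 hkr hke hb hab hW hWex

end Main

end Hyperquotient

theorem mainTheorem8 (ε : ℝ) (hε₀ : 0 < ε) (hε₁ : ε < 1 / 6) (M : ℕ) :
    ∃ Γ : Finset ℕ, ∀ (r : ℕ) (a : Fin 4 → ℕ) (e : ℕ) (f : Hyperquotient.ConvSeries),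
      Hyperquotient.IsHyperquotientSingularity ε r a e f →
      (∑ i, (a i : ℤ)) - (e : ℤ) ≡ 1 [ZMOD (r : ℤ)] →
      (Hyperquotient.IsOddType r a f ∨ Hyperquotient.IsCDEType f) →
      Hyperquotient.SpecialAlternative M ε r a e f →
      r ∈ Γ := by
  -- Since r = gcd(e, r) ≤ M, the set {0, …, M} works.
  refine ⟨Finset.range (M + 1), fun r a e f hX hsum hf hS => ?_⟩
  rcases hf with hf | hf
  · exact absurd hf (Hyperquotient.not_isOddType hX hS)
  · have h1 := Hyperquotient.index_eq_gcd hε₀ hε₁ hX hsum hf hS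
    have h2 := hS.gcd_le
    rw [Finset.mem_range]
    omega
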